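/- Let $\mathbb{D}$ be a division ring of finite degree $d$ over a subfield $\mathbb{F}$ of its center. Assume that $\mathbb{D}$ is of quadratic type over $\mathbb{F}$ with associated pair $(\sigma,e)$, i.e. $\sigma$ is an antiautomorphism of the $\mathbb{F}$-algebra $\mathbb{D}$, $e:\mathbb{D}\to\mathbb{F}$ is $\mathbb{F}$-linear, and one of the following holds: (i) $d=1$, $\sigma=\mathrm{id}$ and $e$ is the trace of $\mathbb{D}$ over $\mathbb{F}$; (ii) $d=2$, $\mathbb{D}$ is a separable extension of $\mathbb{F}$, $\sigma$ is its non-identity automorphism and $e$ is the trace of $\mathbb{D}$ over $\mathbb{F}$; (iii) $\mathbb{D}$ is a quaternion algebra over $\mathbb{F}$ (in any characteristic; $d=4$), $\sigma$ is the quaternionic conjugation and $e(x)=x+\sigma(x)$ is the reduced trace; (iv) $\mathrm{char}(\mathbb{F})=2$, $d=2^k$ with $k\ge 1$, $\mathbb{D}$ is commutative with $x^2\in\mathbb{F}$ for all $x\in\mathbb{D}$, $\sigma=\mathrm{id}$, and $e$ is an arbitrary nonzero $\mathbb{F}$-linear form. Let $V$ be a right $\mathbb{D}$-vector space of finite dimension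 $n>0$, and assume $|\mathbb{F}|\ge nd$. Terminology. An $\mathbb{F}$-linear subspace $\mathcal{S}$ of $\mathrm{End}_{\mathbb{D}}(V)$ has $\mathbb{F}$-trivial spectrum if no element of $\mathcal{S}$ has a nonzero eigenvalue in $\mathbb{F}$; it is optimal if moreover it has the greatest possible $\mathbb{F}$-dimension among such subspaces. A flag of $V$ is a strictly increasing list $\{0\}=V_0\subset V_1\subset\cdots\subset V_p=V$ of $\mathbb{D}$-linear subspaces (not necessarily with $\dim V_i=i$). A $\sigma$-sesquilinear form on a right $\mathbb{D}$-vector space $W$ is a biadditive map $B:W\times W\to\mathbb{D}$ with $B(xa,y)=\sigma(a)B(x,y)$ and $B(x,ya)=B(x,y)a$ for all $a\in\mathbb{D}$; it is $e$-nonisotropic if $e(B(x,x))\neq0$ for all $x\in W\setminus\{0\}$. Forms $B$ on $W$ and $B'$ on $W'$ are equivalent if $B'(\psi(x),\psi(y))=B(x,y)$ for all $x,y\in W$, for some isomorphism $\psi:W\to W'$ of $\mathbb{D}$-vector spaces. For an $\mathbb{F}$-bilinear form $b$ on $W$, $\mathcal{A}_{b,\mathbb{D}}$ is the space of all $u\in\mathrm{End}_{\mathbb{D}}(W)$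 with $b(x,u(x))=0$ for all $x\in W$. Given a flag and $\mathcal{X}_i\subseteq\mathrm{End}_{\mathbb{D}}(V_i/V_{i-1})$ for $1\le i\le p$, the joint $\mathcal{X}_1\vee\cdots\vee\mathcal{X}_p$ is the set of all $u\in\mathrm{End}_{\mathbb{D}}(V)$ that leave every $V_i$ invariant and induce an element of $\mathcal{X}_i$ on $V_i/V_{i-1}$ for every $i$. (a) Let $\mathcal{S}$ be an optimal $\mathbb{F}$-trivial spectrum subspace of $\mathrm{End}_{\mathbb{D}}(V)$. Then the $\mathcal{S}$-invariant $\mathbb{D}$-linear subspaces of $V$ are exactly the members of a flag $V_0\subset\cdots\subset V_p$, and for each $i\in\{1,\dots,p\}$ there is an $e$-nonisotropic $\sigma$-sesquilinear form $B_i$ on $V_i/V_{i-1}$ such that, for $b_i:=e\circ B_i$, $$\mathcal{S}=\mathcal{A}_{b_1,\mathbb{D}}\vee\cdots\vee\mathcal{A}_{b_p,\mathbb{D}}.$$ Moreover each $B_i$ is uniquely determined by $\mathcal{S}$ up to multiplication by an element of $\mathbb{F}^\times$. (b) The equivalence class of each $B_i$ is determined, up to multiplication by an element of $\mathbb{F}^\times$,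 by the conjugacy class of $\mathcal{S}$: if $\mathcal{S}'=\varphi\mathcal{S}\varphi^{-1}$ for an automorphism $\varphi$ of the $\mathbb{D}$-vector space $V$, and flags $(V_i)_{0\le i\le p}$, $(V'_i)_{0\le i\le p'}$ and forms $(B_i)$, $(B'_i)$ are attached to the optimal subspaces $\mathcal{S}$, $\mathcal{S}'$ as in (a), then $p=p'$ and for each $i$ the form $B'_i$ is equivalent to $cB_i$ for some $c\in\mathbb{F}^\times$. (c) Conversely, for every flag $V_0\subset\cdots\subset V_p$ of $V$ and all $e$-nonisotropic $\sigma$-sesquilinear forms $B_i$ on $V_i/V_{i-1}$ ($1\le i\le p$), with $b_i:=e\circ B_i$, the space $\mathcal{A}_{b_1,\mathbb{D}}\vee\cdots\vee\mathcal{A}_{b_p,\mathbb{D}}$ is an optimal $\mathbb{F}$-trivial spectrum subspace of $\mathrm{End}_{\mathbb{D}}(V)$. -/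

import Mathlib

open Module MulOpposite
open scoped Quaternion

namespace TrivialSpectrum

/-! Right vector spaces over `D` are modules over `Dᵐᵒᵖ`: the product `x a` is `op a • x`.
An antiautomorphism of the `F`-algebra `D` is an isomorphism `Dᵐᵒᵖ ≃ₐ[F] D`: the image of `a`
is `σ (op a)`. -/

section AssociatedPairs

variable (F D : Type*) [Field F] [DivisionRing D] [Algebra F D]

/-- `D` has degree 2 over `F` and is a separable extension of `F`. -/
def IsSeparableQuadratic : Prop :=
  finrank F D = 2 ∧ Algebra.IsSeparable F D

/-- `D` is a hyper-radicial extension of `F`: the characteristic is 2, the degree is `2 ^ k` with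
`k ≥ 1`, `D` is commutative, and the square of every element of `D` lies in `F`. -/
def IsHyperRadicial : Prop :=
  CharP F 2 ∧ (∃ k : ℕ, 1 ≤ k ∧ finrank F D = 2 ^ k) ∧ (∀ x y : D, x * y = y * x) ∧
    ∀ x : D, ∃ c : F, x ^ 2 = algebraMap F D c

/-- The trace of `D` over `F`: the trace of `x ↦ a x`. -/
noncomputable def fullTrace (a : D) : F :=
  LinearMap.trace F D (LinearMap.mulLeft F a)

variable {F D}

/-- `D` is a quaternion algebra over `F` and `σ` is its quaternionic conjugation. The algebra
`ℍ[F,a,b,c]` is generated by `i, j` with `i² = a + b i`, `j² = c`, `i j + j i = b j`; it is a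
quaternion algebra (in every characteristic) exactly when `b² + 4 a ≠ 0` and `c ≠ 0`. -/
def IsQuaternionConjugation (σ : Dᵐᵒᵖ ≃ₐ[F] D) : Prop :=
  ∃ a b c : F, b ^ 2 + 4 * a ≠ 0 ∧ c ≠ 0 ∧
    ∃ φ : D ≃ₐ[F] ℍ[F,a,b,c], ∀ x : D, φ (σ (op x)) = star (φ x)

/-- `(σ, e)` is an associated pair for `D` over `F`; in particular `D` is of quadratic type.
The four cases are: `D = F`; separable quadratic extensions; quaternion algebras; hyper-radicial
extensions. -/
def IsAssociatedPair (σ : Dᵐᵒᵖ ≃ₐ[F] D) (e : D →ₗ[F] F) : Prop :=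
  (finrank F D = 1 ∧ (∀ x : D, σ (op x) = x) ∧ ∀ x : D, e x = fullTrace F D x) ∨
  (IsSeparableQuadratic F D ∧ (∃ x : D, σ (op x) ≠ x) ∧ ∀ x : D, e x = fullTrace F D x) ∨
  (IsQuaternionConjugation σ ∧ ∀ x : D, algebraMap F D (e x) = x + σ (op x)) ∨
  (IsHyperRadicial F D ∧ (∀ x : D, σ (op x) = x) ∧ e ≠ 0)

end AssociatedPairs

section Forms

variable {F D : Type*} [Field F] [DivisionRing D] [Algebra F D]

/-- The `σ`-sesquilinear forms on the right `D`-vector space `W`: the biadditive maps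
`B : W × W → D` with `B (x a) y = σ(a) B x y` and `B x (y a) = B x y a`. -/
abbrev SesquilinearForm (σ : Dᵐᵒᵖ ≃ₐ[F] D) (W : Type*) [AddCommGroup W] [Module Dᵐᵒᵖ W] :=
  W →ₛₗ[(σ : Dᵐᵒᵖ →+* D)] W →ₗ[Dᵐᵒᵖ] D

variable {W : Type*} [AddCommGroup W] [Module Dᵐᵒᵖ W]

/-- `B` is `e`-nonisotropic. -/
def IsNonisotropic {σ : Dᵐᵒᵖ ≃ₐ[F] D} (e : D →ₗ[F] F) (B : SesquilinearForm σ W) : Prop :=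
  ∀ x : W, x ≠ 0 → e (B x x) ≠ 0

variable [Module F W] [IsScalarTower F Dᵐᵒᵖ W]

theorem sesq_smul_left {σ : Dᵐᵒᵖ ≃ₐ[F] D} (B : SesquilinearForm σ W) (c : F) (x y : W) :
    B (c • x) y = c • B x y := by
  have h : (σ : Dᵐᵒᵖ →+* D) (algebraMap F Dᵐᵒᵖ c) = algebraMap F D c := σ.commutes c
  rw [← algebraMap_smul Dᵐᵒᵖ c x, LinearMap.map_smulₛₗ, h, LinearMap.smul_apply, algebraMap_smul]

theorem sesq_smul_right {σ : Dᵐᵒᵖ ≃ₐ[F] D} (B : SesquilinearForm σ W) (c : F) (x y : W) :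
    B x (c • y) = c • B x y := by
  rw [← algebraMap_smul Dᵐᵒᵖ c y, LinearMap.map_smul, algebraMap_smul]

/-- The `F`-bilinear form `e ∘ B`. -/
def formComp {σ : Dᵐᵒᵖ ≃ₐ[F] D} (e : D →ₗ[F] F) (B : SesquilinearForm σ W) :
    LinearMap.BilinForm F W :=
  LinearMap.mk₂ F (fun x y => e (B x y))
    (fun x x' y => by simp)
    (fun c x y => by rw [sesq_smul_left, map_smul])
    (fun x y y' => by simp)
    (fun c x y => by rw [sesq_smul_right, map_smul])

variable (D) in
/-- The space `𝒜_{b,D}` of all `D`-linear `b`-alternating endomorphisms of `W`. -/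
def altSpace (b : LinearMap.BilinForm F W) : Submodule F (Module.End Dᵐᵒᵖ W) where
  carrier := {u | ∀ x, b x (u x) = 0}
  add_mem' := by
    intro u v hu hv x
    simp [hu x, hv x]
  zero_mem' := by
    intro x
    simp
  smul_mem' := by
    intro c u hu x
    simp [hu x]

end Forms

section Spaces

variable {F D V : Type*} [Field F] [DivisionRing D] [Algebra F D]
  [AddCommGroup V] [Module Dᵐᵒᵖ V] [Module F V] [IsScalarTower F Dᵐᵒᵖ V]

/-- No element of `S` has a nonzero eigenvalue in `F`. -/
def HasTrivialSpectrum (S : Submodule F (Module.End Dᵐᵒᵖ V)) : Prop :=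
  ∀ u ∈ S, ∀ c : F, c ≠ 0 → ∀ x : V, u x = c • x → x = 0

/-- `S` has `F`-trivial spectrum and has the greatest dimension among the `F`-linear subspaces
with this property. -/
def IsOptimal (S : Submodule F (Module.End Dᵐᵒᵖ V)) : Prop :=
  HasTrivialSpectrum S ∧
    ∀ T : Submodule F (Module.End Dᵐᵒᵖ V), HasTrivialSpectrum T → finrank F T ≤ finrank F S

/-- `S' = φ S φ⁻¹` for some automorphism `φ` of the `D`-vector space `V`. -/
def AreConjugate (S S' : Submodule F (Module.End Dᵐᵒᵖ V)) : Prop :=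
  ∃ φ : V ≃ₗ[Dᵐᵒᵖ] V, ∀ v : Module.End Dᵐᵒᵖ V,
    v ∈ S' ↔ ∃ u ∈ S, v = φ.toLinearMap ∘ₗ u ∘ₗ φ.symm.toLinearMap

end Spaces

/-- A (possibly incomplete) flag `0 = V₀ ⊂ V₁ ⊂ ⋯ ⊂ V_p = V` of `D`-linear subspaces of `V`. -/
structure SubspaceFlag (D V : Type*) [DivisionRing D] [AddCommGroup V] [Module Dᵐᵒᵖ V] where
  length : ℕ
  space : Fin (length + 1) → Submodule Dᵐᵒᵖ V
  strictMono : StrictMono space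
  space_zero : space 0 = ⊥
  space_last : space (Fin.last length) = ⊤

namespace SubspaceFlag

variable {F D V : Type*} [Field F] [DivisionRing D] [Algebra F D]
  [AddCommGroup V] [Module Dᵐᵒᵖ V]

/-- The quotient `V_{i+1} / V_i`, for `0 ≤ i < p`. -/
abbrev Subquotient (𝒱 : SubspaceFlag D V) (i : Fin 𝒱.length) :=
  𝒱.space i.succ ⧸ (𝒱.space i.castSucc).submoduleOf (𝒱.space i.succ)

/-- `u` leaves all the members of the flag invariant. -/
def IsStable (𝒱 : SubspaceFlag D V) (u : Module.End Dᵐᵒᵖ V) : Prop :=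
  ∀ j, ∀ x ∈ 𝒱.space j, u x ∈ 𝒱.space j

/-- The endomorphism of `V_{i+1} / V_i` induced by `u`. -/
def induced (𝒱 : SubspaceFlag D V) (u : Module.End Dᵐᵒᵖ V) (hu : 𝒱.IsStable u)
    (i : Fin 𝒱.length) : Module.End Dᵐᵒᵖ (𝒱.Subquotient i) :=
  Submodule.mapQ _ _ (u.restrict (hu i.succ)) (fun x hx => hu i.castSucc x hx)

variable [Module F V] [IsScalarTower F Dᵐᵒᵖ V]

/-- The joint `X₁ ∨ ⋯ ∨ X_p`: all the endomorphisms of `V` that leave all the `V_i` invariant and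
induce elements of `X_i` on the successive quotients. -/
def joint (𝒱 : SubspaceFlag D V)
    (X : ∀ i : Fin 𝒱.length, Submodule F (Module.End Dᵐᵒᵖ (𝒱.Subquotient i))) :
    Submodule F (Module.End Dᵐᵒᵖ V) where
  carrier := {u | ∃ hu : 𝒱.IsStable u, ∀ i, 𝒱.induced u hu i ∈ X i}
  add_mem' := by
    rintro u v ⟨hu, hu'⟩ ⟨hv, hv'⟩
    refine ⟨fun j x hx => add_mem (hu j x hx) (hv j x hx), fun i => ?_⟩
    convert add_mem (hu' i) (hv' i) using 1
    ext x
    rfl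
  zero_mem' := by
    refine ⟨fun j x _ => zero_mem _, fun i => ?_⟩
    convert zero_mem (X i) using 1
    ext x
    rfl
  smul_mem' := by
    rintro c u ⟨hu, hu'⟩
    refine ⟨fun j x hx => (𝒱.space j).smul_of_tower_mem c (hu j x hx), fun i => ?_⟩
    convert (X i).smul_mem c (hu' i) using 1
    ext x
    rfl

/-- The members of the flag are exactly the `S`-invariant `D`-linear subspaces of `V`. -/
def IsInvariantFlag (𝒱 : SubspaceFlag D V) (S : Submodule F (Module.End Dᵐᵒᵖ V)) : Prop :=
  ∀ W : Submodule Dᵐᵒᵖ V, (∀ u ∈ S, ∀ x ∈ W, u x ∈ W) ↔ ∃ j, 𝒱.space j = W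

/-- `𝒜_{b₁,D} ∨ ⋯ ∨ 𝒜_{b_p,D}` with `b_i = e ∘ B_i`. -/
def altJoint (𝒱 : SubspaceFlag D V) {σ : Dᵐᵒᵖ ≃ₐ[F] D} (e : D →ₗ[F] F)
    (B : ∀ i : Fin 𝒱.length, SesquilinearForm σ (𝒱.Subquotient i)) :
    Submodule F (Module.End Dᵐᵒᵖ V) :=
  𝒱.joint fun i => altSpace D (formComp e (B i))

end SubspaceFlag

end TrivialSpectrum

namespace TrivialSpectrum

/-! ### Pencils of operators and linear families of forms over a large field. -/

section LinearAlgebra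

variable {F X Y E M : Type*} [Field F] [AddCommGroup X] [Module F X] [AddCommGroup Y] [Module F Y]
  [AddCommGroup E] [Module F E] [AddCommGroup M] [Module F M]

/-! Write d = [D : F], n = dim V and Sx = {u x : u ∈ S}. The proof rests on the bound dim S ≤ d
n(n+1)/2 − n for spaces with trivial spectrum (`HasTrivialSpectrum.finrank_le`) and on the study of
equality; spaces that attain it are called full. Take x with dim Sx maximal. As x ∉ Sx, dim Sx ≤ nd
− 1 < |F|, and a pencil argument (`mem_range_of_forall_mem_range_add_smul`) shows that operators of
S killing x have their range inside Sx. Hence the stabilizer of x acts faithfully on a D-hyperplane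
avoiding x, and induction on n gives the bound. If S is full, Sx must be an F-hyperplane ("x is
good").

The defect in the bound is additive along flags (`two_mul_finrank_joint`). So a full space is the
joint of the full spaces it induces on the quotients of a maximal invariant flag, and joints of full
spaces are full. Alternating spaces of nonisotropic forms are full (`isFull_altSpace`); therefore
the bound is always attained, optimal means full, the converse statement follows, and existence is
reduced to irreducible full spaces.

For irreducible S, induct on n. Let x be good and Sx = ker(e ∘ β). The stabilizer of x acts on ker β
as a full space that is again irreducible (`isIrreducible_restrictTo_stab`), hence as the
alternating space of some form B. The same B governs e(β(v y)) for v ∈ S with v x ∈ ker β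
(`exists_apply_eq_mul`), with a nonzero factor. It follows that every nonzero vector is good and
that Sx ∩ Sy ⊆ S(x+y). These incidences allow the linear forms with kernels Sx to be rescaled so as
to depend linearly on x (`exists_linear_family`). The resulting F-bilinear form is e ∘ B for a
σ-sesquilinear B, and S lies in its alternating space; fullness forces equality.

Uniqueness: the alternating space of a nonisotropic B determines ker e(B(x, ·)) as the orbit of each
x ≠ 0, so two forms with the same space are proportional at each x, and then globally. A conjugation
carries invariant subspaces to invariant subspaces, and pulling forms back reduces (b) to this
uniqueness. -/

theorem exists_add_smul_injective [FiniteDimensional F X] (f : X →ₗ[F] X)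
    (hF : (finrank F X : Cardinal) < Cardinal.mk F) :
    ∃ s : F, Function.Injective (f + s • (LinearMap.id : X →ₗ[F] X)) := by
  by_contra! h
  have h' : ∀ s : F, ∃ x : X, x ≠ 0 ∧ f x = s • x := by
    intro s
    have := h (-s)
    rw [← LinearMap.ker_eq_bot, ← ne_eq, Submodule.ne_bot_iff] at this
    obtain ⟨x, hx, hx0⟩ := this
    refine ⟨x, hx0, ?_⟩
    simpa [add_neg_eq_zero] using hx
  choose x hx0 hx using h'
  -- Every scalar would be an eigenvalue of f; independence of the eigenvectors then bounds |F| by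
  -- the dimension.
  have hli : LinearIndependent F x :=
    Module.End.eigenvectors_linearIndependent' f id Function.injective_id x
      fun s => ⟨Module.End.mem_eigenspace_iff.2 (hx s), hx0 s⟩
  have := hli.cardinal_lift_le_rank
  rw [← finrank_eq_rank] at this
  rw [← Cardinal.lift_lt] at hF
  simp only [Cardinal.lift_natCast] at this hF
  exact absurd this (not_le.2 hF)

/-- A vector lying in the range of all the operators `B + s A`, where `A` has the greatest rank
among them, lies in the range of `A`. -/
theorem mem_range_of_forall_mem_range_add_smul [FiniteDimensional F Y] (A B : X →ₗ[F] Y)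
    (hF : (finrank F (LinearMap.range A) : Cardinal) < Cardinal.mk F)
    (hr : ∀ s : F, finrank F (LinearMap.range (B + s • A)) ≤ finrank F (LinearMap.range A))
    {w : Y} (hw : ∀ s : F, w ∈ LinearMap.range (B + s • A)) : w ∈ LinearMap.range A := by
  by_contra hwn
  obtain ⟨g, hg⟩ := A.rangeRestrict.exists_rightInverse_of_surjective A.range_rangeRestrict
  obtain ⟨P₀, hP₀⟩ := (LinearMap.range A).subtype.exists_leftInverse_of_injective
    (Submodule.ker_subtype _)
  obtain ⟨l, hl, hlA⟩ := Submodule.exists_le_ker_of_notMem hwn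
  -- The correction by `l` turns an arbitrary projection onto the range of `A` into one that also
  -- kills `w`.
  let P : Y →ₗ[F] LinearMap.range A := P₀ - l.smulRight ((l w)⁻¹ • P₀ w)
  have hPA : ∀ y : LinearMap.range A, P y = y := by
    intro y
    have h1 : P₀ (y : Y) = y := LinearMap.congr_fun hP₀ y
    have h2 : l (y : Y) = 0 := hlA y.2
    simp [P, h1, h2]
  have hPw : P w = 0 := by
    simp [P, smul_smul, hl]
  -- For this s, P maps the range of B + sA onto that of A and has w in its kernel there, so B + sA
  -- has greater rank than A.
  obtain ⟨s, hs⟩ := exists_add_smul_injective (P ∘ₗ B ∘ₗ g) hF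
  have hs' := LinearMap.injective_iff_surjective.1 hs
  have hw' := hw s
  set R := LinearMap.range (B + s • A) with hR
  have hsurj : Function.Surjective (P.domRestrict R) := by
    intro z
    obtain ⟨y, rfl⟩ := hs' z
    refine ⟨⟨(B + s • A) (g y), LinearMap.mem_range_self _ _⟩, ?_⟩
    have h3 : A (g y) = y := congrArg Subtype.val (LinearMap.congr_fun hg y)
    simp [LinearMap.domRestrict_apply, h3, hPA]
  have h4 := (P.domRestrict R).finrank_range_add_finrank_ker
  rw [LinearMap.range_eq_top.2 hsurj, finrank_top] at h4
  have h5 : 0 < finrank F (LinearMap.ker (P.domRestrict R)) := by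
    apply finrank_pos_iff_exists_ne_zero.2
    refine ⟨⟨⟨w, hw'⟩, by simpa using hPw⟩, ?_⟩
    intro h
    apply hwn
    have : w = 0 := by simpa using congrArg Subtype.val (congrArg Subtype.val h)
    rw [this]
    exact zero_mem _
  have h6 := hr s
  rw [← hR] at h6
  omega

theorem exists_smul_eq_of_ker_le (φ ψ : E →ₗ[F] F) (h : ∀ w, φ w = 0 → ψ w = 0) :
    ∃ c : F, ψ = c • φ := by
  by_cases hφ : ∀ w, φ w = 0
  · exact ⟨0, by ext w; simpa using h w (hφ w)⟩
  push Not at hφ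
  obtain ⟨w, hw⟩ := hφ
  refine ⟨ψ w / φ w, ?_⟩
  ext z
  have := h (z - (φ z / φ w) • w) (by simp [hw])
  simp only [map_sub, map_smul, smul_eq_mul, sub_eq_zero] at this
  simp only [LinearMap.smul_apply, smul_eq_mul, this]
  ring

theorem exists_smul_add_smul_of_ker_inf_le (φ ψ χ : E →ₗ[F] F)
    (h : ∀ w, φ w = 0 → ψ w = 0 → χ w = 0) : ∃ a b : F, χ = a • φ + b • ψ := by
  have := mem_span_of_iInf_ker_le_ker (L := ![φ, ψ]) (K := χ) (by
    intro w hw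
    simp only [Submodule.mem_iInf, LinearMap.mem_ker] at hw ⊢
    exact h w (hw 0) (hw 1))
  rw [Matrix.range_cons, Matrix.range_cons, Matrix.range_empty, Set.union_empty,
    Set.singleton_union, Submodule.mem_span_pair] at this
  obtain ⟨a, b, hab⟩ := this
  exact ⟨a, b, hab.symm⟩

/-- Two linear maps, one of which is injective, are proportional if they are so pointwise. -/
theorem exists_smul_eq_of_forall_exists (f g : E →ₗ[F] M) (hg : Function.Injective g)
    (h : ∀ x, ∃ c : F, f x = c • g x) : ∃ c : F, ∀ x, f x = c • g x := by
  choose c hc using h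
  by_cases hE : ∀ x : E, x = 0
  · exact ⟨0, fun x => by simp [hE x]⟩
  push Not at hE
  obtain ⟨x₀, hx₀⟩ := hE
  refine ⟨c x₀, fun x => ?_⟩
  by_cases hx : ∃ t : F, x = t • x₀
  · obtain ⟨t, rfl⟩ := hx
    rw [map_smul, map_smul, hc x₀, smul_comm]
  · have h1 := hc (x + x₀)
    rw [map_add, map_add, hc x, hc x₀] at h1
    have h2 : (c x - c (x + x₀)) • x = (c (x + x₀) - c x₀) • x₀ := by
      apply hg
      rw [sub_smul, sub_smul, map_sub, map_sub, map_smul, map_smul, map_smul, map_smul,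
        sub_eq_sub_iff_add_eq_add, h1, smul_add, add_comm]
    have h3 : c x - c (x + x₀) = 0 := by
      by_contra h4
      apply hx
      refine ⟨(c x - c (x + x₀))⁻¹ * (c (x + x₀) - c x₀), ?_⟩
      rw [mul_smul, ← h2, smul_smul, inv_mul_cancel₀ h4, one_smul]
    rw [h3, zero_smul, eq_comm, smul_eq_zero] at h2
    rw [hc x, sub_eq_zero.1 h3, sub_eq_zero.1 (h2.resolve_right hx₀)]

/-- A family of linear forms `φ x`, such that `φ x` defines the subspace `S x` and that satisfies
two incidence conditions, can be rescaled to depend linearly on `x`. -/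
theorem exists_linear_family (S : Set (E →ₗ[F] E)) (φ : E → E →ₗ[F] F)
    (hφ : ∀ x, x ≠ 0 → φ x ≠ 0) (hker : ∀ x, x ≠ 0 → ∀ v ∈ S, φ x (v x) = 0)
    (h1 : ∀ x y, x ≠ 0 → y ≠ 0 → (∀ v ∈ S, φ x (v y) = 0) → ∃ c : F, y = c • x)
    (h2 : ∀ x y, (∀ s t : F, s • x + t • y = 0 → s = 0 ∧ t = 0) →
      ∀ w, φ x w = 0 → φ y w = 0 → φ (x + y) w = 0) :
    ∃ Φ : E →ₗ[F] E →ₗ[F] F, (∀ x, ∀ v ∈ S, Φ x (v x) = 0) ∧ ∀ x, Φ x = 0 → x = 0 := by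
  classical
  by_cases hE : ∀ x : E, x = 0
  · exact ⟨0, fun x v _ => by simp, fun x _ => hE x⟩
  push Not at hE
  obtain ⟨x₁, hx₁⟩ := hE
  have hne : ∀ x y : E, (∀ s t : F, s • x + t • y = 0 → s = 0 ∧ t = 0) →
      x ≠ 0 ∧ y ≠ 0 ∧ x + y ≠ 0 := by
    intro x y h
    refine ⟨?_, ?_, ?_⟩
    · rintro rfl
      exact one_ne_zero (h 1 0 (by simp)).1
    · rintro rfl
      exact one_ne_zero (h 0 1 (by simp)).2
    · intro h'
      exact one_ne_zero (h 1 1 (by simpa using h')).1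
  -- If one coefficient vanished, φ (x + y) would kill v y (or v x) for all v ∈ S, and `h1` would
  -- make y (or x) a multiple of x + y.
  have hcomb : ∀ x y : E, (∀ s t : F, s • x + t • y = 0 → s = 0 ∧ t = 0) →
      ∃ a : F, a ≠ 0 ∧ ∃ c : F, c ≠ 0 ∧ φ (x + y) = a • φ x + c • φ y := by
    intro x y h
    obtain ⟨hx, hy, hxy⟩ := hne x y h
    obtain ⟨a, c, hac⟩ := exists_smul_add_smul_of_ker_inf_le (φ x) (φ y) (φ (x + y)) (h2 x y h)
    refine ⟨a, ?_, c, ?_, hac⟩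
    · rintro rfl
      obtain ⟨k, hk⟩ := h1 (x + y) y hxy hy (fun v hv => by
        rw [hac]
        simp [hker y hy v hv])
      have h3 := h k (k - 1) (by
        rw [sub_smul, one_smul, add_sub, ← smul_add, ← hk, sub_self])
      rw [h3.1] at h3
      simp at h3
    · rintro rfl
      obtain ⟨k, hk⟩ := h1 (x + y) x hxy hx (fun v hv => by
        rw [hac]
        simp [hker x hx v hv])
      have h3 := h (k - 1) k (by
        rw [sub_smul, one_smul, sub_add_eq_add_sub, ← smul_add, ← hk, sub_self])
      rw [h3.2] at h3
      simp at h3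
  let b := Basis.ofVectorSpace F E
  have hb0 : ∀ i, b i ≠ 0 := fun i => b.ne_zero i
  have : Nontrivial E := ⟨⟨x₁, 0, hx₁⟩⟩
  obtain ⟨o⟩ := b.index_nonempty
  -- Normalize against a base vector: each φ (b i) is rescaled to ψ i so that φ (b o + b i) is
  -- proportional to φ (b o) + ψ i.
  have hψ : ∀ i, ∃ ψ : E →ₗ[F] F, (∀ v ∈ S, ψ (v (b i)) = 0) ∧
      (∃ c : F, c ≠ 0 ∧ ψ = c • φ (b i)) ∧ (i = o → ψ = φ (b o)) ∧
      (i ≠ o → ∃ a : F, a ≠ 0 ∧ φ (b o + b i) = a • (φ (b o) + ψ)) := by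
    intro i
    by_cases hi : i = o
    · subst hi
      exact ⟨φ (b i), hker _ (hb0 i), ⟨1, one_ne_zero, by simp⟩, fun _ => rfl, fun h => absurd rfl h⟩
    · obtain ⟨a, ha, c, hc, hac⟩ := hcomb (b o) (b i) (by
        intro s t hst
        have h3 := congrArg (b.coord o) hst
        have h4 := congrArg (b.coord i) hst
        simp [hi, Ne.symm hi] at h3 h4
        exact ⟨h3, h4⟩)
      refine ⟨(a⁻¹ * c) • φ (b i), fun v hv => ?_, ⟨a⁻¹ * c, mul_ne_zero (inv_ne_zero ha) hc, rfl⟩,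
        fun h => absurd h hi, fun _ => ⟨a, ha, ?_⟩⟩
      · simp [hker _ (hb0 i) v hv]
      · rw [hac, smul_add, smul_smul, mul_inv_cancel_left₀ ha]
  choose ψ hψ0 hψc hψo hψi using hψ
  have ho : ∀ i, ∀ v ∈ S, φ (b o) (v (b i)) + ψ i (v (b o)) = 0 := by
    intro i v hv
    by_cases hi : i = o
    · subst hi
      rw [hψo i rfl, hker _ (hb0 i) v hv, add_zero]
    · obtain ⟨a, ha, hai⟩ := hψi i hi
      have h3 := hker (b o + b i) (by
        intro h
        have h3 := congrArg (b.coord o) h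
        simp [hi] at h3) v hv
      rw [hai, LinearMap.smul_apply, smul_eq_zero] at h3
      have h4 := h3.resolve_left ha
      simp only [map_add, LinearMap.add_apply, hker _ (hb0 o) v hv, hψ0 i v hv] at h4
      linear_combination h4
  have hij : ∀ i j, ∀ v ∈ S, ψ i (v (b j)) + ψ j (v (b i)) = 0 := by
    intro i j v hv
    by_cases hi : i = o
    · subst hi
      rw [hψo i rfl]
      exact ho j v hv
    by_cases hj : j = o
    · subst hj
      rw [hψo j rfl, add_comm]
      exact ho i v hv
    by_cases hij : i = j
    · subst hij
      simp [hψ0 i v hv]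
    have hindep : ∀ k l, k ≠ o → l ≠ o → k ≠ l →
        ∀ s t : F, s • (b o + b k) + t • b l = 0 → s = 0 ∧ t = 0 := by
      intro k l hk hl hkl s t hst
      have h3 := congrArg (b.coord o) hst
      have h4 := congrArg (b.coord l) hst
      simp [hk, hl, hkl, Ne.symm hl] at h3 h4
      exact ⟨h3, h4⟩
    have key : ∀ k l, k ≠ o → l ≠ o → k ≠ l → ∃ s : F, s ≠ 0 ∧ ∃ t : F,
        φ (b o + b k + b l) = s • (φ (b o) + ψ k) + t • ψ l := by
      intro k l hk hl hkl
      obtain ⟨a, ha, c, hc, hac⟩ := hcomb (b o + b k) (b l) (hindep k l hk hl hkl)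
      obtain ⟨a', ha', hak⟩ := hψi k hk
      obtain ⟨c', hc', hcl⟩ := hψc l
      refine ⟨a * a', mul_ne_zero ha ha', c * c'⁻¹, ?_⟩
      rw [hac, hak, hcl, smul_smul, smul_smul, inv_mul_cancel_right₀ hc']
    -- The form attached to b o + b i + b j is expanded in two ways; comparison will show that it is
    -- s (φ (b o) + ψ i + ψ j), which gives the antisymmetry in i and j.
    obtain ⟨s, hs, t, hst⟩ := key i j hi hj hij
    obtain ⟨s', hs', t', hst'⟩ := key j i hj hi (Ne.symm hij)
    rw [add_right_comm, hst] at hst'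
    have hrel : (s - s') • φ (b o) + (s - t') • ψ i + (t - s') • ψ j = 0 := by
      have : (s - s') • φ (b o) + (s - t') • ψ i + (t - s') • ψ j =
        (s • (φ (b o) + ψ i) + t • ψ j) - (s' • (φ (b o) + ψ j) + t' • ψ i) := by module
      rw [this, hst', sub_self]
    have h5 : s = t' ∧ t = s' := by
      -- No independence of the three forms is assumed. Evaluating the relation at v (b o) shows
      -- that φ (b o) kills all v y, so y is a multiple of b o by `h1`, and its coefficients vanish.
      set y := (s - t') • b i + (t - s') • b j with hy
      have hyv : ∀ v ∈ S, φ (b o) (v y) = 0 := by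
        intro v hv
        have h6 := LinearMap.congr_fun hrel (v (b o))
        have h7 := ho i v hv
        have h8 := ho j v hv
        simp only [LinearMap.add_apply, LinearMap.smul_apply, smul_eq_mul, LinearMap.zero_apply,
          hker _ (hb0 o) v hv] at h6
        simp only [hy, map_add, map_smul, smul_eq_mul]
        linear_combination (s - t') * h7 + (t - s') * h8 - h6
      have hyo : ∃ k : F, y = k • b o := by
        by_cases hy0 : y = 0
        · exact ⟨0, by simp [hy0]⟩
        · exact h1 _ _ (hb0 o) hy0 hyv
      obtain ⟨k, hk⟩ := hyo
      rw [hy] at hk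
      have h3 := congrArg (b.coord i) hk
      have h4 := congrArg (b.coord j) hk
      simp [hij, Ne.symm hij, Ne.symm hi, Ne.symm hj] at h3 h4
      exact ⟨sub_eq_zero.1 h3, sub_eq_zero.1 h4⟩
    have h6 : s = s' := by
      rw [h5.1, h5.2] at hrel
      simp only [sub_self, zero_smul, add_zero, smul_eq_zero] at hrel
      rw [h5.1]
      exact sub_eq_zero.1 (hrel.resolve_right (hφ _ (hb0 o)))
    have h7 := hker (b o + b i + b j) (by
      intro h
      have h3 := congrArg (b.coord j) h
      simp [Ne.symm hj, hij] at h3) v hv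
    rw [hst, h5.2, ← h6] at h7
    simp only [map_add, LinearMap.add_apply, LinearMap.smul_apply, smul_eq_mul,
      hker _ (hb0 o) v hv, hψ0 i v hv, hψ0 j v hv] at h7
    apply mul_left_cancel₀ hs
    linear_combination h7 - s * ho i v hv - s * ho j v hv
  let Φ : E →ₗ[F] E →ₗ[F] F := b.constr F ψ
  have hΦb : ∀ i, Φ (b i) = ψ i := fun i => b.constr_basis F ψ i
  have hanti : ∀ v ∈ S, ∀ x y, Φ x (v y) + Φ y (v x) = 0 := by
    intro v hv
    have : Φ.compl₂ v + (Φ.compl₂ v).flip = 0 := by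
      apply b.ext
      intro i
      apply b.ext
      intro j
      simp [hΦb, hij i j v hv]
    intro x y
    simpa using LinearMap.congr_fun (LinearMap.congr_fun this x) y
  have hΦ : ∀ x, ∀ v ∈ S, Φ x (v x) = 0 := by
    intro x v hv
    have hx : x ∈ Submodule.span F (Set.range b) := by simp [b.span_eq]
    induction hx using Submodule.span_induction with
    | mem x hx =>
      obtain ⟨i, rfl⟩ := hx
      rw [hΦb, hψ0 i v hv]
    | zero => simp
    | add x y _ _ hx hy =>
      have := hanti v hv x y
      simp only [map_add, LinearMap.add_apply, hx, hy]
      linear_combination this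
    | smul c x _ hx => simp [hx]
  refine ⟨Φ, hΦ, fun x hx => ?_⟩
  by_contra hx0
  obtain ⟨c, hc⟩ := h1 (b o) x (hb0 o) hx0 (fun v hv => by
    have := hanti v hv x (b o)
    rw [hx, hΦb, hψo o rfl] at this
    simpa using this)
  rw [hc, map_smul, hΦb, hψo o rfl, smul_eq_zero] at hx
  rcases hx with h | h
  · exact hx0 (by rw [hc, h, zero_smul])
  · exact hφ _ (hb0 o) h

end LinearAlgebra

/-! ### Common properties of the four kinds of associated pairs. -/

section QuadraticPairs

variable {F D : Type*} [Field F] [DivisionRing D] [Algebra F D]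

/-- The properties of an associated pair `(σ, e)` that hold in all the four cases. -/
structure IsQuadraticPair (σ : Dᵐᵒᵖ ≃ₐ[F] D) (e : D →ₗ[F] F) : Prop where
  invol : ∀ x : D, σ (op (σ (op x))) = x
  norm_mem : ∀ x : D, ∃ q : F, σ (op x) * x = algebraMap F D q
  mul_comm : ∀ x y : D, e (x * y) = e (y * x)
  apply_conj : ∀ x : D, e (σ (op x)) = e x
  ne_zero : e ≠ 0

theorem conj_mul (σ : Dᵐᵒᵖ ≃ₐ[F] D) (x y : D) : σ (op (x * y)) = σ (op y) * σ (op x) := by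
  rw [op_mul, map_mul]

theorem conj_add (σ : Dᵐᵒᵖ ≃ₐ[F] D) (x y : D) : σ (op (x + y)) = σ (op x) + σ (op y) := by
  rw [op_add, map_add]

theorem conj_smul (σ : Dᵐᵒᵖ ≃ₐ[F] D) (c : F) (x : D) : σ (op (c • x)) = c • σ (op x) := by
  rw [op_smul, map_smul]

theorem conj_ne_zero (σ : Dᵐᵒᵖ ≃ₐ[F] D) {x : D} (hx : x ≠ 0) : σ (op x) ≠ 0 := by
  simpa using hx

namespace IsQuadraticPair

variable {σ : Dᵐᵒᵖ ≃ₐ[F] D} {e : D →ₗ[F] F}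

theorem exists_norm (h : IsQuadraticPair σ e) {x : D} (hx : x ≠ 0) :
    ∃ q : F, q ≠ 0 ∧ σ (op x) * x = algebraMap F D q ∧ x * σ (op x) = algebraMap F D q := by
  obtain ⟨q, hq⟩ := h.norm_mem x
  refine ⟨q, ?_, hq, ?_⟩
  · rintro rfl
    rw [map_zero, mul_eq_zero] at hq
    exact hq.elim (conj_ne_zero σ hx) hx
  · apply mul_right_cancel₀ hx
    rw [mul_assoc, hq, Algebra.commutes]

/-- Cyclicity of e moves x to the front, where x σ(x) is a scalar. This is what makes conjugation by
x harmless for the vanishing of e. -/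
theorem exists_apply_conj_mul_mul (h : IsQuadraticPair σ e) {x : D} (hx : x ≠ 0) :
    ∃ q : F, q ≠ 0 ∧ ∀ a, e (σ (op x) * a * x) = q * e a := by
  obtain ⟨q, hq, -, hq'⟩ := h.exists_norm hx
  refine ⟨q, hq, fun a => ?_⟩
  rw [h.mul_comm, ← mul_assoc, hq', ← Algebra.smul_def, map_smul, smul_eq_mul]

theorem apply_conj_mul_mul_eq_zero (h : IsQuadraticPair σ e) (x : D) {a : D} (ha : e a = 0) :
    e (σ (op x) * a * x) = 0 := by
  by_cases hx : x = 0
  · simp [hx]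
  · obtain ⟨q, -, hq⟩ := h.exists_apply_conj_mul_mul hx
    rw [hq, ha, mul_zero]

theorem exists_inv_eq (h : IsQuadraticPair σ e) {x : D} (hx : x ≠ 0) :
    ∃ q : F, q ≠ 0 ∧ x⁻¹ = q • σ (op x) := by
  obtain ⟨q, hq, hq', -⟩ := h.exists_norm hx
  refine ⟨q⁻¹, inv_ne_zero hq, ?_⟩
  rw [eq_comm, ← mul_eq_one_iff_eq_inv₀ hx, smul_mul_assoc, hq', Algebra.smul_def, ← map_mul,
    inv_mul_cancel₀ hq, map_one]

end IsQuadraticPair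

theorem exists_apply_ne_zero {e : D →ₗ[F] F} (he : e ≠ 0) : ∃ a, e a ≠ 0 := by
  by_contra! h
  exact he (LinearMap.ext h)

/-- The F-bilinear form (s, t) ↦ e(st) is nondegenerate because tD = D for t ≠ 0. This is the device
for passing from identities under e to identities in D. -/
theorem eq_zero_of_forall_apply_mul {e : D →ₗ[F] F} (he : e ≠ 0) {t : D}
    (h : ∀ a, e (t * a) = 0) : t = 0 := by
  by_contra ht
  obtain ⟨a, ha⟩ := exists_apply_ne_zero he
  apply ha
  have := h (t⁻¹ * a)
  rwa [mul_inv_cancel_left₀ ht] at this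

theorem isQuadraticPair_of_finrank_eq_one {σ : Dᵐᵒᵖ ≃ₐ[F] D} {e : D →ₗ[F] F}
    (hd : finrank F D = 1) (hσ : ∀ x, σ (op x) = x) (he : ∀ x, e x = fullTrace F D x) :
    IsQuadraticPair σ e := by
  have hF : ∀ x : D, ∃ c : F, x = algebraMap F D c := by
    intro x
    obtain ⟨c, hc⟩ := (finrank_eq_one_iff_of_nonzero' (1 : D) one_ne_zero).1 hd x
    exact ⟨c, by rw [← hc, Algebra.algebraMap_eq_smul_one]⟩
  refine ⟨fun x => by rw [hσ, hσ], fun x => ?_, fun x y => ?_, fun x => by rw [hσ], ?_⟩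
  · obtain ⟨c, rfl⟩ := hF x
    exact ⟨c * c, by rw [hσ, map_mul]⟩
  · obtain ⟨c, rfl⟩ := hF x
    rw [Algebra.commutes]
  · intro h
    have h1 := he 1
    have : FiniteDimensional F D := FiniteDimensional.of_finrank_pos (by omega)
    have : LinearMap.mulLeft F (1 : D) = LinearMap.id := by ext; simp
    rw [h, fullTrace, this, LinearMap.trace_id, hd] at h1
    simp at h1

theorem isQuadraticPair_of_isHyperRadicial {σ : Dᵐᵒᵖ ≃ₐ[F] D} {e : D →ₗ[F] F}
    (hD : IsHyperRadicial F D) (hσ : ∀ x, σ (op x) = x) (he : e ≠ 0) :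
    IsQuadraticPair σ e := by
  obtain ⟨-, -, hcomm, hsq⟩ := hD
  refine ⟨fun x => by rw [hσ, hσ], fun x => ?_, fun x y => by rw [hcomm], fun x => by rw [hσ], he⟩
  obtain ⟨c, hc⟩ := hsq x
  exact ⟨c, by rw [hσ, ← hc, sq]⟩

theorem isQuadraticPair_of_isQuaternionConjugation {σ : Dᵐᵒᵖ ≃ₐ[F] D} {e : D →ₗ[F] F}
    (hσ : IsQuaternionConjugation σ) (he : ∀ x : D, algebraMap F D (e x) = x + σ (op x)) :
    IsQuadraticPair σ e := by
  obtain ⟨a, b, c, hab, hc, φ, hφ⟩ := hσ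
  have hinj : Function.Injective (algebraMap F D) := (algebraMap F D).injective
  have hinv : ∀ x : D, σ (op (σ (op x))) = x := by
    intro x
    apply φ.injective
    rw [hφ, hφ, star_star]
  refine ⟨hinv, fun x => ?_, fun x y => ?_, fun x => ?_, ?_⟩
  · refine ⟨(star (φ x) * φ x).re, ?_⟩
    apply φ.injective
    rw [map_mul, hφ, AlgEquiv.commutes]
    exact QuaternionAlgebra.star_mul_eq_coe _
  · apply hinj
    apply φ.injective
    rw [he, he, map_add, map_add, hφ, hφ, map_mul, map_mul]
    ext <;> simp <;> ring
  · apply hinj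
    rw [he, he, hinv, add_comm]
  · rintro rfl
    have h0 : ∀ z : ℍ[F,a,b,c], z + star z = 0 := by
      intro z
      obtain ⟨x, rfl⟩ := φ.surjective z
      rw [← hφ, ← map_add, ← he]
      simp
    -- The traces of 1 and i are 2 and b; if both vanish, so does b² + 4a.
    have h1 := congrArg QuaternionAlgebra.re (h0 ⟨1, 0, 0, 0⟩)
    have h2 := congrArg QuaternionAlgebra.re (h0 ⟨0, 1, 0, 0⟩)
    simp at h1 h2
    apply hab
    rw [h2]
    linear_combination 2 * a * h1

theorem isQuadraticPair_of_isSeparableQuadratic {σ : Dᵐᵒᵖ ≃ₐ[F] D} {e : D →ₗ[F] F}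
    (hD : IsSeparableQuadratic F D) (hσ : ∃ x, σ (op x) ≠ x) (he : ∀ x, e x = fullTrace F D x) :
    IsQuadraticPair σ e := by
  obtain ⟨hd, hsep⟩ := hD
  obtain ⟨w, hw⟩ := hσ
  have hσF : ∀ c : F, σ (op (algebraMap F D c)) = algebraMap F D c := fun c => σ.commutes c
  have hwF : ∀ c : F, w ≠ algebraMap F D c := by
    rintro c rfl
    exact hw (hσF c)
  have hli : LinearIndependent F ![(1 : D), w] := by
    rw [LinearIndependent.pair_iff]
    intro s t hst
    by_cases ht : t = 0
    · subst ht
      simpa using hst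
    · exfalso
      apply hwF (-(t⁻¹ * s))
      rw [Algebra.algebraMap_eq_smul_one, neg_smul, mul_smul, eq_neg_iff_add_eq_zero]
      apply smul_right_injective D ht
      simp only [smul_add, smul_smul, mul_inv_cancel_left₀ ht, smul_zero]
      rw [add_comm, hst]
  have : FiniteDimensional F D := FiniteDimensional.of_finrank_pos (by omega)
  have hspan : ∀ z : D, ∃ a b : F, z = algebraMap F D a + b • w := by
    intro z
    have h1 := hli.span_eq_top_of_card_eq_finrank (by simp [hd])
    have h2 : z ∈ Submodule.span F (Set.range ![(1 : D), w]) := by rw [h1]; trivial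
    rw [Matrix.range_cons, Matrix.range_cons, Matrix.range_empty, Set.union_empty,
      Set.singleton_union, Submodule.mem_span_pair] at h2
    obtain ⟨a, b, hab⟩ := h2
    exact ⟨a, b, by rw [← hab, Algebra.algebraMap_eq_smul_one]⟩
  have hcomm : ∀ x y : D, x * y = y * x := by
    intro x y
    obtain ⟨a, b, rfl⟩ := hspan x
    obtain ⟨a', b', rfl⟩ := hspan y
    exact (Algebra.commute_algebraMap_left a _).add_left
      (((Algebra.commute_algebraMap_right a' w).add_right ((Commute.refl w).smul_right b')).smul_left b)
  obtain ⟨q, p, hp⟩ := hspan (w * w)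
  -- Both w and σ(w) are roots of t² − p t − q, and they are distinct.
  have hσw : σ (op w) = algebraMap F D p - w := by
    have h1 : σ (op w) * σ (op w) = algebraMap F D q + p • σ (op w) := by
      rw [← conj_mul, hp, conj_add, conj_smul, hσF]
    have h2 : (σ (op w) - w) * (σ (op w) - (algebraMap F D p - w)) = 0 := by
      have : (σ (op w) - w) * (σ (op w) - (algebraMap F D p - w)) =
          σ (op w) * σ (op w) - w * w - algebraMap F D p * σ (op w) + algebraMap F D p * w := by
        rw [Algebra.commutes p, Algebra.commutes p, mul_sub, mul_sub, sub_mul, sub_mul, sub_mul,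
          hcomm w (σ (op w))]
        abel
      rw [this, h1, hp, Algebra.smul_def, Algebra.smul_def]
      abel
    rw [mul_eq_zero] at h2
    exact sub_eq_zero.1 (h2.resolve_left (sub_ne_zero.2 hw))
  have hinv : ∀ x : D, σ (op (σ (op x))) = x := by
    intro x
    obtain ⟨a, b, rfl⟩ := hspan x
    have h1 : σ (op (algebraMap F D p - w)) = w := by
      rw [op_sub, map_sub, hσF, hσw, sub_sub_cancel]
    simp only [conj_add, conj_smul, hσF, hσw, h1]
  refine ⟨hinv, fun x => ?_, fun x y => by rw [hcomm], fun x => ?_, ?_⟩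
  · obtain ⟨a, b, rfl⟩ := hspan x
    refine ⟨a * a + a * b * p - b * b * q, ?_⟩
    simp only [conj_add, conj_smul, hσF, hσw]
    have h3 : (algebraMap F D p - w) * w = - algebraMap F D q := by
      rw [sub_mul, hp, Algebra.smul_def]
      abel
    simp only [mul_add, add_mul, smul_mul_smul_comm, h3, map_add, map_sub, map_mul]
    simp only [Algebra.smul_def, map_mul, ← mul_assoc, mul_sub, ← Algebra.commutes a]
    simp only [mul_assoc, mul_neg]
    abel
  · rw [he, he, fullTrace, fullTrace]
    let τ : D ≃ₗ[F] D := (opLinearEquiv F).trans σ.toLinearEquiv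
    -- Multiplications by x and by σ(x) are conjugate under σ itself, hence have equal traces.
    have : LinearMap.mulLeft F (σ (op x)) = τ.conj (LinearMap.mulLeft F x) := by
      ext y
      have h1 : τ.symm y = σ (op y) := by
        rw [LinearEquiv.symm_apply_eq]
        exact (hinv y).symm
      rw [LinearEquiv.conj_apply_apply, h1]
      show σ (op x) * y = σ (op (x * σ (op y)))
      rw [conj_mul, hinv, hcomm]
    rw [this, LinearMap.trace_conj']
  · intro h
    let _ : Field D := { ‹DivisionRing D› with mul_comm := hcomm }
    apply Algebra.trace_ne_zero F D
    ext x
    exact (he x).symm.trans (by rw [h])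

theorem IsAssociatedPair.isQuadraticPair {σ : Dᵐᵒᵖ ≃ₐ[F] D} {e : D →ₗ[F] F}
    (h : IsAssociatedPair σ e) : IsQuadraticPair σ e := by
  rcases h with ⟨h1, h2, h3⟩ | ⟨h1, h2, h3⟩ | ⟨h1, h2⟩ | ⟨h1, h2, h3⟩
  · exact isQuadraticPair_of_finrank_eq_one h1 h2 h3
  · exact isQuadraticPair_of_isSeparableQuadratic h1 h2 h3
  · exact isQuadraticPair_of_isQuaternionConjugation h1 h2
  · exact isQuadraticPair_of_isHyperRadicial h1 h2 h3

end QuadraticPairs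

/-! ### Orbits, stabilizers and the pencil argument. -/

section Spaces

variable {F D V W : Type*} [Field F] [DivisionRing D] [Algebra F D]
  [AddCommGroup V] [Module Dᵐᵒᵖ V] [Module F V] [IsScalarTower F Dᵐᵒᵖ V]
  [AddCommGroup W] [Module Dᵐᵒᵖ W] [Module F W] [IsScalarTower F Dᵐᵒᵖ W]

theorem finrank_op : finrank F Dᵐᵒᵖ = finrank F D :=
  (opLinearEquiv F).symm.finrank_eq

theorem finite_op [FiniteDimensional F D] : FiniteDimensional F Dᵐᵒᵖ :=
  Module.Finite.equiv (opLinearEquiv F)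

variable (F D V) in
theorem finite_of_tower [FiniteDimensional F D] [FiniteDimensional Dᵐᵒᵖ V] :
    FiniteDimensional F V :=
  have := finite_op (F := F) (D := D)
  Module.Finite.trans Dᵐᵒᵖ V

variable (F D V) in
theorem finrank_of_tower [FiniteDimensional F D] [FiniteDimensional Dᵐᵒᵖ V] :
    finrank F V = finrank Dᵐᵒᵖ V * finrank F D := by
  have := finite_op (F := F) (D := D)
  rw [← finrank_mul_finrank F Dᵐᵒᵖ V, finrank_op, mul_comm]

instance finite_hom [FiniteDimensional F D] [FiniteDimensional Dᵐᵒᵖ V] [FiniteDimensional Dᵐᵒᵖ W] :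
    FiniteDimensional F (V →ₗ[Dᵐᵒᵖ] W) :=
  have := finite_of_tower F D W
  Module.Finite.equiv ((finBasis Dᵐᵒᵖ V).constr F)

omit [Module F V] [IsScalarTower F Dᵐᵒᵖ V] in
theorem finrank_hom [FiniteDimensional F D] [FiniteDimensional Dᵐᵒᵖ V] [FiniteDimensional Dᵐᵒᵖ W] :
    finrank F (V →ₗ[Dᵐᵒᵖ] W) = finrank F D * (finrank Dᵐᵒᵖ V * finrank Dᵐᵒᵖ W) := by
  have := finite_of_tower F D W
  rw [← ((finBasis Dᵐᵒᵖ V).constr F (M' := W)).finrank_eq, Module.finrank_pi_fintype]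
  simp only [Finset.sum_const, Finset.card_univ, Fintype.card_fin, smul_eq_mul]
  rw [finrank_of_tower F D W]
  ring

theorem finrank_op_self : finrank Dᵐᵒᵖ D = 1 := by
  apply finrank_eq_one (1 : D) one_ne_zero
  intro w
  exact ⟨op w, by simp⟩

/-- The operator `y ↦ k (f y)`. -/
def rankOne (k : V) (f : V →ₗ[Dᵐᵒᵖ] D) : Module.End Dᵐᵒᵖ V where
  toFun y := op (f y) • k
  map_add' y z := by rw [map_add, op_add, add_smul]
  map_smul' a y := by
    rw [map_smul, RingHom.id_apply, ← op_unop a, op_smul_eq_mul, op_mul, mul_smul, op_unop]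

@[simp]
theorem rankOne_apply (k : V) (f : V →ₗ[Dᵐᵒᵖ] D) (y : V) : rankOne k f y = op (f y) • k := rfl

theorem exists_form_of_notMem {G : Submodule Dᵐᵒᵖ V} {x : V} (hx : x ∉ G) :
    ∃ β : V →ₗ[Dᵐᵒᵖ] D, β x = 1 ∧ ∀ y ∈ G, β y = 0 := by
  obtain ⟨f, hf, hG⟩ := Submodule.exists_le_ker_of_notMem hx
  let β : V →ₗ[Dᵐᵒᵖ] D :=
    { toFun := fun y => unop (f y)
      map_add' := fun y z => by rw [map_add, unop_add]
      map_smul' := fun a y => by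
        rw [map_smul, RingHom.id_apply, smul_eq_mul, unop_mul, ← op_unop a, op_smul_eq_mul]
        simp }
  have hβ : β x ≠ 0 := by simpa [β] using hf
  refine ⟨(β x)⁻¹ • β, ?_, fun y hy => ?_⟩
  · rw [LinearMap.smul_apply, smul_eq_mul, inv_mul_cancel₀ hβ]
  · have : f y = 0 := hG hy
    simp [β, this]

theorem finrank_ker_add_one [FiniteDimensional Dᵐᵒᵖ V] {β : V →ₗ[Dᵐᵒᵖ] D} (hβ : β ≠ 0) :
    finrank Dᵐᵒᵖ (LinearMap.ker β) + 1 = finrank Dᵐᵒᵖ V := by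
  have hs : LinearMap.range β = ⊤ := by
    rw [LinearMap.range_eq_top]
    obtain ⟨x, hx⟩ : ∃ x, β x ≠ 0 := by
      by_contra! h
      exact hβ (LinearMap.ext h)
    intro t
    refine ⟨op ((β x)⁻¹ * t) • x, ?_⟩
    rw [map_smul, op_smul_eq_mul, mul_inv_cancel_left₀ hx]
  rw [← β.finrank_range_add_finrank_ker, hs, finrank_top, finrank_op_self, add_comm]

/-- Every `F`-linear form on `V` is of the form `e ∘ β`. -/
theorem exists_form_eq [FiniteDimensional F D] {e : D →ₗ[F] F} (he : e ≠ 0) (φ : V →ₗ[F] F) :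
    ∃ β : V →ₗ[Dᵐᵒᵖ] D, ∀ y, e (β y) = φ y := by
  let τ : D →ₗ[F] D →ₗ[F] F := (LinearMap.mul F D).compr₂ e
  have hτ : ∀ t a, τ t a = e (t * a) := fun t a => rfl
  have hinj : Function.Injective τ := by
    rw [injective_iff_map_eq_zero]
    intro t ht
    apply eq_zero_of_forall_apply_mul he
    intro a
    rw [← hτ, ht, LinearMap.zero_apply]
  -- Nondegeneracy and equality of dimensions identify D with its F-dual through e; β y then
  -- represents the form a ↦ φ(y a).
  have hsurj : Function.Surjective τ :=
    (LinearMap.injective_iff_surjective_of_finrank_eq_finrank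
      (Subspace.dual_finrank_eq (K := F) (V := D)).symm).1 hinj
  let ψ : V → D →ₗ[F] F := fun y =>
    { toFun := fun a => φ (op a • y)
      map_add' := fun a b => by rw [op_add, add_smul, map_add]
      map_smul' := fun c a => by rw [op_smul, smul_assoc, map_smul, RingHom.id_apply] }
  choose β hβ using fun y => hsurj (ψ y)
  have hβ' : ∀ y a, e (β y * a) = φ (op a • y) := by
    intro y a
    rw [← hτ, hβ]
    rfl
  have hext : ∀ s t : D, (∀ a, e (s * a) = e (t * a)) → s = t := by
    intro s t h
    rw [← sub_eq_zero]
    apply eq_zero_of_forall_apply_mul he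
    intro a
    rw [sub_mul, map_sub, h, sub_self]
  refine ⟨{ toFun := β, map_add' := fun y z => ?_, map_smul' := fun b y => ?_ }, fun y => ?_⟩
  · apply hext
    intro a
    rw [add_mul, map_add, hβ', hβ', hβ', smul_add, map_add]
  · apply hext
    intro a
    rw [RingHom.id_apply, hβ', ← op_unop b, op_smul_eq_mul, mul_assoc, hβ', op_mul, mul_smul]
  · simpa using hβ' y 1

/-- The vectors `u x` with `u ∈ S`. -/
def orbit (S : Submodule F (Module.End Dᵐᵒᵖ V)) (x : V) : Submodule F V :=
  S.map (LinearMap.applyₗ' F x)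

/-- The operators in `S` that vanish at `x`. -/
def stab (S : Submodule F (Module.End Dᵐᵒᵖ V)) (x : V) : Submodule F (Module.End Dᵐᵒᵖ V) :=
  S ⊓ LinearMap.ker (LinearMap.applyₗ' F x)

/-- The operators on `H` that are restrictions of operators in `S`. -/
def restrictTo (S : Submodule F (Module.End Dᵐᵒᵖ V)) (H : Submodule Dᵐᵒᵖ V) :
    Submodule F (Module.End Dᵐᵒᵖ H) where
  carrier := {t | ∃ u ∈ S, ∀ h : H, u h = t h}
  add_mem' := by
    rintro s t ⟨u, hu, hu'⟩ ⟨v, hv, hv'⟩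
    exact ⟨u + v, add_mem hu hv, fun h => by simp [hu', hv']⟩
  zero_mem' := ⟨0, zero_mem _, fun h => by simp⟩
  smul_mem' := by
    rintro c t ⟨u, hu, hu'⟩
    exact ⟨c • u, S.smul_mem c hu, fun h => by simp [hu']⟩

/-- `S` has trivial spectrum and its dimension is the greatest possible one. -/
def IsFull (S : Submodule F (Module.End Dᵐᵒᵖ V)) : Prop :=
  HasTrivialSpectrum S ∧
    2 * finrank F S + 2 * finrank Dᵐᵒᵖ V = finrank F D * finrank Dᵐᵒᵖ V * (finrank Dᵐᵒᵖ V + 1)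

variable {S T : Submodule F (Module.End Dᵐᵒᵖ V)} {x : V}

theorem mem_stab {u : Module.End Dᵐᵒᵖ V} : u ∈ stab S x ↔ u ∈ S ∧ u x = 0 := Iff.rfl

theorem apply_mem_orbit {u : Module.End Dᵐᵒᵖ V} (hu : u ∈ S) (x : V) : u x ∈ orbit S x :=
  ⟨u, hu, rfl⟩

theorem HasTrivialSpectrum.mono (hS : HasTrivialSpectrum S) (h : T ≤ S) : HasTrivialSpectrum T :=
  fun u hu => hS u (h hu)

theorem HasTrivialSpectrum.restrict (hS : HasTrivialSpectrum S) (H : Submodule Dᵐᵒᵖ V) :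
    HasTrivialSpectrum (restrictTo S H) := by
  rintro t ⟨u, hu, hut⟩ c hc y hy
  have := hS u hu c hc y (by rw [hut, hy]; rfl)
  exact Subtype.ext this

theorem HasTrivialSpectrum.notMem_orbit (hS : HasTrivialSpectrum S) (hx : x ≠ 0) :
    x ∉ orbit S x := by
  rintro ⟨u, hu, hux⟩
  exact hx (hS u hu 1 one_ne_zero x (by rw [one_smul]; exact hux))

section FiniteDimensional

variable [FiniteDimensional F D] [FiniteDimensional Dᵐᵒᵖ V]

theorem finrank_eq_orbit_add_stab (S : Submodule F (Module.End Dᵐᵒᵖ V)) (x : V) :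
    finrank F S = finrank F (orbit S x) + finrank F (stab S x) := by
  let A := (LinearMap.applyₗ' F x : Module.End Dᵐᵒᵖ V →ₗ[F] V).domRestrict S
  have h1 : LinearMap.range A = orbit S x := LinearMap.range_domRestrict _ _
  have h2 : (LinearMap.ker A).map S.subtype = stab S x := by
    ext u
    simp only [Submodule.mem_map, LinearMap.mem_ker, Submodule.subtype_apply, Subtype.exists,
      mem_stab]
    constructor
    · rintro ⟨u, hu, hux, rfl⟩
      exact ⟨hu, hux⟩
    · rintro ⟨hu, hux⟩
      exact ⟨u, hu, hux, rfl⟩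
  rw [← A.finrank_range_add_finrank_ker, h1, ← h2, Submodule.finrank_map_subtype_eq]

theorem HasTrivialSpectrum.finrank_orbit_lt (hS : HasTrivialSpectrum S) (hx : x ≠ 0) :
    finrank F (orbit S x) < finrank F V := by
  have := finite_of_tower F D V
  apply Submodule.finrank_lt
  intro h
  exact hS.notMem_orbit hx (by rw [h]; trivial)

omit [FiniteDimensional F D] [FiniteDimensional Dᵐᵒᵖ V] in
theorem finrank_restrictTo {H : Submodule Dᵐᵒᵖ V} (hT : ∀ u ∈ T, ∀ h ∈ H, u h ∈ H)
    (hinj : ∀ u ∈ T, (∀ h ∈ H, u h = 0) → u = 0) :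
    finrank F (restrictTo T H) = finrank F T := by
  let ρ : T →ₗ[F] Module.End Dᵐᵒᵖ H :=
    { toFun := fun u => u.1.restrict (hT u.1 u.2)
      map_add' := fun u v => by ext h; rfl
      map_smul' := fun c u => by ext h; rfl }
  have hr : LinearMap.range ρ = restrictTo T H := by
    ext t
    constructor
    · rintro ⟨u, rfl⟩
      exact ⟨u, u.2, fun h => rfl⟩
    · rintro ⟨u, hu, hut⟩
      exact ⟨⟨u, hu⟩, by ext h; exact hut h⟩
  rw [← hr]
  apply LinearMap.finrank_range_of_inj
  rw [injective_iff_map_eq_zero]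
  intro u hu
  apply Subtype.ext
  apply hinj u u.2
  intro h hh
  exact congrArg Subtype.val (LinearMap.congr_fun hu ⟨h, hh⟩)

/-- The evaluations u ↦ u (y + s x) form a pencil whose member at infinity, evaluation at x, has
maximal rank. Since this rank is less than dim V, the hypothesis |F| ≥ dim V suffices. -/
theorem mem_orbit_of_forall (hF : (finrank F V : Cardinal) ≤ Cardinal.mk F)
    (hmax : ∀ y, finrank F (orbit S y) ≤ finrank F (orbit S x))
    (hlt : finrank F (orbit S x) < finrank F V) {y w : V}
    (h : ∀ s : F, w ∈ orbit S (y + s • x)) : w ∈ orbit S x := by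
  have := finite_of_tower F D V
  let A : V → S →ₗ[F] V := fun z => (LinearMap.applyₗ' F z).domRestrict S
  have hA : ∀ z, LinearMap.range (A z) = orbit S z := fun z => LinearMap.range_domRestrict _ _
  have hadd : ∀ s : F, A y + s • A x = A (y + s • x) := by
    intro s
    ext u
    simp [A, LinearMap.domRestrict_apply]
  rw [← hA]
  refine mem_range_of_forall_mem_range_add_smul (A x) (A y) ?_ ?_ ?_
  · rw [hA]
    exact lt_of_lt_of_le (by exact_mod_cast hlt) hF
  · intro s
    rw [hadd, hA, hA]
    exact hmax _
  · intro s
    rw [hadd, hA]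
    exact h s

/-- Since u x = 0, the vector u y equals u (y + s x) for every s. -/
theorem apply_mem_orbit_of_mem_stab (hF : (finrank F V : Cardinal) ≤ Cardinal.mk F)
    (hmax : ∀ y, finrank F (orbit S y) ≤ finrank F (orbit S x))
    (hlt : finrank F (orbit S x) < finrank F V) {u : Module.End Dᵐᵒᵖ V} (hu : u ∈ stab S x)
    (y : V) : u y ∈ orbit S x := by
  refine mem_orbit_of_forall hF hmax hlt (y := y) fun s => ⟨u, hu.1, ?_⟩
  have : u x = 0 := hu.2
  simp [this]

/-- Since u x = 0 and v x = u y, the operator v − s u sends y + s x to v y for every s. -/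
theorem apply_mem_orbit_of_apply_eq (hF : (finrank F V : Cardinal) ≤ Cardinal.mk F)
    (hmax : ∀ y, finrank F (orbit S y) ≤ finrank F (orbit S x))
    (hlt : finrank F (orbit S x) < finrank F V) {u v : Module.End Dᵐᵒᵖ V} (hu : u ∈ stab S x)
    (hv : v ∈ S) {y : V} (h : v x = u y) : v y ∈ orbit S x := by
  refine mem_orbit_of_forall hF hmax hlt (y := y)
    fun s => ⟨v - s • u, sub_mem hv (S.smul_mem s hu.1), ?_⟩
  have : u x = 0 := hu.2
  simp [this, h]

/-- Take for G the largest D-subspace inside Sx. It misses x, and it contains u y for every u in the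
stabilizer, because each u (y a) lies in Sx. -/
theorem exists_form_of_max (hF : (finrank F V : Cardinal) ≤ Cardinal.mk F)
    (hS : HasTrivialSpectrum S) (hx : x ≠ 0)
    (hmax : ∀ y, finrank F (orbit S y) ≤ finrank F (orbit S x)) :
    ∃ β : V →ₗ[Dᵐᵒᵖ] D, β x = 1 ∧ ∀ u ∈ stab S x, ∀ y, β (u y) = 0 := by
  let G : Submodule Dᵐᵒᵖ V :=
    { carrier := {w | ∀ a : Dᵐᵒᵖ, a • w ∈ orbit S x}
      add_mem' := fun {w z} hw hz a => by rw [smul_add]; exact add_mem (hw a) (hz a)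
      zero_mem' := fun a => by rw [smul_zero]; exact zero_mem _
      smul_mem' := fun b w hw a => by rw [smul_smul]; exact hw _ }
  have hxG : x ∉ G := by
    intro h
    apply hS.notMem_orbit hx
    simpa using h 1
  obtain ⟨β, hβ, hG⟩ := exists_form_of_notMem hxG
  refine ⟨β, hβ, fun u hu y => hG _ fun a => ?_⟩
  rw [← map_smul]
  exact apply_mem_orbit_of_mem_stab hF hmax (hS.finrank_orbit_lt hx) hu _

omit [FiniteDimensional F D] [FiniteDimensional Dᵐᵒᵖ V] in
theorem finrank_restrictTo_stab {β : V →ₗ[Dᵐᵒᵖ] D} (hβ : β x ≠ 0)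
    (hu : ∀ u ∈ stab S x, ∀ y, β (u y) = 0) :
    finrank F (restrictTo (stab S x) (LinearMap.ker β)) = finrank F (stab S x) := by
  apply finrank_restrictTo
  · intro u hu' h _
    exact hu u hu' h
  · intro u hu' h
    ext y
    have h1 : y - op ((β x)⁻¹ * β y) • x ∈ LinearMap.ker β := by
      rw [LinearMap.mem_ker, map_sub, map_smul, op_smul_eq_mul, mul_inv_cancel_left₀ hβ, sub_self]
    have h2 := h _ h1
    have h3 : u x = 0 := hu'.2
    rw [map_sub, map_smul, h3, smul_zero, sub_zero] at h2
    exact h2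

variable (S) in
theorem exists_max_orbit [Nontrivial V] :
    ∃ x : V, x ≠ 0 ∧ ∀ y, finrank F (orbit S y) ≤ finrank F (orbit S x) := by
  have := finite_of_tower F D V
  have hfin : (Set.range fun x : {x : V // x ≠ 0} => finrank F (orbit S x.1)).Finite := by
    apply (Set.finite_Iic (finrank F V)).subset
    rintro _ ⟨x, rfl⟩
    exact Submodule.finrank_le _
  obtain ⟨z, hz⟩ := exists_ne (0 : V)
  obtain ⟨_, ⟨x, rfl⟩, hx⟩ := hfin.exists_maximal ⟨_, ⟨⟨z, hz⟩, rfl⟩⟩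
  refine ⟨x.1, x.2, fun y => ?_⟩
  by_cases hy : y = 0
  · have : orbit S (0 : V) = ⊥ := by
      rw [eq_bot_iff]
      rintro _ ⟨u, hu, rfl⟩
      simp
    rw [hy, this, finrank_bot]
    exact Nat.zero_le _
  · by_contra! h
    exact absurd (hx ⟨⟨y, hy⟩, rfl⟩ h.le) (not_le.2 h)

end FiniteDimensional

end Spaces

/-! ### The dimension bound. -/

section Bound

universe w

variable {F D : Type*} [Field F] [DivisionRing D] [Algebra F D] [FiniteDimensional F D]

/-- The upper bound for the dimension of a space with trivial spectrum. -/
theorem HasTrivialSpectrum.finrank_le {V : Type w} [AddCommGroup V] [Module Dᵐᵒᵖ V] [Module F V]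
    [IsScalarTower F Dᵐᵒᵖ V] [FiniteDimensional Dᵐᵒᵖ V]
    (hF : (finrank F V : Cardinal) ≤ Cardinal.mk F)
    {S : Submodule F (Module.End Dᵐᵒᵖ V)} (hS : HasTrivialSpectrum S) :
    2 * finrank F S + 2 * finrank Dᵐᵒᵖ V ≤ finrank F D * finrank Dᵐᵒᵖ V * (finrank Dᵐᵒᵖ V + 1) := by
  induction hn : finrank Dᵐᵒᵖ V generalizing V with
  | zero =>
    have : finrank F (Module.End Dᵐᵒᵖ V) = 0 := by rw [finrank_hom, hn]; ring
    have h2 := Submodule.finrank_le S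
    rw [this, Nat.le_zero] at h2
    simp [h2]
  | succ n ih =>
    have : Nontrivial V := nontrivial_of_finrank_pos (R := Dᵐᵒᵖ) (by omega)
    obtain ⟨x, hx, hmax⟩ := exists_max_orbit S
    obtain ⟨β, hβ, hu⟩ := exists_form_of_max hF hS hx hmax
    have hβ0 : β x ≠ 0 := by rw [hβ]; exact one_ne_zero
    have h1 := finrank_restrictTo_stab hβ0 hu
    have h2 := finrank_ker_add_one (β := β) (by rintro rfl; exact hβ0 rfl)
    have h3 := finrank_of_tower F D V
    have h4 := finrank_of_tower F D (LinearMap.ker β)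
    have h5 : finrank Dᵐᵒᵖ (LinearMap.ker β) = n := by omega
    have h6 := ih (V := LinearMap.ker β) (by
      refine le_trans ?_ hF
      rw [h3, h4, h5, hn]
      exact_mod_cast Nat.mul_le_mul_right _ (Nat.le_succ n))
      ((hS.mono inf_le_left : HasTrivialSpectrum (stab S x)).restrict _) h5
    have h7 := hS.finrank_orbit_lt hx
    have h8 := finrank_eq_orbit_add_stab S x
    rw [h3, hn] at h7
    rw [h1] at h6
    -- Add dim Sx ≤ d(n+1) − 1 to the inductive bound for the stabilizer acting on the n-dimensional
    -- ker β.
    nlinarith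

end Bound

/-! ### Vectors whose orbit is a hyperplane. -/

section Good

variable {F D V : Type*} [Field F] [DivisionRing D] [Algebra F D] [FiniteDimensional F D]
  [AddCommGroup V] [Module Dᵐᵒᵖ V] [Module F V] [IsScalarTower F Dᵐᵒᵖ V]
  [FiniteDimensional Dᵐᵒᵖ V] {S : Submodule F (Module.End Dᵐᵒᵖ V)} {x : V}

/-- `S x` is a hyperplane of the `F`-vector space `V`. -/
def IsGood (S : Submodule F (Module.End Dᵐᵒᵖ V)) (x : V) : Prop :=
  finrank F (orbit S x) + 1 = finrank F V

omit [FiniteDimensional F D] [FiniteDimensional Dᵐᵒᵖ V] in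
theorem IsGood.lt (hg : IsGood S x) : finrank F (orbit S x) < finrank F V := by
  unfold IsGood at hg
  omega

theorem IsGood.max (hS : HasTrivialSpectrum S) (hg : IsGood S x) (y : V) :
    finrank F (orbit S y) ≤ finrank F (orbit S x) := by
  by_cases hy : y = 0
  · have : orbit S (0 : V) = ⊥ := by
      rw [eq_bot_iff]
      rintro _ ⟨u, hu, rfl⟩
      simp
    rw [hy, this, finrank_bot]
    exact Nat.zero_le _
  · have := hS.finrank_orbit_lt hy
    unfold IsGood at hg
    omega

theorem exists_form_orbit (hg : IsGood S x) {e : D →ₗ[F] F} (he : e ≠ 0) :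
    ∃ β : V →ₗ[Dᵐᵒᵖ] D, ∀ w, e (β w) = 0 ↔ w ∈ orbit S x := by
  have := finite_of_tower F D V
  obtain ⟨w, hw⟩ : ∃ w, w ∉ orbit S x := by
    by_contra! h
    have : orbit S x = ⊤ := by ext; simp [h]
    have h2 := hg.lt
    rw [this, finrank_top] at h2
    exact lt_irrefl _ h2
  obtain ⟨φ, hφw, hφ⟩ := Submodule.exists_le_ker_of_notMem hw
  obtain ⟨β, hβ⟩ := exists_form_eq (D := D) he φ
  have h1 : orbit S x = LinearMap.ker φ := by
    apply Submodule.eq_of_le_of_finrank_le hφ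
    have h3 := φ.finrank_range_add_finrank_ker
    have h4 : 0 < finrank F (LinearMap.range φ) :=
      finrank_pos_iff_exists_ne_zero.2 ⟨⟨φ w, w, rfl⟩, fun h => hφw (congrArg Subtype.val h)⟩
    unfold IsGood at hg
    omega
  exact ⟨β, fun w => by rw [hβ, h1, LinearMap.mem_ker]⟩

/-- Equality in the global bound forces equality in dim Sx ≤ nd − 1, since the stabilizer already
obeys the bound one dimension lower. -/
theorem exists_isGood [Nontrivial V] (hF : (finrank F V : Cardinal) ≤ Cardinal.mk F)
    (hS : IsFull S) : ∃ x, x ≠ 0 ∧ IsGood S x := by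
  obtain ⟨x, hx, hmax⟩ := exists_max_orbit S
  obtain ⟨β, hβ, hu⟩ := exists_form_of_max hF hS.1 hx hmax
  refine ⟨x, hx, ?_⟩
  have hβ0 : β x ≠ 0 := by rw [hβ]; exact one_ne_zero
  have h1 := finrank_restrictTo_stab hβ0 hu
  have h2 := finrank_ker_add_one (β := β) (by rintro rfl; exact hβ0 rfl)
  have h3 := finrank_of_tower F D V
  have h4 := finrank_of_tower F D (LinearMap.ker β)
  have h6 := HasTrivialSpectrum.finrank_le (V := LinearMap.ker β) (by
    refine le_trans ?_ hF
    rw [h3, h4]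
    exact_mod_cast Nat.mul_le_mul_right _ (by omega))
    ((hS.1.mono inf_le_left : HasTrivialSpectrum (stab S x)).restrict _)
  have h7 := hS.1.finrank_orbit_lt hx
  have h8 := finrank_eq_orbit_add_stab S x
  have h9 := hS.2
  unfold IsGood
  rw [h3] at h7 ⊢
  rw [h1] at h6
  rw [← h2] at h7 h9 ⊢
  nlinarith

/-- The vectors u (y a) all lie in Sx = ker(e ∘ β), so e(β(u y) a) = 0 for all a, and nondegeneracy
removes e. -/
theorem apply_mem_ker_of_mem_stab (hF : (finrank F V : Cardinal) ≤ Cardinal.mk F)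
    (hS : HasTrivialSpectrum S) (hg : IsGood S x) {e : D →ₗ[F] F} (he : e ≠ 0)
    {β : V →ₗ[Dᵐᵒᵖ] D} (hβ : ∀ w, e (β w) = 0 ↔ w ∈ orbit S x)
    {u : Module.End Dᵐᵒᵖ V} (hu : u ∈ stab S x) (y : V) : β (u y) = 0 := by
  apply eq_zero_of_forall_apply_mul he
  intro a
  rw [← op_smul_eq_mul, ← map_smul, ← map_smul, hβ]
  exact apply_mem_orbit_of_mem_stab hF (hg.max hS) hg.lt hu _

theorem IsFull.restrictTo_stab
    (hS : IsFull S) (hg : IsGood S x) {β : V →ₗ[Dᵐᵒᵖ] D} (hβ : β x ≠ 0)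
    (hu : ∀ u ∈ stab S x, ∀ y, β (u y) = 0) :
    IsFull (restrictTo (stab S x) (LinearMap.ker β)) := by
  refine ⟨(hS.1.mono inf_le_left).restrict _, ?_⟩
  rw [finrank_restrictTo_stab hβ hu]
  have h2 := finrank_ker_add_one (β := β) (by rintro rfl; exact hβ rfl)
  have h3 := finrank_of_tower F D V
  have h8 := finrank_eq_orbit_add_stab S x
  have h9 := hS.2
  unfold IsGood at hg
  rw [h3] at hg
  rw [← h2] at hg h9
  nlinarith

end Good

/-! ### Resolvents and rank-one operators. -/

section Transvections

variable {F D V : Type*} [Field F] [DivisionRing D] [Algebra F D] [FiniteDimensional F D]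
  [AddCommGroup V] [Module Dᵐᵒᵖ V] [Module F V] [IsScalarTower F Dᵐᵒᵖ V]
  [FiniteDimensional Dᵐᵒᵖ V] {S : Submodule F (Module.End Dᵐᵒᵖ V)}

/-- If r = (s − v)⁻¹ k lies in ker f, then so does v r = s r − k, which is (s − v)⁻¹ (v k); at s = 0
the vector −k plays this role. So v k lies in (s − v)(ker f) for every s, and the pencil argument at
s = ∞ puts it in ker f. The hypothesis is reproduced for v k so that the lemma can be iterated. -/
theorem apply_apply_eq_zero_of_resolvent (hF : (finrank F V : Cardinal) ≤ Cardinal.mk F)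
    {f : V →ₗ[Dᵐᵒᵖ] D} {v : Module.End Dᵐᵒᵖ V} {k : V} (hk : f k = 0)
    (h : ∀ s : F, s ≠ 0 → ∃ r, f r = 0 ∧ s • r - v r = k) :
    f (v k) = 0 ∧ ∀ s : F, s ≠ 0 → ∃ r, f r = 0 ∧ s • r - v r = v k := by
  have hres : ∀ s : F, s ≠ 0 → ∃ r, f r = 0 ∧ s • r - v r = v k := by
    intro s hs
    obtain ⟨r, hr, hrk⟩ := h s hs
    refine ⟨s • r - k, ?_, ?_⟩
    · rw [map_sub, LinearMap.map_smul_of_tower, hr, hk, smul_zero, sub_zero]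
    · rw [map_sub, LinearMap.map_smul_of_tower, smul_sub, sub_sub_sub_comm, ← smul_sub, hrk]
      abel
  refine ⟨?_, hres⟩
  by_cases hf : f = 0
  · simp [hf]
  have := finite_of_tower F D V
  let Z : Submodule F V := (LinearMap.ker f).restrictScalars F
  let A : Z →ₗ[F] V := Z.subtype
  let B : Z →ₗ[F] V := -((v.restrictScalars F) ∘ₗ Z.subtype)
  have hA : finrank F (LinearMap.range A) = finrank F Z := by rw [Submodule.range_subtype]
  have hZ : finrank F Z < finrank F V := by
    apply Submodule.finrank_lt
    intro h
    apply hf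
    ext y
    have : y ∈ Z := by rw [h]; trivial
    exact this
  have := mem_range_of_forall_mem_range_add_smul A B (by
    rw [hA]
    exact lt_of_lt_of_le (by exact_mod_cast hZ) hF) (fun s => by
    rw [hA]
    exact LinearMap.finrank_range_le _) (w := v k) (fun s => by
    by_cases hs : s = 0
    · refine ⟨-⟨k, hk⟩, ?_⟩
      simp [A, B, hs]
    · obtain ⟨r, hr, hrk⟩ := hres s hs
      refine ⟨⟨r, hr⟩, ?_⟩
      rw [← hrk]
      simp only [A, B, LinearMap.add_apply, LinearMap.neg_apply, LinearMap.comp_apply,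
        LinearMap.smul_apply, Submodule.subtype_apply, LinearMap.restrictScalars_apply]
      abel)
  rw [Submodule.range_subtype] at this
  exact this

/-- If `S` contains all the operators `y ↦ k (f y)` with `k ∈ K`, then `f` vanishes on `K`, on
`v K` and on `v² K`, for all `v ∈ S`. -/
theorem HasTrivialSpectrum.apply_eq_zero_of_rankOne_mem
    (hF : (finrank F V : Cardinal) ≤ Cardinal.mk F) (hS : HasTrivialSpectrum S)
    {K : Submodule Dᵐᵒᵖ V} {f : V →ₗ[Dᵐᵒᵖ] D} (h : ∀ k ∈ K, rankOne k f ∈ S)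
    {v : Module.End Dᵐᵒᵖ V} (hv : v ∈ S) {k : V} (hk : k ∈ K) :
    f k = 0 ∧ f (v k) = 0 ∧ f (v (v k)) = 0 := by
  have hres : ∀ v ∈ S, ∀ s : F, s ≠ 0 → ∃ r, f r = 0 ∧ s • r - v r = k := by
    intro v hv s hs
    let g : Module.End Dᵐᵒᵖ V := s • LinearMap.id - v
    have hg : ∀ r, g r = s • r - v r := fun r => rfl
    have hinj : Function.Injective g := by
      rw [injective_iff_map_eq_zero]
      intro r hr
      exact hS v hv s hs r (sub_eq_zero.1 ((hg r).symm.trans hr)).symm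
    obtain ⟨r, hr⟩ := LinearMap.injective_iff_surjective.1 hinj k
    refine ⟨r, ?_, hr⟩
    by_contra hfr
    -- The added rank-one operator sends r to k, which turns r into an eigenvector for s.
    have h1 := hS (v + rankOne (op (f r)⁻¹ • k) f)
      (add_mem hv (h _ (K.smul_mem _ hk))) s hs r (by
        rw [LinearMap.add_apply, rankOne_apply, smul_smul, ← op_mul, inv_mul_cancel₀ hfr, op_one,
          one_smul, ← hr, hg]
        abel)
    exact hfr (by rw [h1, map_zero])
  have hfk : f k = 0 := by
    obtain ⟨r, hr, hrk⟩ := hres 0 (zero_mem _) 1 one_ne_zero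
    have : r = k := by simpa using hrk
    rw [← this, hr]
  obtain ⟨h1, h2⟩ := apply_apply_eq_zero_of_resolvent hF hfk (hres v hv)
  exact ⟨hfk, h1, (apply_apply_eq_zero_of_resolvent hF h1 h2).1⟩

end Transvections

/-! ### Flags, block-triangular operators and the dimension of joints. -/

theorem sq_sum_eq_sum_sq_add {p : ℕ} (n : Fin p → ℕ) :
    (∑ i, n i) ^ 2 = ∑ i, n i ^ 2 +
      2 * ∑ q : {q : Fin p × Fin p // q.1 < q.2}, n q.1.2 * n q.1.1 := by
  have h1 : ∑ q : {q : Fin p × Fin p // q.1 < q.2}, n q.1.2 * n q.1.1 =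
      ∑ i, ∑ j, if i < j then n i * n j else 0 := by
    rw [← Finset.sum_product', ← Finset.sum_filter, Finset.univ_product_univ]
    rw [Finset.sum_subtype (p := fun q : Fin p × Fin p => q.1 < q.2)
      (Finset.univ.filter fun q : Fin p × Fin p => q.1 < q.2) (by simp)
      (fun q => n q.1 * n q.2)]
    exact Finset.sum_congr rfl fun q _ => mul_comm _ _
  have h2 : ∑ i, ∑ j, (if i < j then n i * n j else 0) =
      ∑ i, ∑ j, if j < i then n i * n j else 0 := by
    rw [Finset.sum_comm]
    simp only [mul_comm]
  rw [h1, sq, Finset.sum_mul_sum, two_mul]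
  nth_rewrite 2 [h2]
  rw [← Finset.sum_add_distrib, ← Finset.sum_add_distrib]
  refine Finset.sum_congr rfl fun i _ => ?_
  have h3 : n i ^ 2 = ∑ j, if i = j then n i * n j else 0 := by
    rw [Finset.sum_ite_eq Finset.univ i, if_pos (Finset.mem_univ _), sq]
  rw [h3, ← Finset.sum_add_distrib, ← Finset.sum_add_distrib]
  refine Finset.sum_congr rfl fun j _ => ?_
  rcases lt_trichotomy i j with h | h | h
  · simp [h, h.ne, h.not_gt]
  · simp [h]
  · simp [h, h.ne', h.not_gt]

theorem finrank_eq_sum_add_finrank_ker {F ι M : Type*} [Field F] [Fintype ι] [AddCommGroup M]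
    [Module F M] [FiniteDimensional F M] {E : ι → Type*} [∀ i, AddCommGroup (E i)]
    [∀ i, Module F (E i)] [∀ i, FiniteDimensional F (E i)] (X : ∀ i, Submodule F (E i))
    (g : M →ₗ[F] ∀ i, X i) (hg : Function.Surjective g) :
    finrank F M = ∑ i, finrank F (X i) + finrank F (LinearMap.ker g) := by
  rw [← g.finrank_range_add_finrank_ker, LinearMap.range_eq_top.2 hg, finrank_top,
    Module.finrank_pi_fintype]

namespace SubspaceFlag

variable {F D V : Type*} [Field F] [DivisionRing D] [Algebra F D]
  [AddCommGroup V] [Module Dᵐᵒᵖ V] (𝒱 : SubspaceFlag D V)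

theorem exists_proj (i : Fin 𝒱.length) : ∃ π : V →ₗ[Dᵐᵒᵖ] 𝒱.Subquotient i,
    π ∘ₗ (𝒱.space i.succ).subtype = Submodule.mkQ _ :=
  LinearMap.exists_extend _

/-- A linear extension to `V` of the projection of `V_{i+1}` onto `V_{i+1} / V_i`. -/
noncomputable def proj (i : Fin 𝒱.length) : V →ₗ[Dᵐᵒᵖ] 𝒱.Subquotient i :=
  (𝒱.exists_proj i).choose

theorem proj_apply {i : Fin 𝒱.length} {x : V} (hx : x ∈ 𝒱.space i.succ) :
    𝒱.proj i x = Submodule.Quotient.mk ⟨x, hx⟩ :=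
  LinearMap.congr_fun (𝒱.exists_proj i).choose_spec ⟨x, hx⟩

theorem proj_eq_zero_iff {i : Fin 𝒱.length} {x : V} (hx : x ∈ 𝒱.space i.succ) :
    𝒱.proj i x = 0 ↔ x ∈ 𝒱.space i.castSucc := by
  rw [proj_apply 𝒱 hx, Submodule.Quotient.mk_eq_zero]
  rfl

theorem castSucc_le_succ (i : Fin 𝒱.length) : 𝒱.space i.castSucc ≤ 𝒱.space i.succ :=
  𝒱.strictMono.monotone (Fin.castSucc_lt_succ).le

theorem proj_eq_zero {i : Fin 𝒱.length} {j : Fin (𝒱.length + 1)} (hj : j ≤ i.castSucc) {x : V}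
    (hx : x ∈ 𝒱.space j) : 𝒱.proj i x = 0 := by
  have h := 𝒱.strictMono.monotone hj hx
  exact (𝒱.proj_eq_zero_iff (𝒱.castSucc_le_succ i h)).2 h

theorem mem_space_iff {j : Fin (𝒱.length + 1)} {x : V} :
    x ∈ 𝒱.space j ↔ ∀ i : Fin 𝒱.length, j ≤ i.castSucc → 𝒱.proj i x = 0 := by
  refine ⟨fun hx i hi => 𝒱.proj_eq_zero hi hx, fun h => ?_⟩
  have : ∀ k, j ≤ k → x ∈ 𝒱.space k := by
    intro k
    induction k using Fin.reverseInduction with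
    | last => intro _; rw [𝒱.space_last]; trivial
    | cast i ih =>
      intro hi
      exact (𝒱.proj_eq_zero_iff (ih (hi.trans Fin.castSucc_lt_succ.le))).1 (h i hi)
  exact this j le_rfl

theorem exists_mem_notMem {x : V} (hx : x ≠ 0) :
    ∃ i : Fin 𝒱.length, x ∈ 𝒱.space i.succ ∧ x ∉ 𝒱.space i.castSucc := by
  by_contra! h
  have : ∀ k, x ∈ 𝒱.space k := by
    intro k
    induction k using Fin.reverseInduction with
    | last => rw [𝒱.space_last]; trivial
    | cast i ih => exact h i ih
  apply hx
  have h0 := this 0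
  rwa [𝒱.space_zero] at h0

/-- Solve from the top: lift the highest coordinate to V_{k+1}, where the higher projections vanish,
and correct the lower coordinates by induction. -/
theorem exists_forall_proj_eq (k : Fin (𝒱.length + 1)) (y : ∀ i, 𝒱.Subquotient i)
    (hy : ∀ i, k ≤ i.castSucc → y i = 0) : ∃ x, ∀ i, 𝒱.proj i x = y i := by
  induction k using Fin.induction generalizing y with
  | zero => exact ⟨0, fun i => by rw [map_zero, hy i (Fin.zero_le _)]⟩
  | succ k ih =>
    obtain ⟨⟨z, hz⟩, hzy⟩ := Submodule.Quotient.mk_surjective _ (y k)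
    obtain ⟨x, hx⟩ := ih (fun i => y i - 𝒱.proj i z) (by
      intro i hi
      rcases (Fin.castSucc_le_castSucc_iff.1 hi).eq_or_lt with h | h
      · subst h
        rw [𝒱.proj_apply hz, hzy, sub_self]
      · have h' : k.succ ≤ i.castSucc := Fin.succ_le_castSucc_iff.2 h
        rw [hy i h', 𝒱.proj_eq_zero h' hz, sub_zero])
    exact ⟨x + z, fun i => by rw [map_add, hx, sub_add_cancel]⟩

/-- A splitting of the flag. -/
noncomputable def splitting : V ≃ₗ[Dᵐᵒᵖ] ∀ i, 𝒱.Subquotient i :=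
  LinearEquiv.ofBijective (LinearMap.pi 𝒱.proj) <| by
    constructor
    · rw [injective_iff_map_eq_zero]
      intro x hx
      have : x ∈ 𝒱.space 0 := 𝒱.mem_space_iff.2 fun i _ => congrFun hx i
      rwa [𝒱.space_zero] at this
    · intro y
      obtain ⟨x, hx⟩ := 𝒱.exists_forall_proj_eq (Fin.last _) y
        (fun i hi => absurd hi (not_le.2 (Fin.castSucc_lt_last i)))
      exact ⟨x, funext hx⟩

@[simp]
theorem splitting_apply (x : V) (i : Fin 𝒱.length) : 𝒱.splitting x i = 𝒱.proj i x := rfl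

/-- The section of `V_{i+1} → V_{i+1} / V_i` given by the splitting. -/
noncomputable def incl (i : Fin 𝒱.length) : 𝒱.Subquotient i →ₗ[Dᵐᵒᵖ] V :=
  𝒱.splitting.symm.toLinearMap ∘ₗ LinearMap.single Dᵐᵒᵖ 𝒱.Subquotient i

theorem proj_incl (i j : Fin 𝒱.length) (q : 𝒱.Subquotient j) :
    𝒱.proj i (𝒱.incl j q) = Pi.single (M := 𝒱.Subquotient) j q i := by
  rw [← splitting_apply, incl, LinearMap.comp_apply, LinearEquiv.coe_coe,
    LinearEquiv.apply_symm_apply, LinearMap.single_apply]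

@[simp]
theorem proj_incl_self (i : Fin 𝒱.length) (q : 𝒱.Subquotient i) :
    𝒱.proj i (𝒱.incl i q) = q := by
  rw [proj_incl, Pi.single_eq_same]

theorem proj_incl_of_ne {i j : Fin 𝒱.length} (h : i ≠ j) (q : 𝒱.Subquotient j) :
    𝒱.proj i (𝒱.incl j q) = 0 := by
  rw [proj_incl, Pi.single_eq_of_ne h]

theorem incl_mem (i : Fin 𝒱.length) (q : 𝒱.Subquotient i) : 𝒱.incl i q ∈ 𝒱.space i.succ := by
  rw [mem_space_iff]
  intro l hl
  apply proj_incl_of_ne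
  rintro rfl
  exact absurd hl (not_le.2 Fin.castSucc_lt_succ)

theorem sum_incl_proj (x : V) : ∑ i, 𝒱.incl i (𝒱.proj i x) = x := by
  apply 𝒱.splitting.injective
  ext j
  rw [splitting_apply, splitting_apply, map_sum, Finset.sum_eq_single j]
  · simp
  · intro i _ hi
    exact 𝒱.proj_incl_of_ne hi.symm _
  · simp

theorem finrank_eq_sum [FiniteDimensional Dᵐᵒᵖ V] :
    finrank Dᵐᵒᵖ V = ∑ i, finrank Dᵐᵒᵖ (𝒱.Subquotient i) := by
  have : ∀ i, Module.Free Dᵐᵒᵖ (𝒱.Subquotient i) := fun i => inferInstance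
  rw [𝒱.splitting.finrank_eq, Module.finrank_pi_fintype]

variable {𝒱}

theorem induced_proj {u : Module.End Dᵐᵒᵖ V} (hu : 𝒱.IsStable u) {i : Fin 𝒱.length} {x : V}
    (hx : x ∈ 𝒱.space i.succ) : 𝒱.induced u hu i (𝒱.proj i x) = 𝒱.proj i (u x) := by
  rw [𝒱.proj_apply hx, 𝒱.proj_apply (hu _ x hx)]
  rfl

theorem induced_apply {u : Module.End Dᵐᵒᵖ V} (hu : 𝒱.IsStable u) (i : Fin 𝒱.length)
    (q : 𝒱.Subquotient i) : 𝒱.induced u hu i q = 𝒱.proj i (u (𝒱.incl i q)) := by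
  rw [← induced_proj hu (𝒱.incl_mem i q), proj_incl_self]

theorem isStable_incl_comp_proj {i j : Fin 𝒱.length} (hij : i ≤ j)
    (f : 𝒱.Subquotient j →ₗ[Dᵐᵒᵖ] 𝒱.Subquotient i) :
    𝒱.IsStable (𝒱.incl i ∘ₗ f ∘ₗ 𝒱.proj j) := by
  intro k x hx
  rw [LinearMap.comp_apply, LinearMap.comp_apply]
  by_cases hk : k ≤ j.castSucc
  · rw [𝒱.proj_eq_zero hk hx, map_zero, map_zero]
    exact zero_mem _
  · have h1 : i.succ ≤ k :=
      (Fin.succ_le_succ_iff.2 hij).trans (Fin.castSucc_lt_iff_succ_le.1 (not_le.1 hk))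
    exact 𝒱.strictMono.monotone h1 (𝒱.incl_mem _ _)

theorem induced_incl_comp_proj_self (i : Fin 𝒱.length) (t : Module.End Dᵐᵒᵖ (𝒱.Subquotient i)) :
    𝒱.induced _ (isStable_incl_comp_proj (le_refl i) t) i = t := by
  refine LinearMap.ext fun q => ?_
  simp [induced_apply]

theorem induced_incl_comp_proj_of_ne {i j k : Fin 𝒱.length} (hij : i ≤ j) (h : k ≠ i ∨ k ≠ j)
    (f : 𝒱.Subquotient j →ₗ[Dᵐᵒᵖ] 𝒱.Subquotient i) :
    𝒱.induced _ (isStable_incl_comp_proj hij f) k = 0 := by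
  refine LinearMap.ext fun q => ?_
  rw [induced_apply]
  simp only [LinearMap.comp_apply, LinearMap.zero_apply]
  rcases h with h | h
  · exact 𝒱.proj_incl_of_ne h _
  · rw [𝒱.proj_incl_of_ne h.symm, map_zero, map_zero, map_zero]

variable [Module F V] [IsScalarTower F Dᵐᵒᵖ V]

variable {X Y : ∀ i : Fin 𝒱.length, Submodule F (Module.End Dᵐᵒᵖ (𝒱.Subquotient i))}

theorem incl_comp_proj_mem_joint {i : Fin 𝒱.length} {t : Module.End Dᵐᵒᵖ (𝒱.Subquotient i)}
    (ht : t ∈ X i) : 𝒱.incl i ∘ₗ t ∘ₗ 𝒱.proj i ∈ 𝒱.joint X := by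
  refine ⟨isStable_incl_comp_proj le_rfl t, fun k => ?_⟩
  by_cases hk : k = i
  · subst hk
    rwa [induced_incl_comp_proj_self]
  · rw [induced_incl_comp_proj_of_ne le_rfl (Or.inl hk)]
    exact zero_mem _

theorem incl_comp_proj_mem_joint_of_lt {i j : Fin 𝒱.length} (hij : i < j)
    (f : 𝒱.Subquotient j →ₗ[Dᵐᵒᵖ] 𝒱.Subquotient i) :
    𝒱.incl i ∘ₗ f ∘ₗ 𝒱.proj j ∈ 𝒱.joint X := by
  refine ⟨isStable_incl_comp_proj hij.le f, fun k => ?_⟩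
  rw [induced_incl_comp_proj_of_ne hij.le]
  · exact zero_mem _
  · by_contra! h
    exact hij.ne (h.1.symm.trans h.2)

theorem le_of_joint_le (h : 𝒱.joint X ≤ 𝒱.joint Y) (i : Fin 𝒱.length) : X i ≤ Y i := by
  intro t ht
  obtain ⟨hu, hu'⟩ := h (incl_comp_proj_mem_joint ht)
  have := hu' i
  rwa [induced_incl_comp_proj_self] at this

/-- The operators of a joint as tuples of induced operators. -/
def jointToPi (X : ∀ i : Fin 𝒱.length, Submodule F (Module.End Dᵐᵒᵖ (𝒱.Subquotient i))) :
    𝒱.joint X →ₗ[F] ∀ i, X i where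
  toFun u i := ⟨𝒱.induced u.1 u.2.fst i, u.2.snd i⟩
  map_add' u v := by
    ext1 i
    refine Subtype.ext (LinearMap.ext fun q => ?_)
    obtain ⟨q, rfl⟩ := Submodule.Quotient.mk_surjective _ q
    rfl
  map_smul' c u := by
    ext1 i
    refine Subtype.ext (LinearMap.ext fun q => ?_)
    obtain ⟨q, rfl⟩ := Submodule.Quotient.mk_surjective _ q
    rfl

/-- The blocks of the strictly upper block-triangular operators. -/
noncomputable def upperToPi : 𝒱.joint (fun _ => (⊥ : Submodule F _)) →ₗ[F]
    ∀ q : {q : Fin 𝒱.length × Fin 𝒱.length // q.1 < q.2},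
      (𝒱.Subquotient q.1.2 →ₗ[Dᵐᵒᵖ] 𝒱.Subquotient q.1.1) where
  toFun u q := 𝒱.proj q.1.1 ∘ₗ u.1 ∘ₗ 𝒱.incl q.1.2
  map_add' u v := by
    ext1 q
    refine LinearMap.ext fun x => ?_
    simp
  map_smul' c u := by
    ext1 q
    refine LinearMap.ext fun x => ?_
    simp [LinearMap.map_smul_of_tower]

theorem jointToPi_surjective : Function.Surjective (jointToPi X) := by
  classical
  intro t
  refine ⟨∑ i, ⟨_, incl_comp_proj_mem_joint (t i).2⟩, ?_⟩
  ext1 k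
  rw [map_sum, Finset.sum_apply, Finset.sum_eq_single k]
  · apply Subtype.ext
    exact induced_incl_comp_proj_self _ _
  · intro i _ hi
    apply Subtype.ext
    exact induced_incl_comp_proj_of_ne le_rfl (Or.inl hi.symm) _
  · simp

theorem upperToPi_bijective : Function.Bijective (upperToPi (F := F) (𝒱 := 𝒱)) := by
  classical
  constructor
  · rw [injective_iff_map_eq_zero]
    intro u hu
    apply Subtype.ext
    obtain ⟨hs, hi⟩ := u.2
    have key : ∀ i j q, 𝒱.proj i (u.1 (𝒱.incl j q)) = 0 := by
      intro i j q
      rcases lt_trichotomy i j with h | h | h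
      · exact LinearMap.congr_fun (congrFun hu ⟨(i, j), h⟩) q
      · subst h
        rw [← induced_apply hs, (Submodule.mem_bot F).1 (hi i)]
        rfl
      · exact 𝒱.proj_eq_zero (Fin.succ_le_castSucc_iff.2 h) (hs _ _ (𝒱.incl_mem j q))
    ext1 x
    apply 𝒱.splitting.injective
    ext1 i
    rw [splitting_apply, ← 𝒱.sum_incl_proj x, map_sum, map_sum]
    simp [key]
  · intro f
    refine ⟨∑ q, ⟨_, incl_comp_proj_mem_joint_of_lt q.2 (f q)⟩, ?_⟩
    ext1 q
    refine LinearMap.ext fun x => ?_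
    rw [map_sum, Finset.sum_apply, LinearMap.sum_apply, Finset.sum_eq_single q]
    · simp [upperToPi]
    · intro r _ hr
      simp only [upperToPi, LinearMap.coe_mk, AddHom.coe_mk, LinearMap.comp_apply]
      by_cases h : q.1.1 = r.1.1
      · have h2 : r.1.2 ≠ q.1.2 := fun h2 => hr (Subtype.ext (Prod.ext h.symm h2))
        rw [𝒱.proj_incl_of_ne h2, map_zero, map_zero, map_zero]
      · exact 𝒱.proj_incl_of_ne h _
    · simp

theorem ker_jointToPi :
    (LinearMap.ker (jointToPi X)).map (𝒱.joint X).subtype =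
      𝒱.joint (fun _ => (⊥ : Submodule F _)) := by
  ext u
  simp only [Submodule.mem_map, LinearMap.mem_ker, Submodule.subtype_apply, Subtype.exists]
  constructor
  · rintro ⟨u, hu, hu0, rfl⟩
    refine ⟨hu.fst, fun i => ?_⟩
    rw [Submodule.mem_bot]
    exact congrArg Subtype.val (congrFun hu0 i)
  · rintro ⟨hs, hu⟩
    have hu' : ∀ i, 𝒱.induced u hs i = 0 := fun i => (Submodule.mem_bot F).1 (hu i)
    refine ⟨u, ⟨hs, fun i => ?_⟩, ?_, rfl⟩
    · rw [hu' i]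
      exact zero_mem _
    · ext1 i
      apply Subtype.ext
      exact hu' i

/-- Diagonal blocks range freely over the X i, and the kernel of the diagonal map consists of
arbitrary strictly upper blocks. -/
theorem finrank_joint [FiniteDimensional F D] [FiniteDimensional Dᵐᵒᵖ V] :
    finrank F (𝒱.joint X) = ∑ i, finrank F (X i) +
      ∑ q : {q : Fin 𝒱.length × Fin 𝒱.length // q.1 < q.2}, finrank F D *
        (finrank Dᵐᵒᵖ (𝒱.Subquotient q.1.2) * finrank Dᵐᵒᵖ (𝒱.Subquotient q.1.1)) := by
  have : ∀ q : {q : Fin 𝒱.length × Fin 𝒱.length // q.1 < q.2},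
      Module.Finite F (𝒱.Subquotient q.1.2 →ₗ[Dᵐᵒᵖ] 𝒱.Subquotient q.1.1) := fun _ => finite_hom
  have : ∀ q : {q : Fin 𝒱.length × Fin 𝒱.length // q.1 < q.2},
      Module.Free F (𝒱.Subquotient q.1.2 →ₗ[Dᵐᵒᵖ] 𝒱.Subquotient q.1.1) :=
    fun _ => Module.Free.of_divisionRing F _
  have h := @finrank_eq_sum_add_finrank_ker F (Fin 𝒱.length) (𝒱.joint X) _ _ _ _ _
    (fun i => Module.End Dᵐᵒᵖ (𝒱.Subquotient i)) (fun _ => LinearMap.addCommGroup)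
    (fun _ => LinearMap.module) (fun _ => finite_hom) X (jointToPi X) jointToPi_surjective
  rw [h, ← Submodule.finrank_map_subtype_eq, ker_jointToPi,
    (LinearEquiv.ofBijective _ (upperToPi_bijective (F := F) (𝒱 := 𝒱))).finrank_eq,
    Module.finrank_pi_fintype]
  congr 1
  exact Finset.sum_congr rfl fun q _ => finrank_hom

/-- A nonzero eigenvector has nonzero image in exactly the quotient V_{i+1} / V_i where it first
appears, and is an eigenvector there. -/
theorem hasTrivialSpectrum_joint (hX : ∀ i, HasTrivialSpectrum (X i)) :
    HasTrivialSpectrum (𝒱.joint X) := by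
  rintro u ⟨hs, hu⟩ c hc x hx
  by_contra hx0
  obtain ⟨i, hi, hi'⟩ := 𝒱.exists_mem_notMem hx0
  apply hi'
  rw [← 𝒱.proj_eq_zero_iff hi]
  apply hX i _ (hu i) c hc
  rw [induced_proj hs hi, hx, LinearMap.map_smul_of_tower]

/-- The operators on `V_{i+1} / V_i` induced by the elements of `S`. -/
def inducedSpace (𝒱 : SubspaceFlag D V) (S : Submodule F (Module.End Dᵐᵒᵖ V))
    (i : Fin 𝒱.length) : Submodule F (Module.End Dᵐᵒᵖ (𝒱.Subquotient i)) where
  carrier := {t | ∃ u ∈ S, ∃ hu : 𝒱.IsStable u, 𝒱.induced u hu i = t}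
  add_mem' := by
    rintro s t ⟨u, hu, hu', rfl⟩ ⟨v, hv, hv', rfl⟩
    refine ⟨u + v, add_mem hu hv, fun j x hx => add_mem (hu' j x hx) (hv' j x hx), ?_⟩
    ext x
    rfl
  zero_mem' := by
    refine ⟨0, zero_mem _, fun j x _ => zero_mem _, ?_⟩
    ext x
    rfl
  smul_mem' := by
    rintro c t ⟨u, hu, hu', rfl⟩
    refine ⟨c • u, S.smul_mem c hu, fun j x hx => (𝒱.space j).smul_of_tower_mem c (hu' j x hx), ?_⟩
    ext x
    rfl

variable {S : Submodule F (Module.End Dᵐᵒᵖ V)}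

/-- Lift an eigenvector to x. Then (u − c) x lies in V_i, where u − c is bijective, so x can be
corrected by an element of V_i to a genuine eigenvector, which must vanish. -/
theorem hasTrivialSpectrum_inducedSpace [FiniteDimensional Dᵐᵒᵖ V] (hS : HasTrivialSpectrum S)
    (i : Fin 𝒱.length) : HasTrivialSpectrum (𝒱.inducedSpace S i) := by
  rintro _ ⟨u, hu, hs, rfl⟩ c hc q hq
  set x := 𝒱.incl i q with hx
  have hxi : x ∈ 𝒱.space i.succ := 𝒱.incl_mem i q
  have h1 : u x - c • x ∈ 𝒱.space i.castSucc := by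
    rw [← 𝒱.proj_eq_zero_iff
      (sub_mem (hs _ x hxi) ((𝒱.space i.succ).smul_of_tower_mem c hxi)),
      map_sub, LinearMap.map_smul_of_tower, ← induced_proj hs hxi, hx, proj_incl_self, hq, sub_self]
  let g : Module.End Dᵐᵒᵖ (𝒱.space i.castSucc) :=
    u.restrict (hs i.castSucc) - c • LinearMap.id
  have hg : ∀ z, ((g z : 𝒱.space i.castSucc) : V) = u z - c • (z : V) := fun z => rfl
  have hinj : Function.Injective g := by
    rw [injective_iff_map_eq_zero]
    intro z hz
    have h2 := hg z
    rw [hz] at h2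
    exact Subtype.ext (hS u hu c hc z (sub_eq_zero.1 h2.symm))
  obtain ⟨z, hz⟩ := LinearMap.injective_iff_surjective.1 hinj ⟨_, h1⟩
  have h2 : u z - c • (z : V) = u x - c • x := by rw [← hg, hz]
  have h3 := hS u hu c hc (x - z) (by
    rw [map_sub, smul_sub]
    rw [sub_eq_sub_iff_add_eq_add] at h2 ⊢
    rw [add_comm (c • x), h2, add_comm])
  have h4 : x ∈ 𝒱.space i.castSucc := by
    rw [sub_eq_zero.1 h3]
    exact z.2
  rw [← 𝒱.proj_eq_zero_iff hxi, hx, proj_incl_self] at h4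
  exact h4

section FiniteDimensional

variable [FiniteDimensional F D] [FiniteDimensional Dᵐᵒᵖ V]

/-- The defect of a joint in the dimension bound is the sum of the defects of its blocks; the terms
are arranged to avoid subtraction. -/
theorem two_mul_finrank_joint :
    2 * finrank F (𝒱.joint X) + 2 * finrank Dᵐᵒᵖ V + ∑ i, finrank F D *
      finrank Dᵐᵒᵖ (𝒱.Subquotient i) * (finrank Dᵐᵒᵖ (𝒱.Subquotient i) + 1) =
    finrank F D * finrank Dᵐᵒᵖ V * (finrank Dᵐᵒᵖ V + 1) +
      ∑ i, (2 * finrank F (X i) + 2 * finrank Dᵐᵒᵖ (𝒱.Subquotient i)) := by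
  rw [finrank_joint, 𝒱.finrank_eq_sum, ← Finset.mul_sum]
  have h := sq_sum_eq_sum_sq_add fun i => finrank Dᵐᵒᵖ (𝒱.Subquotient i)
  simp only [mul_add, Finset.sum_add_distrib, mul_one, ← Finset.mul_sum, mul_assoc, ← sq]
  rw [h]
  ring

theorem isFull_joint (hX : ∀ i, IsFull (X i)) : IsFull (𝒱.joint X) := by
  refine ⟨hasTrivialSpectrum_joint fun i => (hX i).1, ?_⟩
  have h := two_mul_finrank_joint (X := X)
  rw [Finset.sum_congr rfl fun i _ => (hX i).2] at h
  exact Nat.add_right_cancel h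

theorem finrank_subquotient_le (i : Fin 𝒱.length) :
    finrank F (𝒱.Subquotient i) ≤ finrank F V := by
  have := finite_of_tower F D V
  apply LinearMap.finrank_le_finrank_of_injective (f := (𝒱.incl i).restrictScalars F)
  intro q r h
  rw [← 𝒱.proj_incl_self i q, ← 𝒱.proj_incl_self i r]
  exact congrArg _ h

/-- S sits inside the joint of its induced spaces, and these obey the bound, so the joint cannot be
larger than the full space S and no block can have a defect. -/
theorem eq_joint_inducedSpace (hF : (finrank F V : Cardinal) ≤ Cardinal.mk F) (hS : IsFull S)
    (h𝒱 : ∀ u ∈ S, 𝒱.IsStable u) :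
    S = 𝒱.joint (𝒱.inducedSpace S) ∧ ∀ i, IsFull (𝒱.inducedSpace S i) := by
  have hle : S ≤ 𝒱.joint (𝒱.inducedSpace S) :=
    fun u hu => ⟨h𝒱 u hu, fun i => ⟨u, hu, h𝒱 u hu, rfl⟩⟩
  have htriv := fun i => hasTrivialSpectrum_inducedSpace (𝒱 := 𝒱) hS.1 i
  have hb : ∀ i ∈ Finset.univ, 2 * finrank F (𝒱.inducedSpace S i) +
      2 * finrank Dᵐᵒᵖ (𝒱.Subquotient i) ≤
      finrank F D * finrank Dᵐᵒᵖ (𝒱.Subquotient i) * (finrank Dᵐᵒᵖ (𝒱.Subquotient i) + 1) :=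
    fun i _ => (htriv i).finrank_le
      ((Nat.cast_le.2 (finrank_subquotient_le (F := F) i)).trans hF)
  have h := two_mul_finrank_joint (X := 𝒱.inducedSpace S)
  have h1 := Submodule.finrank_mono hle
  have h2 := hS.2
  have h3 := Finset.sum_le_sum hb
  have h4 := (Finset.sum_eq_sum_iff_of_le hb).1 (by omega)
  exact ⟨Submodule.eq_of_le_of_finrank_le hle (by omega),
    fun i => ⟨htriv i, h4 i (Finset.mem_univ _)⟩⟩

end FiniteDimensional

end SubspaceFlag

namespace SubspaceFlag

/-! ### Invariant subspaces and maximal invariant flags. -/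

section InvariantFlags

variable {F D V : Type*} [Field F] [DivisionRing D] [Algebra F D]
  [AddCommGroup V] [Module Dᵐᵒᵖ V] [Module F V] [IsScalarTower F Dᵐᵒᵖ V]

/-- A flag of `S`-invariant subspaces that cannot be refined. -/
theorem exists_maximal_invariant_flag [FiniteDimensional Dᵐᵒᵖ V]
    (S : Submodule F (Module.End Dᵐᵒᵖ V)) :
    ∃ 𝒱 : SubspaceFlag D V, (∀ u ∈ S, 𝒱.IsStable u) ∧
      ∀ (i : Fin 𝒱.length) (W : Submodule Dᵐᵒᵖ V), (∀ u ∈ S, ∀ x ∈ W, u x ∈ W) →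
        𝒱.space i.castSucc ≤ W → W ≤ 𝒱.space i.succ →
        W = 𝒱.space i.castSucc ∨ W = 𝒱.space i.succ := by
  classical
  let I := {W : Submodule Dᵐᵒᵖ V // ∀ u ∈ S, ∀ x ∈ W, u x ∈ W}
  -- `Flag` is a maximal chain, here of invariant subspaces; dimension separates its members, so it
  -- is finite and can be numbered.
  obtain ⟨c⟩ : Nonempty (Flag I) := inferInstance
  have hfin : Finite c := by
    let g : c → Fin (finrank Dᵐᵒᵖ V + 1) :=
      fun W => ⟨finrank Dᵐᵒᵖ W.1.1, Nat.lt_succ_of_le (Submodule.finrank_le _)⟩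
    apply Finite.of_injective g
    intro W W' h
    have h' : finrank Dᵐᵒᵖ W.1.1 = finrank Dᵐᵒᵖ W'.1.1 := congrArg Fin.val h
    rcases le_total W W' with hl | hl
    · exact Subtype.ext (Subtype.ext (Submodule.eq_of_le_of_finrank_eq hl h'))
    · exact (Subtype.ext (Subtype.ext (Submodule.eq_of_le_of_finrank_eq hl h'.symm))).symm
  let bot : I := ⟨⊥, fun u _ x hx => by
    rw [Submodule.mem_bot] at hx ⊢
    rw [hx, map_zero]⟩
  let top : I := ⟨⊤, fun u _ x _ => trivial⟩
  have hbot : bot ∈ c := Flag.mem_iff_forall_le_or_ge.2 fun W _ =>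
    Or.inl (show (⊥ : Submodule Dᵐᵒᵖ V) ≤ W.1 from bot_le)
  have htop : top ∈ c := Flag.mem_iff_forall_le_or_ge.2 fun W _ =>
    Or.inr (show W.1 ≤ (⊤ : Submodule Dᵐᵒᵖ V) from le_top)
  let _ := Fintype.ofFinite c
  obtain ⟨p, hp⟩ : ∃ p, Fintype.card c = p + 1 :=
    have : Nonempty c := ⟨⟨bot, hbot⟩⟩
    ⟨_, (Nat.succ_pred Fintype.card_ne_zero).symm⟩
  let ε : Fin (p + 1) ≃o c := Fintype.orderIsoFinOfCardEq c hp
  have hmono : StrictMono fun j => (ε j).1.1 := fun i j h => ε.strictMono h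
  refine ⟨⟨p, fun j => (ε j).1.1, hmono, ?_, ?_⟩, ?_, ?_⟩
  · rw [eq_bot_iff]
    have h : ε 0 ≤ ε (ε.symm ⟨bot, hbot⟩) := ε.monotone (Fin.zero_le _)
    rw [OrderIso.apply_symm_apply] at h
    exact h
  · rw [eq_top_iff]
    have h : ε (ε.symm ⟨top, htop⟩) ≤ ε (Fin.last p) := ε.monotone (Fin.le_last _)
    rw [OrderIso.apply_symm_apply] at h
    exact h
  · intro u hu j x hx
    exact (ε j).1.2 u hu x hx
  · intro i W hW h1 h2
    have hWc : (⟨W, hW⟩ : I) ∈ c := by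
      refine Flag.mem_iff_forall_le_or_ge.2 fun W' hW' => ?_
      obtain ⟨j, hj⟩ := ε.surjective ⟨W', hW'⟩
      have hj' : (ε j).1 = W' := congrArg Subtype.val hj
      rcases le_or_gt j i.castSucc with h | h
      · refine Or.inr ?_
        rw [← hj']
        exact (hmono.monotone h).trans h1
      · refine Or.inl ?_
        rw [← hj']
        exact h2.trans (hmono.monotone (Fin.castSucc_lt_iff_succ_le.1 h))
    obtain ⟨j, hj⟩ := ε.surjective ⟨_, hWc⟩
    have hj' : (ε j).1.1 = W := congrArg (fun z : c => z.1.1) hj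
    rw [← hj'] at h1 h2 ⊢
    have h3 := hmono.le_iff_le.1 h1
    have h4 := hmono.le_iff_le.1 h2
    rcases h3.eq_or_lt with h | h
    · exact Or.inl (by rw [h])
    · exact Or.inr (by rw [le_antisymm h4 (Fin.castSucc_lt_iff_succ_le.1 h)])

variable {𝒱 : SubspaceFlag D V}

theorem rankOne_mem_joint {X : ∀ i : Fin 𝒱.length, Submodule F (Module.End Dᵐᵒᵖ (𝒱.Subquotient i))}
    {i : Fin 𝒱.length} {z : V} (hz : z ∈ 𝒱.space i.castSucc) (β : 𝒱.Subquotient i →ₗ[Dᵐᵒᵖ] D) :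
    rankOne z (β ∘ₗ 𝒱.proj i) ∈ 𝒱.joint X := by
  have hs : 𝒱.IsStable (rankOne z (β ∘ₗ 𝒱.proj i)) := by
    intro k x hx
    rw [rankOne_apply, LinearMap.comp_apply]
    by_cases hk : k ≤ i.castSucc
    · rw [𝒱.proj_eq_zero hk hx, map_zero, op_zero, zero_smul]
      exact zero_mem _
    · exact (𝒱.space k).smul_mem _ (𝒱.strictMono.monotone (not_le.1 hk).le hz)
  refine ⟨hs, fun k => ?_⟩
  have : 𝒱.induced _ hs k = 0 := by
    refine LinearMap.ext fun q => ?_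
    rw [induced_apply, rankOne_apply, LinearMap.comp_apply, map_smul, LinearMap.zero_apply]
    by_cases hk : k = i
    · subst hk
      rw [𝒱.proj_eq_zero le_rfl hz, smul_zero]
    · rw [𝒱.proj_incl_of_ne (Ne.symm hk), map_zero, op_zero, zero_smul]
  rw [this]
  exact zero_mem _

/-- If W lies in V_{i+1} and contains x outside V_i, the strictly upper rank-one operators of the
joint send x to every vector of V_i. So W lies between V_i and V_{i+1}, and irrefinability decides.
-/
theorem isInvariantFlag_joint
    {X : ∀ i : Fin 𝒱.length, Submodule F (Module.End Dᵐᵒᵖ (𝒱.Subquotient i))}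
    (h : ∀ (i : Fin 𝒱.length) (W : Submodule Dᵐᵒᵖ V), (∀ u ∈ 𝒱.joint X, ∀ x ∈ W, u x ∈ W) →
        𝒱.space i.castSucc ≤ W → W ≤ 𝒱.space i.succ →
        W = 𝒱.space i.castSucc ∨ W = 𝒱.space i.succ) : 𝒱.IsInvariantFlag (𝒱.joint X) := by
  intro W
  constructor
  · intro hW
    by_cases hb : W = ⊥
    · exact ⟨0, by rw [𝒱.space_zero, hb]⟩
    obtain ⟨i, hi, hi'⟩ : ∃ i : Fin 𝒱.length, W ≤ 𝒱.space i.succ ∧ ¬ W ≤ 𝒱.space i.castSucc := by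
      by_contra! h'
      have : ∀ k, W ≤ 𝒱.space k := by
        intro k
        induction k using Fin.reverseInduction with
        | last => rw [𝒱.space_last]; exact le_top
        | cast i ih => exact h' i ih
      apply hb
      have h0 := this 0
      rwa [𝒱.space_zero, le_bot_iff] at h0
    refine ⟨i.succ, ?_⟩
    obtain ⟨x, hx, hx'⟩ := Set.not_subset.1 hi'
    have hq : 𝒱.proj i x ∉ (⊥ : Submodule Dᵐᵒᵖ (𝒱.Subquotient i)) := by
      rw [Submodule.mem_bot, 𝒱.proj_eq_zero_iff (hi hx)]
      exact hx'
    obtain ⟨β, hβ, -⟩ := exists_form_of_notMem hq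
    have hle : 𝒱.space i.castSucc ≤ W := by
      intro z hz
      have := hW _ (rankOne_mem_joint hz β) x hx
      rwa [rankOne_apply, LinearMap.comp_apply, hβ, op_one, one_smul] at this
    rcases h i W hW hle hi with h1 | h1
    · exact absurd h1.le hi'
    · exact h1.symm
  · rintro ⟨j, rfl⟩ u ⟨hu, -⟩
    exact hu j

/-- The flag `0 ⊂ K ⊂ V`. -/
def ofSubspace {K : Submodule Dᵐᵒᵖ V} (h0 : K ≠ ⊥) (h1 : K ≠ ⊤) : SubspaceFlag D V where
  length := 2
  space := ![⊥, K, ⊤]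
  strictMono := by
    rw [Fin.strictMono_iff_lt_succ]
    intro i
    fin_cases i
    · exact bot_lt_iff_ne_bot.2 h0
    · exact lt_top_iff_ne_top.2 h1
  space_zero := rfl
  space_last := rfl

end InvariantFlags

end SubspaceFlag

section Reducible

variable {F D V : Type*} [Field F] [DivisionRing D] [Algebra F D] [FiniteDimensional F D]
  [AddCommGroup V] [Module Dᵐᵒᵖ V] [Module F V] [IsScalarTower F Dᵐᵒᵖ V]
  [FiniteDimensional Dᵐᵒᵖ V] {S : Submodule F (Module.End Dᵐᵒᵖ V)}

/-- If `K` is `S`-invariant, then `S` contains all the operators `y ↦ k (f y)` with `k ∈ K` and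
`f` vanishing on `K`. -/
theorem IsFull.rankOne_mem (hF : (finrank F V : Cardinal) ≤ Cardinal.mk F) (hS : IsFull S)
    {K : Submodule Dᵐᵒᵖ V} (hK : ∀ u ∈ S, ∀ x ∈ K, u x ∈ K) {k : V} (hk : k ∈ K)
    {f : V →ₗ[Dᵐᵒᵖ] D} (hf : ∀ x ∈ K, f x = 0) : rankOne k f ∈ S := by
  by_cases h0 : K = ⊥
  · rw [h0, Submodule.mem_bot] at hk
    have : rankOne k f = 0 := by
      ext y
      simp [hk]
    rw [this]
    exact zero_mem _
  by_cases h1 : K = ⊤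
  · have : rankOne k f = 0 := by
      ext y
      have : f y = 0 := hf y (by rw [h1]; trivial)
      simp [this]
    rw [this]
    exact zero_mem _
  let 𝒱 : SubspaceFlag D V := SubspaceFlag.ofSubspace h0 h1
  have hst : ∀ u ∈ S, 𝒱.IsStable u := by
    intro u hu j
    fin_cases j
    · intro x hx
      have hx0 : x = 0 := hx
      rw [hx0, map_zero]
      exact zero_mem _
    · exact hK u hu
    · exact fun x _ => trivial
  -- Along the flag 0 ⊂ K ⊂ V all induced blocks of the operator vanish, so it lies in the joint
  -- that equals S.
  rw [(SubspaceFlag.eq_joint_inducedSpace hF hS hst).1]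
  have hs : 𝒱.IsStable (rankOne k f) := by
    intro j
    fin_cases j
    · intro x hx
      have hx0 : x = 0 := hx
      rw [hx0, map_zero]
      exact zero_mem _
    · exact fun x _ => K.smul_mem _ hk
    · exact fun x _ => trivial
  refine ⟨hs, fun i => ?_⟩
  have : 𝒱.induced _ hs i = 0 := by
    refine LinearMap.ext fun q => ?_
    obtain ⟨q, rfl⟩ := Submodule.Quotient.mk_surjective _ q
    refine (Submodule.Quotient.mk_eq_zero _).2 ?_
    change op (f q) • k ∈ 𝒱.space i.castSucc
    obtain ⟨q, hq⟩ := q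
    revert q
    fin_cases i
    · intro q hq
      have h2 : f q = 0 := hf q hq
      rw [h2, op_zero, zero_smul]
      exact zero_mem _
    · intro q _
      exact K.smul_mem _ hk
  rw [this]
  exact zero_mem _

end Reducible

/-! ### Alternating spaces of nonisotropic forms: orbits, fullness, uniqueness. -/

section SesquilinearForms

variable {F D V W : Type*} [Field F] [DivisionRing D] [Algebra F D]
  [AddCommGroup V] [Module Dᵐᵒᵖ V] [AddCommGroup W] [Module Dᵐᵒᵖ W] {σ : Dᵐᵒᵖ ≃ₐ[F] D}

/-- Constructor for sesquilinear forms. -/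
def SesquilinearForm.ofFun (f : W → W → D) (h1 : ∀ x x' y, f (x + x') y = f x y + f x' y)
    (h2 : ∀ (a : Dᵐᵒᵖ) x y, f (a • x) y = σ a * f x y)
    (h3 : ∀ x y y', f x (y + y') = f x y + f x y')
    (h4 : ∀ (a : Dᵐᵒᵖ) x y, f x (a • y) = f x y * unop a) : SesquilinearForm σ W where
  toFun x :=
    { toFun := f x
      map_add' := h3 x
      map_smul' := fun a y => h4 a x y }
  map_add' x x' := LinearMap.ext fun y => h1 x x' y
  map_smul' a x := LinearMap.ext fun y => h2 a x y

variable (B : SesquilinearForm σ W)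

theorem sesq_smul_left' (a : Dᵐᵒᵖ) (x y : W) : B (a • x) y = σ a * B x y := by
  rw [LinearMap.map_smulₛₗ, LinearMap.smul_apply, smul_eq_mul]
  rfl

theorem sesq_smul_right' (a : Dᵐᵒᵖ) (x y : W) : B x (a • y) = B x y * unop a := by
  rw [map_smul, ← op_unop a, op_smul_eq_mul, op_unop]

/-- The form `(x, y) ↦ B (ψ x) (ψ y)`. -/
def SesquilinearForm.pullback (ψ : V →ₗ[Dᵐᵒᵖ] W) : SesquilinearForm σ V :=
  SesquilinearForm.ofFun (fun x y => B (ψ x) (ψ y)) (fun x x' y => by simp)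
    (fun a x y => by rw [map_smul, sesq_smul_left']) (fun x y y' => by simp)
    (fun a x y => by rw [map_smul, sesq_smul_right'])

@[simp]
theorem SesquilinearForm.pullback_apply (ψ : V →ₗ[Dᵐᵒᵖ] W) (x y : V) :
    SesquilinearForm.pullback B ψ x y = B (ψ x) (ψ y) := rfl

variable {B} {e : D →ₗ[F] F}

theorem IsNonisotropic.pullback (hB : IsNonisotropic e B) {ψ : V →ₗ[Dᵐᵒᵖ] W}
    (hψ : Function.Injective ψ) : IsNonisotropic e (SesquilinearForm.pullback B ψ) := by
  intro x hx
  rw [SesquilinearForm.pullback_apply]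
  exact hB _ ((map_ne_zero_iff ψ hψ).2 hx)

variable (B) in
/-- The `D`-linear form `z ↦ σ (B z p)`. -/
def conjForm (hp : IsQuadraticPair σ e) (p : W) : W →ₗ[Dᵐᵒᵖ] D where
  toFun z := σ (op (B z p))
  map_add' z z' := by rw [map_add, LinearMap.add_apply, conj_add]
  map_smul' a z := by
    rw [sesq_smul_left', conj_mul, RingHom.id_apply, ← op_unop a, hp.invol, op_smul_eq_mul]

theorem conjForm_apply (hp : IsQuadraticPair σ e) (p z : W) :
    conjForm B hp p z = σ (op (B z p)) := rfl

variable [Module F W] [IsScalarTower F Dᵐᵒᵖ W]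

@[simp]
theorem formComp_apply (x y : W) : formComp e B x y = e (B x y) := rfl

theorem mem_altSpace {u : Module.End Dᵐᵒᵖ W} :
    u ∈ altSpace D (formComp e B) ↔ ∀ x, e (B x (u x)) = 0 := Iff.rfl

theorem hasTrivialSpectrum_altSpace (hB : IsNonisotropic e B) :
    HasTrivialSpectrum (altSpace D (formComp e B)) := by
  intro u hu c hc x hx
  by_contra hx0
  have h1 := mem_altSpace.1 hu x
  rw [hx, sesq_smul_right, map_smul, smul_eq_mul, mul_eq_zero] at h1
  exact h1.elim hc (hB x hx0)

theorem apply_add_apply_eq_zero {u : Module.End Dᵐᵒᵖ W} (hu : u ∈ altSpace D (formComp e B))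
    (x y : W) : e (B x (u y)) + e (B y (u x)) = 0 := by
  have h := mem_altSpace.1 hu (x + y)
  simp only [map_add, LinearMap.add_apply, mem_altSpace.1 hu x, mem_altSpace.1 hu y] at h
  rw [add_comm]
  simpa using h

omit [Module F W] [IsScalarTower F Dᵐᵒᵖ W] in
theorem IsNonisotropic.apply_self_ne_zero (hB : IsNonisotropic e B) {x : W} (hx : x ≠ 0) :
    B x x ≠ 0 := by
  intro h
  apply hB x hx
  rw [h, map_zero]

theorem mem_orbit_altSpace (hp : IsQuadraticPair σ e) (hB : IsNonisotropic e B) {y : W}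
    (hy : y ≠ 0) {w : W} : w ∈ orbit (altSpace D (formComp e B)) y ↔ e (B y w) = 0 := by
  constructor
  · rintro ⟨u, hu, rfl⟩
    exact mem_altSpace.1 hu y
  intro hw
  set p : W := op (B y y)⁻¹ • y with hpdef
  have hyp : B y p = 1 := by
    rw [hpdef, sesq_smul_right', unop_op, mul_inv_cancel₀ (hB.apply_self_ne_zero hy)]
  set s : D := σ (op (B y w)) with hs
  have hes : e s = 0 := by rw [hs, hp.apply_conj, hw]
  -- The first two terms are alternating since they give e of an element minus its conjugate. They
  -- send y to w − p s; the third term, alternating because e(s) = 0, restores p s.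
  refine ⟨rankOne w (conjForm B hp p) - rankOne p (conjForm B hp w) +
    rankOne (op s • p) (conjForm B hp p), ?_, ?_⟩
  · refine mem_altSpace.2 fun z => ?_
    simp only [LinearMap.add_apply, LinearMap.sub_apply, rankOne_apply, conjForm_apply, map_add,
      map_sub, sesq_smul_right', unop_op]
    have h1 : e (B z w * σ (op (B z p))) = e (B z p * σ (op (B z w))) := by
      rw [← hp.apply_conj, conj_mul, hp.invol]
    have h2 := hp.apply_conj_mul_mul_eq_zero (σ (op (B z p))) hes
    rw [hp.invol] at h2
    rw [h1, h2, sub_self, add_zero]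
  · change op (conjForm B hp p y) • w - op (conjForm B hp w y) • p +
      op (conjForm B hp p y) • op s • p = w
    rw [conjForm_apply, conjForm_apply, hyp, ← hs, op_one, map_one, op_one, one_smul, one_smul,
      sub_add_cancel]

omit [Module F W] [IsScalarTower F Dᵐᵒᵖ W] in
theorem eq_zero_of_forall_apply_apply (he : e ≠ 0) {x y : W}
    (h : ∀ a : Dᵐᵒᵖ, e (B x (a • y)) = 0) : B x y = 0 := by
  apply eq_zero_of_forall_apply_mul he
  intro a
  have := h (op a)
  rwa [sesq_smul_right', unop_op] at this

theorem apply_apply_eq_zero_of_mem_stab (hp : IsQuadraticPair σ e) {y : W}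
    {u : Module.End Dᵐᵒᵖ W} (hu : u ∈ stab (altSpace D (formComp e B)) y) (z : W) :
    B y (u z) = 0 := by
  apply eq_zero_of_forall_apply_apply hp.ne_zero
  intro a
  have h := apply_add_apply_eq_zero hu.1 y (a • z)
  have hy : u y = 0 := hu.2
  rw [map_smul, hy, map_zero, map_zero, add_zero] at h
  exact h

/-- An alternating t on ker B(y, ·) is extended by t ∘ π, with π the projection along y. Replacing
the left argument z by π z changes nothing, because B(y a, ·) vanishes on the values of t. -/
theorem restrictTo_stab_altSpace (hB : IsNonisotropic e B) {y : W}
    (hy : y ≠ 0) : restrictTo (stab (altSpace D (formComp e B)) y) (LinearMap.ker (B y)) =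
      altSpace D (formComp e (SesquilinearForm.pullback B (LinearMap.ker (B y)).subtype)) := by
  ext t
  constructor
  · rintro ⟨u, hu, hut⟩
    refine mem_altSpace.2 fun x => ?_
    rw [SesquilinearForm.pullback_apply, Submodule.subtype_apply, Submodule.subtype_apply, ← hut]
    exact mem_altSpace.1 hu.1 _
  · intro ht
    have hyy := hB.apply_self_ne_zero hy
    let π : W →ₗ[Dᵐᵒᵖ] LinearMap.ker (B y) :=
      LinearMap.codRestrict _ (LinearMap.id - rankOne y ((B y y)⁻¹ • B y)) fun z => by
        rw [LinearMap.mem_ker, LinearMap.sub_apply, LinearMap.id_apply, rankOne_apply, map_sub,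
          sesq_smul_right', unop_op, LinearMap.smul_apply, smul_eq_mul,
          mul_inv_cancel_left₀ hyy, sub_self]
    have hπ : ∀ z, (π z : W) = z - op ((B y y)⁻¹ * B y z) • y := fun z => rfl
    have hπk : ∀ z : LinearMap.ker (B y), π z = z := by
      intro z
      apply Subtype.ext
      rw [hπ, LinearMap.mem_ker.1 z.2, mul_zero, op_zero, zero_smul, sub_zero]
    refine ⟨(LinearMap.ker (B y)).subtype ∘ₗ t ∘ₗ π, ⟨mem_altSpace.2 fun z => ?_, ?_⟩, fun h => ?_⟩
    · have h1 := mem_altSpace.1 ht (π z)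
      rw [SesquilinearForm.pullback_apply, Submodule.subtype_apply, Submodule.subtype_apply,
        hπ, map_sub, LinearMap.sub_apply, sesq_smul_left', LinearMap.mem_ker.1 (t (π z)).2,
        mul_zero, sub_zero] at h1
      exact h1
    · have h1 : π y = 0 := by
        apply Subtype.ext
        rw [hπ, inv_mul_cancel₀ hyy, op_one, one_smul, sub_self]
        rfl
      change ((t (π y) : LinearMap.ker (B y)) : W) = 0
      rw [h1, map_zero]
      rfl
    · rw [LinearMap.comp_apply, LinearMap.comp_apply, hπk]
      rfl

theorem isGood_altSpace [FiniteDimensional F D] [FiniteDimensional Dᵐᵒᵖ W]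
    (hp : IsQuadraticPair σ e) (hB : IsNonisotropic e B) {y : W} (hy : y ≠ 0) :
    IsGood (altSpace D (formComp e B)) y := by
  have := finite_of_tower F D W
  have h1 : orbit (altSpace D (formComp e B)) y = LinearMap.ker (formComp e B y) := by
    ext w
    rw [mem_orbit_altSpace hp hB hy]
    rfl
  have h2 := (formComp e B y).finrank_range_add_finrank_ker
  have h3 : LinearMap.range (formComp e B y) = ⊤ :=
    LinearMap.range_eq_top.2 (LinearMap.surjective fun h => hB y hy (LinearMap.congr_fun h y))
  rw [h3, finrank_top, finrank_self] at h2
  unfold IsGood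
  rw [h1, ← h2, add_comm]

/-- A nonisotropic form is determined up to a scalar by the space of its alternating operators. -/
theorem exists_smul_eq_of_altSpace_le (hp : IsQuadraticPair σ e) (hB : IsNonisotropic e B)
    {B' : SesquilinearForm σ W}
    (h : altSpace D (formComp e B) ≤ altSpace D (formComp e B')) :
    ∃ c : F, ∀ x y, B' x y = c • B x y := by
  have hinj : Function.Injective (formComp e B) := by
    rw [injective_iff_map_eq_zero]
    intro x hx
    by_contra hx0
    exact hB x hx0 (LinearMap.congr_fun hx x)
  -- For each x ≠ 0 the kernel of e(B(x, ·)) is the orbit of x, on which e(B'(x, ·)) vanishes;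
  -- injectivity makes the factor independent of x.
  obtain ⟨c, hc⟩ := exists_smul_eq_of_forall_exists (formComp e B') (formComp e B) hinj (by
    intro x
    by_cases hx : x = 0
    · exact ⟨0, by simp [hx]⟩
    apply exists_smul_eq_of_ker_le
    intro w hw
    obtain ⟨u, hu, rfl⟩ := (mem_orbit_altSpace hp hB hx).2 hw
    exact mem_altSpace.1 (h hu) x)
  refine ⟨c, fun x y => ?_⟩
  rw [← sub_eq_zero]
  apply eq_zero_of_forall_apply_mul hp.ne_zero
  intro a
  have h1 := LinearMap.congr_fun (hc x) (op a • y)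
  rw [LinearMap.smul_apply, formComp_apply, formComp_apply, sesq_smul_right', sesq_smul_right',
    unop_op] at h1
  rw [sub_mul, map_sub, h1, smul_mul_assoc, map_smul, sub_self]

theorem exists_unit_smul_eq_of_altSpace_le [Nontrivial W] (hp : IsQuadraticPair σ e)
    (hB : IsNonisotropic e B) {B' : SesquilinearForm σ W} (hB' : IsNonisotropic e B')
    (h : altSpace D (formComp e B) ≤ altSpace D (formComp e B')) :
    ∃ c : Fˣ, ∀ x y, B' x y = c • B x y := by
  obtain ⟨c, hc⟩ := exists_smul_eq_of_altSpace_le hp hB h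
  have hc0 : c ≠ 0 := by
    rintro rfl
    obtain ⟨x, hx⟩ := exists_ne (0 : W)
    apply hB' x hx
    rw [hc, zero_smul, map_zero]
  exact ⟨Units.mk0 c hc0, hc⟩

end SesquilinearForms

section Full

universe w

variable {F D : Type*} [Field F] [DivisionRing D] [Algebra F D] [FiniteDimensional F D]
  {σ : Dᵐᵒᵖ ≃ₐ[F] D} {e : D →ₗ[F] F}

/-- Each nonzero orbit is a hyperplane and the stabilizer is the alternating space of the restricted
form, so every step of the induction for the bound is an equality. -/
theorem isFull_altSpace {W : Type w} [AddCommGroup W] [Module Dᵐᵒᵖ W] [Module F W]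
    [IsScalarTower F Dᵐᵒᵖ W] [FiniteDimensional Dᵐᵒᵖ W] (hp : IsQuadraticPair σ e)
    {B : SesquilinearForm σ W} (hB : IsNonisotropic e B) :
    IsFull (altSpace D (formComp e B)) := by
  induction hn : finrank Dᵐᵒᵖ W generalizing W with
  | zero =>
    refine ⟨hasTrivialSpectrum_altSpace hB, ?_⟩
    have : finrank F (Module.End Dᵐᵒᵖ W) = 0 := by rw [finrank_hom, hn]; ring
    have h2 := Submodule.finrank_le (altSpace D (formComp e B))
    rw [this, Nat.le_zero] at h2
    rw [h2, hn]
    simp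
  | succ n ih =>
    refine ⟨hasTrivialSpectrum_altSpace hB, ?_⟩
    have : Nontrivial W := nontrivial_of_finrank_pos (R := Dᵐᵒᵖ) (by omega)
    obtain ⟨y, hy⟩ := exists_ne (0 : W)
    have hyy := hB.apply_self_ne_zero hy
    have h1 := finrank_restrictTo_stab hyy fun u hu z =>
      apply_apply_eq_zero_of_mem_stab (F := F) hp hu z
    rw [restrictTo_stab_altSpace hB hy] at h1
    have h2 := finrank_ker_add_one (β := B y) (fun h => hyy (by rw [h]; rfl))
    have h3 := isGood_altSpace hp hB hy
    have h4 := finrank_eq_orbit_add_stab (altSpace D (formComp e B)) y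
    have h5 : finrank Dᵐᵒᵖ (LinearMap.ker (B y)) = n := by omega
    have h6 := (ih (hB.pullback (Submodule.subtype_injective (LinearMap.ker (B y)))) h5).2
    unfold IsGood at h3
    rw [finrank_of_tower F D W, hn] at h3
    rw [h1, h5] at h6
    rw [hn]
    nlinarith

end Full

/-! ### Irreducible full spaces: stabilizers and orbits. -/

section Irreducible

variable {F D V : Type*} [Field F] [DivisionRing D] [Algebra F D]
  [AddCommGroup V] [Module Dᵐᵒᵖ V] [Module F V] [IsScalarTower F Dᵐᵒᵖ V]
  {S : Submodule F (Module.End Dᵐᵒᵖ V)} {x : V}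
  {σ : Dᵐᵒᵖ ≃ₐ[F] D} {e : D →ₗ[F] F} {β : V →ₗ[Dᵐᵒᵖ] D}

/-- The only `S`-invariant subspaces are `0` and `V`. -/
def IsIrreducible (S : Submodule F (Module.End Dᵐᵒᵖ V)) : Prop :=
  ∀ K : Submodule Dᵐᵒᵖ V, (∀ u ∈ S, ∀ x ∈ K, u x ∈ K) → K = ⊥ ∨ K = ⊤

theorem sub_smul_mem_ker (hβ : β x ≠ 0) (y : V) :
    y - op ((β x)⁻¹ * β y) • x ∈ LinearMap.ker β := by
  rw [LinearMap.mem_ker, map_sub, map_smul, op_smul_eq_mul, mul_inv_cancel_left₀ hβ, sub_self]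

/-- Two operators that agree on `x` and on a complementary hyperplane are equal. -/
theorem end_ext_of_ker (hβ : β x ≠ 0) {u v : Module.End Dᵐᵒᵖ V} (hx : u x = v x)
    (h : ∀ y ∈ LinearMap.ker β, u y = v y) : u = v := by
  ext y
  have h1 := h _ (sub_smul_mem_ker hβ y)
  rw [map_sub, map_sub, map_smul, map_smul, hx] at h1
  exact sub_left_injective h1

theorem apply_self_ne_zero_of_orbit (hS : HasTrivialSpectrum S) (hx : x ≠ 0)
    (hβ : ∀ w, e (β w) = 0 ↔ w ∈ orbit S x) : e (β x) ≠ 0 :=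
  fun h => hS.notMem_orbit hx ((hβ x).1 h)

variable [FiniteDimensional F D] [FiniteDimensional Dᵐᵒᵖ V]

theorem finrank_submodule_le (K : Submodule Dᵐᵒᵖ V) : finrank F K ≤ finrank F V := by
  have := finite_of_tower F D V
  exact Submodule.finrank_le (K.restrictScalars F)

omit [Module F V] [IsScalarTower F Dᵐᵒᵖ V] [FiniteDimensional F D]
  [FiniteDimensional Dᵐᵒᵖ V] in
theorem ne_zero_of_apply_ne_zero (hβ : e (β x) ≠ 0) : β x ≠ 0 := by
  intro h
  rw [h, map_zero] at hβ
  exact hβ rfl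

theorem IsFull.eq_of_le (hF : (finrank F V : Cardinal) ≤ Cardinal.mk F)
    {T : Submodule F (Module.End Dᵐᵒᵖ V)} (hS : IsFull S) (hT : HasTrivialSpectrum T)
    (h : S ≤ T) : S = T := by
  have h1 := hT.finrank_le hF
  have h2 := hS.2
  exact Submodule.eq_of_le_of_finrank_le h (by omega)

/-- Suppose K is invariant and proper in ker β, and put P = K + xD. Fullness of the stabilizer puts
in S all rank-one operators k f with k ∈ K and f vanishing on P, so the resolvent lemma gives v K,
v² K ⊆ P for v ∈ S. If v k ∉ K, then v k has a nonzero component on x, and v² k ∈ P yields v x ∈ P.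
Since some v₁ ∈ S has v₁ x ∉ P, adding v₁ to v shows that no such v exists. So K is S-invariant,
hence zero. -/
theorem isIrreducible_restrictTo_stab (hF : (finrank F V : Cardinal) ≤ Cardinal.mk F)
    (hS : IsFull S) (hirr : IsIrreducible S) (he : e ≠ 0) (hx : x ≠ 0) (hg : IsGood S x)
    (hβ : ∀ w, e (β w) = 0 ↔ w ∈ orbit S x) :
    IsIrreducible (restrictTo (stab S x) (LinearMap.ker β)) := by
  intro K' hK'
  by_cases htop : K' = ⊤
  · exact Or.inr htop
  refine Or.inl ?_
  have hβx := ne_zero_of_apply_ne_zero (apply_self_ne_zero_of_orbit hS.1 hx hβ)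
  have hT := hS.restrictTo_stab hg hβx
    (fun u hu y => apply_mem_ker_of_mem_stab hF hS.1 hg he hβ hu y)
  have hFH := (Nat.cast_le.2 (finrank_submodule_le (F := F) (LinearMap.ker β))).trans hF
  set K : Submodule Dᵐᵒᵖ V := K'.map (LinearMap.ker β).subtype with hKdef
  have hKβ : ∀ k ∈ K, β k = 0 := by
    rintro _ ⟨k, -, rfl⟩
    exact k.2
  have hmem : ∀ k ∈ K, ∀ f : V →ₗ[Dᵐᵒᵖ] D, f x = 0 → (∀ z ∈ K, f z = 0) → rankOne k f ∈ S := by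
    rintro _ ⟨k, hk, rfl⟩ f hfx hfK
    obtain ⟨u, hu, hut⟩ := hT.rankOne_mem hFH hK' hk
      (f := f ∘ₗ (LinearMap.ker β).subtype) (fun z hz => hfK _ ⟨z, hz, rfl⟩)
    have : u = rankOne (k : V) f := by
      apply end_ext_of_ker hβx
      · rw [rankOne_apply, hfx, op_zero, zero_smul]
        exact hu.2
      · intro y hy
        exact hut ⟨y, hy⟩
    change rankOne (k : V) f ∈ S
    rw [← this]
    exact hu.1
  set P : Submodule Dᵐᵒᵖ V := K ⊔ Submodule.span Dᵐᵒᵖ {x} with hP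
  have hxP : x ∈ P := Submodule.mem_sup_right (Submodule.mem_span_singleton_self x)
  have hKP : K ≤ P := le_sup_left
  have hvP : ∀ v ∈ S, ∀ k ∈ K, v k ∈ P ∧ v (v k) ∈ P := by
    intro v hv k hk
    have key : ∀ f : V →ₗ[Dᵐᵒᵖ] D, (∀ z ∈ P, f z = 0) → f (v k) = 0 ∧ f (v (v k)) = 0 :=
      fun f hf => (hS.1.apply_eq_zero_of_rankOne_mem hF
        (fun k' hk' => hmem k' hk' f (hf x hxP) fun z hz => hf z (hKP hz)) hv hk).2
    constructor
    · by_contra h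
      obtain ⟨f, hf1, hf⟩ := exists_form_of_notMem h
      exact one_ne_zero (hf1.symm.trans (key f hf).1)
    · by_contra h
      obtain ⟨f, hf1, hf⟩ := exists_form_of_notMem h
      exact one_ne_zero (hf1.symm.trans (key f hf).2)
  have hPmem : ∀ z ∈ P, ∃ k ∈ K, ∃ a : Dᵐᵒᵖ, k + a • x = z := by
    intro z hz
    obtain ⟨k, hk, y, hy, rfl⟩ := Submodule.mem_sup.1 hz
    obtain ⟨a, rfl⟩ := Submodule.mem_span_singleton.1 hy
    exact ⟨k, hk, a, rfl⟩
  have hor : ∀ v ∈ S, ∀ k ∈ K, v k ∉ K → v x ∈ P := by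
    intro v hv k hk hvk
    obtain ⟨k', hk', a, hka⟩ := hPmem _ (hvP v hv k hk).1
    have ha : a ≠ 0 := by
      rintro rfl
      rw [zero_smul, add_zero] at hka
      exact hvk (hka ▸ hk')
    have h1 := (hvP v hv k hk).2
    rw [← hka, map_add, map_smul] at h1
    have h2 := (Submodule.add_mem_iff_right _ (hvP v hv k' hk').1).1 h1
    have h3 := P.smul_mem a⁻¹ h2
    rwa [smul_smul, inv_mul_cancel₀ ha, one_smul] at h3
  -- Otherwise Sx ⊆ P; as Sx contains ker β, this would give ker β ⊆ P ∩ ker β = K.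
  obtain ⟨v₁, hv₁, hv₁x⟩ : ∃ v ∈ S, v x ∉ P := by
    by_contra! h
    apply htop
    rw [eq_top_iff]
    rintro ⟨y, hy⟩ -
    obtain ⟨v, hv, hvy⟩ := (hβ y).1 (by rw [LinearMap.mem_ker.1 hy, map_zero])
    have h1 := h v hv
    have hvy' : v x = y := hvy
    rw [hvy'] at h1
    obtain ⟨k, hk, a, hka⟩ := hPmem y h1
    have h2 : β y = 0 := hy
    rw [← hka, map_add, hKβ k hk, zero_add, map_smul, ← op_unop a, op_smul_eq_mul, mul_eq_zero,
      unop_eq_zero_iff] at h2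
    rw [h2.resolve_left hβx, zero_smul, add_zero] at hka
    obtain ⟨z, hz, hzk⟩ := hk
    have : z = ⟨y, hy⟩ := Subtype.ext (hzk.trans hka)
    rwa [← this]
  have hKinv : ∀ v ∈ S, ∀ k ∈ K, v k ∈ K := by
    intro v hv k hk
    by_contra hvk
    have h1 : v₁ k ∈ K := by
      by_contra h
      exact hv₁x (hor v₁ hv₁ k hk h)
    have h2 : (v + v₁) k ∉ K := fun h => hvk ((Submodule.add_mem_iff_left K h1).1 h)
    have h3 := hor _ (add_mem hv hv₁) k hk h2
    exact hv₁x ((Submodule.add_mem_iff_right P (hor v hv k hk hvk)).1 h3)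
  rcases hirr K hKinv with h | h
  · exact Submodule.map_injective_of_injective (Submodule.subtype_injective _)
      (h.trans (Submodule.map_bot _).symm)
  · exact absurd (hKβ x (by rw [h]; trivial)) hβx

/-- The form on the hyperplane `ker β` that defines `S^x` governs the values `β (v y)`. -/
theorem exists_apply_eq_mul (hF : (finrank F V : Cardinal) ≤ Cardinal.mk F)
    (hS : HasTrivialSpectrum S) (hp : IsQuadraticPair σ e) (hg : IsGood S x)
    (hβ : ∀ w, e (β w) = 0 ↔ w ∈ orbit S x) {B : SesquilinearForm σ (LinearMap.ker β)}
    (hB : IsNonisotropic e B)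
    (hT : restrictTo (stab S x) (LinearMap.ker β) = altSpace D (formComp e B)) :
    ∃ c : F, ∀ v ∈ S, ∀ y w : LinearMap.ker β, v x = w → e (β (v y)) = c * e (B y w) := by
  let A := (LinearMap.applyₗ' F x : Module.End Dᵐᵒᵖ V →ₗ[F] V).domRestrict S
  have hA : LinearMap.range A = orbit S x := LinearMap.range_domRestrict _ _
  obtain ⟨g, hgr⟩ := A.rangeRestrict.exists_rightInverse_of_surjective A.range_rangeRestrict
  let ι : LinearMap.ker β →ₗ[F] LinearMap.range A :=
    LinearMap.codRestrict _ ((LinearMap.ker β).subtype.restrictScalars F) fun w => by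
      rw [hA, ← hβ]
      change e (β w) = 0
      rw [LinearMap.mem_ker.1 w.2, map_zero]
  -- A linear choice of v ∈ S with v x = w; another choice differs by an element of the stabilizer,
  -- which does not affect β(v y).
  let s : LinearMap.ker β →ₗ[F] S := g ∘ₗ ι
  have hs : ∀ w, (s w).1 x = w := fun w =>
    congrArg Subtype.val (LinearMap.congr_fun hgr (ι w))
  let G : LinearMap.ker β →ₗ[F] LinearMap.ker β →ₗ[F] F :=
    LinearMap.mk₂ F (fun y w => e (β ((s w).1 y)))
      (fun y y' w => by simp) (fun c y w => by simp [LinearMap.map_smul_of_tower])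
      (fun y w w' => by simp) (fun c y w => by simp [LinearMap.map_smul_of_tower])
  have hG : ∀ y w, G y w = e (β ((s w).1 y)) := fun y w => rfl
  have hinj : Function.Injective (formComp e B) := by
    rw [injective_iff_map_eq_zero]
    intro y hy
    by_contra hy0
    exact hB y hy0 (LinearMap.congr_fun hy y)
  obtain ⟨c, hc⟩ := exists_smul_eq_of_forall_exists G (formComp e B) hinj (by
    intro y
    by_cases hy : y = 0
    · exact ⟨0, by rw [hy, map_zero, map_zero, smul_zero]⟩
    apply exists_smul_eq_of_ker_le
    intro w hw
    -- If e(B(y, w)) = 0, then w = u y with u in the stabilizer, and v x = u y puts v y in Sx =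
    -- ker(e ∘ β).
    obtain ⟨t, ht, hty⟩ := (mem_orbit_altSpace hp hB hy).2 hw
    rw [← hT] at ht
    obtain ⟨u, hu, hut⟩ := ht
    rw [hG, hβ]
    refine apply_mem_orbit_of_apply_eq hF (hg.max hS) hg.lt hu (s w).2 ?_
    rw [hs, hut]
    exact congrArg Subtype.val hty.symm)
  refine ⟨c, fun v hv y w hvw => ?_⟩
  have h1 : v - (s w).1 ∈ stab S x := by
    refine ⟨sub_mem hv (s w).2, ?_⟩
    change v x - (s w).1 x = 0
    rw [hs, hvw, sub_self]
  have h2 := apply_mem_ker_of_mem_stab hF hS hg hp.ne_zero hβ h1 y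
  rw [LinearMap.sub_apply, map_sub, sub_eq_zero] at h2
  rw [h2, ← hG, hc]
  rfl

/-- If c = 0, the v ∈ S with v x ∈ ker β preserve ker β, and by fullness restrict to nothing more
than the stabilizer does. Subtracting stabilizer elements puts in S all operators h β(x)⁻¹β with h ∈
ker β; the resolvent lemma then makes ker β invariant, against irreducibility. -/
theorem ne_zero_of_apply_eq_mul (hF : (finrank F V : Cardinal) ≤ Cardinal.mk F)
    (hS : IsFull S) (hirr : IsIrreducible S) (he : e ≠ 0) (hx : x ≠ 0) (hg : IsGood S x)
    (hβ : ∀ w, e (β w) = 0 ↔ w ∈ orbit S x) {B : SesquilinearForm σ (LinearMap.ker β)} {c : F}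
    (hc : ∀ v ∈ S, ∀ y w : LinearMap.ker β, v x = w → e (β (v y)) = c * e (B y w))
    (hker : LinearMap.ker β ≠ ⊥) : c ≠ 0 := by
  rintro rfl
  have hβx := ne_zero_of_apply_ne_zero (apply_self_ne_zero_of_orbit hS.1 hx hβ)
  have hT := hS.restrictTo_stab hg hβx
    (fun u hu y => apply_mem_ker_of_mem_stab hF hS.1 hg he hβ hu y)
  have hFH := (Nat.cast_le.2 (finrank_submodule_le (F := F) (LinearMap.ker β))).trans hF
  have hstable : ∀ v ∈ S, β (v x) = 0 → ∀ y, β y = 0 → β (v y) = 0 := by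
    intro v hv hvx y hy
    apply eq_zero_of_forall_apply_mul he
    intro a
    have := hc v hv (op a • ⟨y, hy⟩) ⟨v x, hvx⟩ rfl
    rw [zero_mul] at this
    rw [← op_smul_eq_mul, ← map_smul, ← map_smul]
    exact this
  let S' : Submodule F (Module.End Dᵐᵒᵖ V) :=
    { carrier := {v | v ∈ S ∧ β (v x) = 0}
      add_mem' := fun hu hv => ⟨add_mem hu.1 hv.1, by simp [hu.2, hv.2]⟩
      zero_mem' := ⟨zero_mem _, by simp⟩
      smul_mem' := fun c v hv => ⟨S.smul_mem c hv.1, by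
        simp [LinearMap.map_smul_of_tower, hv.2]⟩ }
  have hle : restrictTo (stab S x) (LinearMap.ker β) ≤ restrictTo S' (LinearMap.ker β) := by
    rintro t ⟨u, hu, hut⟩
    have hux : u x = 0 := hu.2
    exact ⟨u, ⟨hu.1, by rw [hux, map_zero]⟩, hut⟩
  have hS' : HasTrivialSpectrum (restrictTo S' (LinearMap.ker β)) :=
    (hS.1.mono (fun v (hv : v ∈ S') => hv.1) : HasTrivialSpectrum S').restrict _
  have heq : restrictTo (stab S x) (LinearMap.ker β) = restrictTo S' (LinearMap.ker β) :=
    hT.eq_of_le hFH hS' hle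
  have hrank : ∀ h ∈ LinearMap.ker β, rankOne h ((β x)⁻¹ • β) ∈ S := by
    intro h hh
    obtain ⟨v, hv, hvx⟩ := (hβ h).1 (by rw [LinearMap.mem_ker.1 hh, map_zero])
    have hvx' : v x = h := hvx
    have hvS' : v ∈ S' := ⟨hv, by rw [hvx']; exact hh⟩
    have h1 : v.restrict (hstable v hv hvS'.2) ∈ restrictTo S' (LinearMap.ker β) :=
      ⟨v, hvS', fun y => rfl⟩
    rw [← heq] at h1
    obtain ⟨u, hu, hut⟩ := h1
    have hux : u x = 0 := hu.2
    have : v - u = rankOne h ((β x)⁻¹ • β) := by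
      apply end_ext_of_ker hβx
      · rw [LinearMap.sub_apply, hvx', hux, sub_zero, rankOne_apply, LinearMap.smul_apply,
          smul_eq_mul, inv_mul_cancel₀ hβx, op_one, one_smul]
      · intro y hy
        have h2 : u y = v y := hut ⟨y, hy⟩
        rw [LinearMap.sub_apply, h2, sub_self, rankOne_apply, LinearMap.smul_apply,
          LinearMap.mem_ker.1 hy, smul_zero, op_zero, zero_smul]
    rw [← this]
    exact sub_mem hv hu.1
  rcases hirr (LinearMap.ker β) (fun v hv h hh => by
    have h1 := (hS.1.apply_eq_zero_of_rankOne_mem hF hrank hv hh).2.1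
    rw [LinearMap.smul_apply, smul_eq_mul, mul_eq_zero] at h1
    exact h1.resolve_left (inv_ne_zero hβx)) with h | h
  · exact hker h
  · exact hβx (LinearMap.mem_ker.1 (by rw [h]; trivial))

/-- On the proper subspaces of `V`, all the irreducible full spaces of operators are spaces of
alternating operators. -/
def StandardBelow (V : Type*) [AddCommGroup V] [Module Dᵐᵒᵖ V] [Module F V]
    [IsScalarTower F Dᵐᵒᵖ V] (σ : Dᵐᵒᵖ ≃ₐ[F] D) (e : D →ₗ[F] F) : Prop :=
  ∀ H : Submodule Dᵐᵒᵖ V, H ≠ ⊤ → ∀ T : Submodule F (Module.End Dᵐᵒᵖ H), IsFull T →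
    IsIrreducible T → ∃ B : SesquilinearForm σ H, IsNonisotropic e B ∧
      T = altSpace D (formComp e B)

/-- Write y = h + x a with h ∈ ker β nonzero. Stabilizer elements see only h, so their orbit at y is
a hyperplane of ker β. Choosing v x = w with B(h, w) prescribed realizes every value of β(v y).
Together these give dim Sy ≥ (n − 1)d − 1 + d = nd − 1. -/
theorem orbit_of_isGood (hF : (finrank F V : Cardinal) ≤ Cardinal.mk F)
    (hS : IsFull S) (hirr : IsIrreducible S) (hp : IsQuadraticPair σ e)
    (hV : StandardBelow V σ e) (hx : x ≠ 0) (hg : IsGood S x)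
    (hβ : ∀ w, e (β w) = 0 ↔ w ∈ orbit S x) {y : V} (hy : ∀ a : Dᵐᵒᵖ, y ≠ a • x) :
    finrank F (orbit (stab S x) y) + 1 + finrank F D = finrank F V ∧ IsGood S y ∧
      ∀ t : D, ∃ v ∈ S, β (v x) = 0 ∧ β (v y) = t := by
  have := finite_of_tower F D V
  have hβx := ne_zero_of_apply_ne_zero (apply_self_ne_zero_of_orbit hS.1 hx hβ)
  have hTfull := hS.restrictTo_stab hg hβx
    (fun u hu y => apply_mem_ker_of_mem_stab hF hS.1 hg hp.ne_zero hβ hu y)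
  have hTirr := isIrreducible_restrictTo_stab hF hS hirr hp.ne_zero hx hg hβ
  obtain ⟨B, hB, hT⟩ := hV (LinearMap.ker β)
    (fun h => hβx (LinearMap.mem_ker.1 (by rw [h]; trivial))) _ hTfull hTirr
  obtain ⟨c, hc⟩ := exists_apply_eq_mul hF hS.1 hp hg hβ hB hT
  set a : Dᵐᵒᵖ := op ((β x)⁻¹ * β y) with ha
  let h : LinearMap.ker β := ⟨y - a • x, sub_smul_mem_ker hβx y⟩
  have hh0 : h ≠ 0 := fun h0 => hy a (sub_eq_zero.1 (congrArg Subtype.val h0))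
  have hyh : y = h + a • x := (sub_add_cancel y (a • x)).symm
  have hc0 : c ≠ 0 := ne_zero_of_apply_eq_mul hF hS hirr hp.ne_zero hx hg hβ hc
    (fun hk => hh0 (Subtype.ext ((Submodule.mem_bot Dᵐᵒᵖ).1 (hk ▸ h.2))))
  have hsurj : ∀ t : D, ∃ v ∈ S, β (v x) = 0 ∧ β (v y) = t := by
    intro t
    -- Chosen so that c e(σ(b) r) = e(t b) for all b, by invariance of e under σ.
    set r : D := c⁻¹ • σ (op t) with hr
    set w : LinearMap.ker β := op ((B h h)⁻¹ * r) • h with hw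
    have hBw : B h w = r := by
      rw [hw, sesq_smul_right', unop_op, mul_inv_cancel_left₀ (hB.apply_self_ne_zero hh0)]
    obtain ⟨v, hv, hvx⟩ := (hβ w).1 (by rw [LinearMap.mem_ker.1 w.2, map_zero])
    have hvx' : v x = w := hvx
    have hvβ : β (v x) = 0 := by rw [hvx']; exact w.2
    refine ⟨v, hv, hvβ, ?_⟩
    rw [hyh, map_add, map_add, map_smul, map_smul, hvβ, smul_zero, add_zero, ← sub_eq_zero]
    apply eq_zero_of_forall_apply_mul hp.ne_zero
    intro b
    have h1 := hc v hv (op b • h) w hvx'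
    have h2 : e (σ (op b) * r) = e (σ (op r) * b) := by
      rw [← hp.apply_conj, conj_mul, hp.invol]
    rw [sesq_smul_left', hBw, h2, hr, conj_smul, hp.invol, smul_mul_assoc, map_smul, smul_eq_mul,
      mul_inv_cancel_left₀ hc0] at h1
    rw [sub_mul, map_sub, sub_eq_zero, ← h1, ← op_smul_eq_mul, ← map_smul, ← map_smul]
    rfl
  have horb : orbit (stab S x) y =
      (orbit (restrictTo (stab S x) (LinearMap.ker β)) h).map
        ((LinearMap.ker β).subtype.restrictScalars F) := by
    have huy : ∀ u ∈ stab S x, u y = u h := by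
      intro u hu
      have hux : u x = 0 := hu.2
      rw [hyh, map_add, map_smul, hux, smul_zero, add_zero]
    ext w
    constructor
    · rintro ⟨u, hu, huw⟩
      have huw' : u y = w := huw
      have hur : ∀ z ∈ LinearMap.ker β, u z ∈ LinearMap.ker β := fun z _ =>
        apply_mem_ker_of_mem_stab hF hS.1 hg hp.ne_zero hβ hu z
      refine ⟨u.restrict hur h, ⟨u.restrict hur, ⟨u, hu, fun z => rfl⟩, rfl⟩, ?_⟩
      rw [← huw', huy u hu]
      rfl
    · rintro ⟨_, ⟨t, ⟨u, hu, hut⟩, rfl⟩, rfl⟩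
      refine ⟨u, hu, ?_⟩
      change u y = t h
      rw [huy u hu, hut]
  have hdim : finrank F (orbit (stab S x) y) + 1 + finrank F D = finrank F V := by
    have h1 := isGood_altSpace hp hB hh0
    unfold IsGood at h1
    rw [horb, ← (Submodule.equivMapOfInjective ((LinearMap.ker β).subtype.restrictScalars F)
      (Submodule.subtype_injective (LinearMap.ker β)) _).finrank_eq, hT, h1,
      finrank_of_tower F D V, ← finrank_ker_add_one (β := β) (fun h0 => hβx (by rw [h0]; rfl)),
      finrank_of_tower F D (LinearMap.ker β)]
    ring
  refine ⟨hdim, ?_, hsurj⟩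
  have hy0 : y ≠ 0 := fun h0 => hy 0 (by rw [h0, zero_smul])
  have hlt := hS.1.finrank_orbit_lt hy0
  let γ : orbit S y →ₗ[F] D := (β.restrictScalars F).domRestrict (orbit S y)
  have hγ : LinearMap.range γ = ⊤ := by
    rw [LinearMap.range_eq_top]
    intro t
    obtain ⟨v, hv, -, hvt⟩ := hsurj t
    exact ⟨⟨v y, apply_mem_orbit hv y⟩, hvt⟩
  have h1 := γ.finrank_range_add_finrank_ker
  rw [hγ, finrank_top] at h1
  have h2 : orbit (stab S x) y ≤ (LinearMap.ker γ).map (orbit S y).subtype := by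
    rintro _ ⟨u, hu, rfl⟩
    exact ⟨⟨u y, apply_mem_orbit hu.1 y⟩,
      apply_mem_ker_of_mem_stab hF hS.1 hg hp.ne_zero hβ hu y, rfl⟩
  have h3 := Submodule.finrank_mono h2
  rw [Submodule.finrank_map_subtype_eq] at h3
  unfold IsGood
  omega

/-- A good vector makes every vector outside its D-line good; a multiple of it is reached through a
vector outside the line. When n = 1 the stabilizer is zero and the count is immediate. -/
theorem isGood_of_ne_zero [Nontrivial V] (hF : (finrank F V : Cardinal) ≤ Cardinal.mk F)
    (hS : IsFull S) (hirr : IsIrreducible S) (hp : IsQuadraticPair σ e)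
    (hV : StandardBelow V σ e) {y : V} (hy : y ≠ 0) : IsGood S y := by
  have key : ∀ x : V, x ≠ 0 → IsGood S x → ∀ y : V, (∀ a : Dᵐᵒᵖ, y ≠ a • x) → IsGood S y := by
    intro x hx hg y hy
    obtain ⟨β, hβ⟩ := exists_form_orbit hg hp.ne_zero
    exact (orbit_of_isGood hF hS hirr hp hV hx hg hβ hy).2.1
  obtain ⟨x, hx, hg⟩ := exists_isGood hF hS
  by_cases hyx : ∀ a : Dᵐᵒᵖ, y ≠ a • x
  · exact key x hx hg y hyx
  push Not at hyx
  obtain ⟨a, ha⟩ := hyx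
  by_cases hall : ∃ z : V, ∀ b : Dᵐᵒᵖ, z ≠ b • x
  · obtain ⟨z, hz⟩ := hall
    refine key z (fun h0 => hz 0 (by rw [h0, zero_smul])) (key x hx hg z hz) y fun b hb => ?_
    have hb0 : b ≠ 0 := by
      rintro rfl
      rw [zero_smul] at hb
      exact hy hb
    apply hz (b⁻¹ * a)
    rw [mul_smul, ← ha, hb, smul_smul, inv_mul_cancel₀ hb0, one_smul]
  · push Not at hall
    have h1 : finrank Dᵐᵒᵖ V = 1 :=
      finrank_eq_one x hx fun w => (hall w).imp fun b hb => hb.symm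
    have ha0 : a ≠ 0 := by
      rintro rfl
      rw [zero_smul] at ha
      exact hy ha
    have h2 : stab S y = ⊥ := by
      rw [eq_bot_iff]
      rintro u ⟨-, hu⟩
      have huy : u y = 0 := hu
      have hux : u x = 0 := by
        rw [ha, map_smul, smul_eq_zero] at huy
        exact huy.resolve_left ha0
      rw [Submodule.mem_bot]
      ext z
      obtain ⟨b, rfl⟩ := hall z
      rw [map_smul, hux, smul_zero, LinearMap.zero_apply]
    have h3 := finrank_eq_orbit_add_stab S y
    have h4 := hS.2
    rw [h2, finrank_bot, add_zero] at h3
    rw [h1] at h4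
    unfold IsGood
    rw [finrank_of_tower F D V, h1]
    omega

omit [FiniteDimensional F D] [FiniteDimensional Dᵐᵒᵖ V] in
theorem mem_orbit_smul {a : Dᵐᵒᵖ} (ha : a ≠ 0) {w : V} :
    w ∈ orbit S (a • x) ↔ a⁻¹ • w ∈ orbit S x := by
  constructor
  · rintro ⟨u, hu, rfl⟩
    refine ⟨u, hu, ?_⟩
    change u x = a⁻¹ • u (a • x)
    rw [map_smul, smul_smul, inv_mul_cancel₀ ha, one_smul]
  · rintro ⟨u, hu, huw⟩
    have huw' : u x = a⁻¹ • w := huw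
    refine ⟨u, hu, ?_⟩
    change u (a • x) = w
    rw [map_smul, huw', smul_smul, mul_inv_cancel₀ ha, one_smul]

-- The orbit of x a is (Sx) a, and a⁻¹ is a scalar multiple of σ(a). In this form the condition is
-- additive in a.
omit [FiniteDimensional F D] [FiniteDimensional Dᵐᵒᵖ V] in
theorem mem_orbit_smul_iff (hp : IsQuadraticPair σ e) (hβ : ∀ w, e (β w) = 0 ↔ w ∈ orbit S x)
    {a : Dᵐᵒᵖ} (ha : a ≠ 0) {w : V} : w ∈ orbit S (a • x) ↔ e (β w * σ a) = 0 := by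
  obtain ⟨q, hq, hqa⟩ := hp.exists_inv_eq (x := unop a) ((unop_ne_zero_iff a).2 ha)
  rw [op_unop] at hqa
  rw [mem_orbit_smul ha, ← hβ, map_smul, ← op_unop a⁻¹, op_smul_eq_mul, unop_inv, hqa,
    mul_smul_comm, map_smul, smul_eq_zero, or_iff_right hq]

/-- Let P and Q be the orbits of y and x under the stabilizers of x and y. Both lie in Sx ∩ Sy and
in S(x+y). Each has dimension (n − 1)d − 1, and P ∩ Q lies in ker β ∩ ker γ, of dimension (n − 2)d,
so dim(P + Q) ≥ nd − 2 ≥ dim(Sx ∩ Sy). -/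
theorem orbit_inf_orbit_le (hF : (finrank F V : Cardinal) ≤ Cardinal.mk F)
    (hS : IsFull S) (hirr : IsIrreducible S) (hp : IsQuadraticPair σ e)
    (hV : StandardBelow V σ e) {y : V} (hx : x ≠ 0) (hgx : IsGood S x) (hgy : IsGood S y)
    (hy : ∀ a : Dᵐᵒᵖ, y ≠ a • x) : orbit S x ⊓ orbit S y ≤ orbit S (x + y) := by
  have := finite_of_tower F D V
  have hy0 : y ≠ 0 := fun h0 => hy 0 (by rw [h0, zero_smul])
  have hyx : ∀ a : Dᵐᵒᵖ, x ≠ a • y := by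
    intro a ha
    have ha0 : a ≠ 0 := by
      rintro rfl
      rw [zero_smul] at ha
      exact hx ha
    apply hy a⁻¹
    rw [ha, smul_smul, inv_mul_cancel₀ ha0, one_smul]
  obtain ⟨β, hβ⟩ := exists_form_orbit hgx hp.ne_zero
  obtain ⟨γ, hγ⟩ := exists_form_orbit hgy hp.ne_zero
  have hβx := ne_zero_of_apply_ne_zero (apply_self_ne_zero_of_orbit hS.1 hx hβ)
  have hγy := ne_zero_of_apply_ne_zero (apply_self_ne_zero_of_orbit hS.1 hy0 hγ)
  obtain ⟨h1, -, h2⟩ := orbit_of_isGood hF hS hirr hp hV hx hgx hβ hy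
  obtain ⟨h3, -, -⟩ := orbit_of_isGood hF hS hirr hp hV hy0 hgy hγ hyx
  -- Otherwise γ would be a left multiple of β; since β(v y) takes all values while e(γ(v y)) = 0,
  -- the factor would vanish.
  have hne : γ ∘ₗ (LinearMap.ker β).subtype ≠ 0 := by
    intro h0
    have hγβ : ∀ z, γ z = γ x * (β x)⁻¹ * β z := by
      intro z
      have h4 : γ (z - op ((β x)⁻¹ * β z) • x) = 0 :=
        LinearMap.congr_fun h0 ⟨_, sub_smul_mem_ker hβx z⟩
      rw [map_sub, map_smul, op_smul_eq_mul, sub_eq_zero] at h4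
      rw [h4, mul_assoc]
    have h5 : γ x * (β x)⁻¹ = 0 := by
      apply eq_zero_of_forall_apply_mul hp.ne_zero
      intro t
      obtain ⟨v, hv, -, hvt⟩ := h2 t
      rw [← hvt, ← hγβ, hγ]
      exact apply_mem_orbit hv y
    apply hγy
    rw [hγβ, h5, zero_mul]
  have h4 := finrank_ker_add_one hne
  have h5 := finrank_ker_add_one (β := β) (fun h0 => hβx (by rw [h0]; rfl))
  set P := orbit (stab S x) y
  set Q := orbit (stab S y) x
  have hPQ : finrank F ((P ⊓ Q : Submodule F V)) ≤
      finrank F (LinearMap.ker (γ ∘ₗ (LinearMap.ker β).subtype)) := by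
    have hle : P ⊓ Q ≤ (((LinearMap.ker (γ ∘ₗ (LinearMap.ker β).subtype)).map
        (LinearMap.ker β).subtype).restrictScalars F) := by
      rintro w ⟨⟨u, hu, huw⟩, ⟨v, hv, hvw⟩⟩
      have huw' : u y = w := huw
      have hvw' : v x = w := hvw
      refine ⟨⟨w, ?_⟩, ?_, rfl⟩
      · rw [LinearMap.mem_ker, ← huw']
        exact apply_mem_ker_of_mem_stab hF hS.1 hgx hp.ne_zero hβ hu y
      · change γ w = 0
        rw [← hvw']
        exact apply_mem_ker_of_mem_stab hF hS.1 hgy hp.ne_zero hγ hv x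
    refine (Submodule.finrank_mono hle).trans (le_of_eq ?_)
    exact ((Submodule.equivMapOfInjective (LinearMap.ker β).subtype
      (Submodule.subtype_injective _) (LinearMap.ker (γ ∘ₗ (LinearMap.ker β).subtype))).restrictScalars
        F).finrank_eq.symm
  have hle : P ⊔ Q ≤ orbit S x ⊓ orbit S y := by
    refine sup_le ?_ ?_
    · rintro _ ⟨u, hu, rfl⟩
      exact ⟨apply_mem_orbit_of_mem_stab hF (hgx.max hS.1) hgx.lt hu y, apply_mem_orbit hu.1 y⟩
    · rintro _ ⟨u, hu, rfl⟩
      exact ⟨apply_mem_orbit hu.1 x, apply_mem_orbit_of_mem_stab hF (hgy.max hS.1) hgy.lt hu x⟩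
  have hlt : orbit S x ⊓ orbit S y < orbit S y := by
    refine lt_of_le_of_ne inf_le_right fun h0 => ?_
    obtain ⟨t, ht⟩ := exists_apply_ne_zero hp.ne_zero
    obtain ⟨v, hv, -, hvt⟩ := h2 t
    apply ht
    rw [← hvt, hβ]
    have h6 : v y ∈ orbit S x ⊓ orbit S y := by
      rw [h0]
      exact apply_mem_orbit hv y
    exact h6.1
  have h6 := Submodule.finrank_lt_finrank_of_lt hlt
  have h7 := Submodule.finrank_sup_add_finrank_inf_eq P Q
  have h8 := finrank_of_tower F D V
  have h9 := finrank_of_tower F D (LinearMap.ker (γ ∘ₗ (LinearMap.ker β).subtype))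
  rw [← h5, ← h4] at h8
  unfold IsGood at hgy
  have heq := Submodule.eq_of_le_of_finrank_le hle (by
    rw [h9] at hPQ
    nlinarith)
  rw [← heq]
  refine sup_le ?_ ?_
  · rintro _ ⟨u, hu, rfl⟩
    refine ⟨u, hu.1, ?_⟩
    have hux : u x = 0 := hu.2
    change u (x + y) = u y
    rw [map_add, hux, zero_add]
  · rintro _ ⟨u, hu, rfl⟩
    refine ⟨u, hu.1, ?_⟩
    have huy : u y = 0 := hu.2
    change u (x + y) = u x
    rw [map_add, huy, add_zero]

end Irreducible

/-! ### From the orbits to a sesquilinear form. -/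

section StandardBelow

variable {F D V : Type*} [Field F] [DivisionRing D] [Algebra F D]
  [AddCommGroup V] [Module Dᵐᵒᵖ V] [Module F V] [IsScalarTower F Dᵐᵒᵖ V]
  {S : Submodule F (Module.End Dᵐᵒᵖ V)} {x : V}
  {σ : Dᵐᵒᵖ ≃ₐ[F] D} {e : D →ₗ[F] F}

omit [Module F V] [IsScalarTower F Dᵐᵒᵖ V] in
theorem form_ext (he : e ≠ 0) {β γ : V →ₗ[Dᵐᵒᵖ] D} (h : ∀ y, e (β y) = e (γ y)) : β = γ := by
  refine LinearMap.ext fun y => ?_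
  rw [← sub_eq_zero]
  apply eq_zero_of_forall_apply_mul he
  intro a
  rw [← op_smul_eq_mul, smul_sub, ← map_smul, ← map_smul, map_sub, h, sub_self]

theorem smul_eq_smul_of_unop_eq {a : Dᵐᵒᵖ} {c : F} (h : unop a = algebraMap F D c) (x : V) :
    a • x = c • x := by
  rw [← op_unop a, h, ← MulOpposite.algebraMap_apply, algebraMap_smul]

/-- If the functional `e ∘ β` vanishes on `S (x a)` as well as on `S x`, then `a` is a scalar. -/
theorem exists_scalar_of_apply_eq_zero (hp : IsQuadraticPair σ e) {β : V →ₗ[Dᵐᵒᵖ] D}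
    (hβx : β x ≠ 0) (hβ : ∀ w, e (β w) = 0 ↔ w ∈ orbit S x) {a : Dᵐᵒᵖ}
    (h : ∀ v ∈ S, e (β (v (a • x))) = 0) : ∃ c : F, a • x = c • x := by
  -- The form e(β(w) a) vanishes where e(β(w)) does; as β is onto, e(t a) = c e(t) for all t, whence
  -- a = c.
  obtain ⟨c, hc⟩ := exists_smul_eq_of_ker_le (e ∘ₗ β.restrictScalars F)
    (e ∘ₗ LinearMap.mulRight F (unop a) ∘ₗ β.restrictScalars F) (by
    intro w hw
    obtain ⟨v, hv, hvw⟩ := (hβ w).1 hw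
    have hvw' : v x = w := hvw
    have h1 := h v hv
    rw [map_smul, hvw', map_smul, ← op_unop a, op_smul_eq_mul] at h1
    exact h1)
  refine ⟨c, smul_eq_smul_of_unop_eq ?_ x⟩
  rw [← sub_eq_zero]
  apply eq_zero_of_forall_apply_mul hp.ne_zero
  intro t
  have h1 : e (β (op ((β x)⁻¹ * t) • x) * unop a) = c * e (β (op ((β x)⁻¹ * t) • x)) :=
    LinearMap.congr_fun hc (op ((β x)⁻¹ * t) • x)
  rw [map_smul, op_smul_eq_mul, mul_inv_cancel_left₀ hβx] at h1
  rw [sub_mul, map_sub, hp.mul_comm, h1, ← Algebra.smul_def, map_smul, smul_eq_mul, sub_self]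

variable [FiniteDimensional F D] [FiniteDimensional Dᵐᵒᵖ V]

/-- The rescaling lemma is applied over F to forms with kernels Sx. Its incidence conditions come
from the orbit lemmas for vectors on different D-lines, and from explicit formulas for vectors on
the same D-line. -/
theorem exists_bilin_of_standardBelow [Nontrivial V]
    (hF : (finrank F V : Cardinal) ≤ Cardinal.mk F) (hS : IsFull S) (hirr : IsIrreducible S)
    (hp : IsQuadraticPair σ e) (hV : StandardBelow V σ e) :
    ∃ Φ : V →ₗ[F] V →ₗ[F] F, ∀ x, x ≠ 0 → ∀ w, Φ x w = 0 ↔ w ∈ orbit S x := by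
  have hgood : ∀ x : V, x ≠ 0 → IsGood S x := fun x hx => isGood_of_ne_zero hF hS hirr hp hV hx
  have hex : ∀ x : V, ∃ β : V →ₗ[Dᵐᵒᵖ] D, x ≠ 0 → ∀ w, e (β w) = 0 ↔ w ∈ orbit S x := by
    intro x
    by_cases hx : x = 0
    · exact ⟨0, fun h => absurd hx h⟩
    · obtain ⟨β, hβ⟩ := exists_form_orbit (hgood x hx) hp.ne_zero
      exact ⟨β, fun _ => hβ⟩
  choose β hβ using hex
  have hβx : ∀ x, x ≠ 0 → β x x ≠ 0 := fun x hx =>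
    ne_zero_of_apply_ne_zero (apply_self_ne_zero_of_orbit hS.1 hx (hβ x hx))
  let φ : V → V →ₗ[F] F := fun x => e ∘ₗ (β x).restrictScalars F
  have hφ : ∀ x w, φ x w = e (β x w) := fun x w => rfl
  obtain ⟨Φ, hΦ, hΦ0⟩ : ∃ Φ : V →ₗ[F] V →ₗ[F] F, (∀ x, ∀ v ∈ S, Φ x (v x) = 0) ∧
      ∀ x, Φ x = 0 → x = 0 := by
    suffices h : ∃ Φ : V →ₗ[F] V →ₗ[F] F, (∀ x,
        ∀ u ∈ {u : V →ₗ[F] V | ∃ v ∈ S, v.restrictScalars F = u}, Φ x (u x) = 0) ∧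
          ∀ x, Φ x = 0 → x = 0 from
      h.imp fun Φ hΦ => ⟨fun x v hv => hΦ.1 x _ ⟨v, hv, rfl⟩, hΦ.2⟩
    refine exists_linear_family _ φ ?_ ?_ ?_ ?_
    · intro x hx h
      exact apply_self_ne_zero_of_orbit hS.1 hx (hβ x hx) (LinearMap.congr_fun h x)
    · rintro x hx _ ⟨v, hv, rfl⟩
      exact (hβ x hx _).2 (apply_mem_orbit hv x)
    · intro x y hx hy h
      by_cases hxy : ∀ a : Dᵐᵒᵖ, y ≠ a • x
      · obtain ⟨t, ht⟩ := exists_apply_ne_zero hp.ne_zero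
        obtain ⟨v, hv, -, hvt⟩ :=
          (orbit_of_isGood hF hS hirr hp hV hx (hgood x hx) (hβ x hx) hxy).2.2 t
        have h1 : e (β x (v y)) = 0 := h _ ⟨v, hv, rfl⟩
        rw [hvt] at h1
        exact absurd h1 ht
      · push Not at hxy
        obtain ⟨a, rfl⟩ := hxy
        exact exists_scalar_of_apply_eq_zero hp (hβx x hx) (hβ x hx) fun v hv => h _ ⟨v, hv, rfl⟩
    · intro x y hxy w hwx hwy
      have hx : x ≠ 0 := fun h => one_ne_zero (hxy 1 0 (by simp [h])).1
      have hy : y ≠ 0 := fun h => one_ne_zero (hxy 0 1 (by simp [h])).2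
      have hxy0 : x + y ≠ 0 := fun h => one_ne_zero (hxy 1 1 (by simpa using h)).1
      rw [hφ, hβ x hx] at hwx
      rw [hφ, hβ y hy] at hwy
      rw [hφ, hβ _ hxy0]
      by_cases hD : ∀ a : Dᵐᵒᵖ, y ≠ a • x
      · exact orbit_inf_orbit_le hF hS hirr hp hV hx (hgood x hx) (hgood y hy) hD ⟨hwx, hwy⟩
      · push Not at hD
        obtain ⟨a, rfl⟩ := hD
        have ha : a ≠ 0 := by
          rintro rfl
          exact hy (zero_smul _ _)
        have hxa : x + a • x = (1 + a) • x := by rw [add_smul, one_smul]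
        have ha1 : 1 + a ≠ 0 := by
          intro h
          rw [hxa, h, zero_smul] at hxy0
          exact hxy0 rfl
        rw [hxa, mem_orbit_smul_iff hp (hβ x hx) ha1, map_add, map_one, mul_add, mul_one, map_add,
          (hβ x hx w).2 hwx, (mem_orbit_smul_iff hp (hβ x hx) ha).1 hwy, add_zero]
  refine ⟨Φ, fun x hx w => ?_⟩
  have hw : ∀ w, w ∈ orbit S x → Φ x w = 0 := by
    rintro _ ⟨v, hv, rfl⟩
    exact hΦ x v hv
  refine ⟨fun h => ?_, hw w⟩
  obtain ⟨c, hc⟩ := exists_smul_eq_of_ker_le (φ x) (Φ x) fun w h => hw w ((hβ x hx w).1 h)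
  have hc0 : c ≠ 0 := by
    rintro rfl
    exact hx (hΦ0 x (by rw [hc, zero_smul]))
  rw [hc, LinearMap.smul_apply, smul_eq_mul, mul_eq_zero] at h
  exact (hβ x hx w).1 (h.resolve_left hc0)

/-- Represent Φ(x, ·) as e ∘ b x. Semilinearity on the left holds because Φ(x a, ·) and e(σ(a) b x
·) have the same kernel S(x a). -/
theorem exists_sesquilinearForm_of_standardBelow [Nontrivial V]
    (hF : (finrank F V : Cardinal) ≤ Cardinal.mk F) (hS : IsFull S) (hirr : IsIrreducible S)
    (hp : IsQuadraticPair σ e) (hV : StandardBelow V σ e) :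
    ∃ B : SesquilinearForm σ V, IsNonisotropic e B ∧ S = altSpace D (formComp e B) := by
  obtain ⟨Φ, hΦ⟩ := exists_bilin_of_standardBelow hF hS hirr hp hV
  choose b hb using fun x => exists_form_eq hp.ne_zero (Φ x) (D := D)
  have hself : ∀ x, x ≠ 0 → Φ x x ≠ 0 := fun x hx h => hS.1.notMem_orbit hx ((hΦ x hx x).1 h)
  have hsmul : ∀ (a : Dᵐᵒᵖ) (x y : V), b (a • x) y = σ a * b x y := by
    intro a x y
    by_cases hx : x = 0
    · have hb0 : b 0 = 0 := form_ext hp.ne_zero fun z => by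
        rw [hb, map_zero, LinearMap.zero_apply, LinearMap.zero_apply, map_zero]
      rw [hx, smul_zero, hb0, LinearMap.zero_apply, mul_zero]
    have hbx : b x x ≠ 0 := ne_zero_of_apply_ne_zero (e := e) (by rw [hb]; exact hself x hx)
    let g : Dᵐᵒᵖ →ₗ[F] V →ₗ[F] F := LinearMap.mk₂ F (fun a y => e (σ a * b x y))
      (fun a a' y => by rw [map_add, add_mul, map_add])
      (fun c a y => by rw [map_smul, smul_mul_assoc, map_smul])
      (fun a y y' => by rw [map_add, mul_add, map_add])
      (fun c a y => by rw [LinearMap.map_smul_of_tower, mul_smul_comm, map_smul])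
    have hg : ∀ a y, g a y = e (σ a * b x y) := fun a y => rfl
    have hinj : Function.Injective g := by
      rw [injective_iff_map_eq_zero]
      intro a ha
      have : σ a = 0 := by
        apply eq_zero_of_forall_apply_mul hp.ne_zero
        intro t
        have h1 := LinearMap.congr_fun ha (op ((b x x)⁻¹ * t) • x)
        rw [hg, map_smul, op_smul_eq_mul, mul_inv_cancel_left₀ hbx] at h1
        exact h1
      simpa using this
    obtain ⟨c, hc⟩ := exists_smul_eq_of_forall_exists
      (Φ ∘ₗ (LinearMap.toSpanSingleton Dᵐᵒᵖ V x).restrictScalars F) g hinj (by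
      intro a
      by_cases ha : a = 0
      · exact ⟨0, by rw [ha, map_zero, map_zero, smul_zero]⟩
      apply exists_smul_eq_of_ker_le
      intro w hw
      change Φ (a • x) w = 0
      rw [hΦ _ (smul_ne_zero ha hx), mem_orbit_smul_iff hp (fun w => by rw [hb, hΦ x hx]) ha,
        hp.mul_comm]
      exact hw)
    have hc' : ∀ a y, Φ (a • x) y = c * e (σ a * b x y) :=
      fun a y => LinearMap.congr_fun (hc a) y
    -- The factor does not depend on a, so a = 1 determines it.
    have hc1 : c = 1 := by
      have h1 := hc' 1 x
      rw [one_smul, map_one, one_mul, hb] at h1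
      exact (mul_eq_right₀ (hself x hx)).1 h1.symm
    have : b (a • x) = σ a • b x := form_ext hp.ne_zero fun y => by
      rw [hb, hc', hc1, one_mul, LinearMap.smul_apply, smul_eq_mul]
    rw [this, LinearMap.smul_apply, smul_eq_mul]
  have hadd : ∀ x x' y, b (x + x') y = b x y + b x' y := by
    intro x x' y
    have : b (x + x') = b x + b x' := form_ext hp.ne_zero fun y => by
      rw [hb, LinearMap.add_apply, map_add, map_add, hb, hb, LinearMap.add_apply]
    rw [this, LinearMap.add_apply]
  let B : SesquilinearForm σ V := SesquilinearForm.ofFun (fun x y => b x y) hadd hsmul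
    (fun x y y' => map_add _ _ _)
    (fun a x y => by rw [map_smul, ← op_unop a, op_smul_eq_mul, op_unop])
  have hB : ∀ x y, e (B x y) = Φ x y := hb
  have hnon : IsNonisotropic e B := fun x hx => by
    rw [hB]
    exact hself x hx
  refine ⟨B, hnon, hS.eq_of_le hF (hasTrivialSpectrum_altSpace hnon) fun u hu => ?_⟩
  refine mem_altSpace.2 fun x => ?_
  by_cases hx : x = 0
  · rw [hx, map_zero, LinearMap.zero_apply, map_zero]
  · rw [hB, hΦ x hx]
    exact apply_mem_orbit hu x

end StandardBelow

section Irreducible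

universe w

variable {F D : Type*} [Field F] [DivisionRing D] [Algebra F D] [FiniteDimensional F D]
  {σ : Dᵐᵒᵖ ≃ₐ[F] D} {e : D →ₗ[F] F}

theorem IsIrreducible.exists_sesquilinearForm {V : Type w} [AddCommGroup V] [Module Dᵐᵒᵖ V]
    [Module F V] [IsScalarTower F Dᵐᵒᵖ V] [FiniteDimensional Dᵐᵒᵖ V]
    {S : Submodule F (Module.End Dᵐᵒᵖ V)} (hirr : IsIrreducible S)
    (hF : (finrank F V : Cardinal) ≤ Cardinal.mk F) (hS : IsFull S) (hp : IsQuadraticPair σ e) :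
    ∃ B : SesquilinearForm σ V, IsNonisotropic e B ∧ S = altSpace D (formComp e B) := by
  induction hn : finrank Dᵐᵒᵖ V using Nat.strong_induction_on generalizing V with
  | _ n ih =>
    rcases subsingleton_or_nontrivial V with hV | hV
    · have hnon : IsNonisotropic e (0 : SesquilinearForm σ V) :=
        fun x hx => absurd (Subsingleton.elim x 0) hx
      exact ⟨0, hnon, hS.eq_of_le hF (hasTrivialSpectrum_altSpace hnon)
        fun u _ => mem_altSpace.2 fun x => by simp⟩
    · refine exists_sesquilinearForm_of_standardBelow hF hS hirr hp fun H hH T hT hTirr => ?_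
      exact ih _ (hn ▸ Submodule.finrank_lt hH) hTirr
        ((Nat.cast_le.2 (finrank_submodule_le (F := F) H)).trans hF) hT rfl

end Irreducible

/-! ### Comparison of flags and their quotients. -/

theorem exists_eq_of_range_eq {α : Type*} [PartialOrder α] {m n : ℕ} {f : Fin (m + 1) → α}
    {g : Fin (n + 1) → α} (hf : StrictMono f) (hg : StrictMono g) (h : Set.range f = Set.range g) :
    ∃ hmn : m = n, ∀ j, f j = g (Fin.cast (by rw [hmn]) j) := by
  have h1 : Nat.card (Set.range f) = m + 1 := by
    rw [Nat.card_range_of_injective hf.injective, Nat.card_fin]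
  have h2 : Nat.card (Set.range g) = n + 1 := by
    rw [Nat.card_range_of_injective hg.injective, Nat.card_fin]
  obtain rfl : m = n := by
    rw [h, h2] at h1
    omega
  exact ⟨rfl, fun j => congrFun ((hf.range_inj hg).1 h) j⟩

namespace SubspaceFlag

section Induced

variable {F D V : Type*} [Field F] [DivisionRing D] [Algebra F D]
  [AddCommGroup V] [Module Dᵐᵒᵖ V]

theorem nontrivial_subquotient (𝒱 : SubspaceFlag D V) (i : Fin 𝒱.length) :
    Nontrivial (𝒱.Subquotient i) := by
  obtain ⟨-, x, hx, hx'⟩ := SetLike.lt_iff_le_and_exists.1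
    (𝒱.strictMono (Fin.castSucc_lt_succ (i := i)))
  exact ⟨⟨𝒱.proj i x, 0, fun h => hx' ((𝒱.proj_eq_zero_iff hx).1 h)⟩⟩

/-- An automorphism that maps `V_i` and `V_{i+1}` onto members of another flag induces an
isomorphism between the quotients. -/
theorem exists_subquotient_equiv {𝒱 𝒱' : SubspaceFlag D V} (φ : V ≃ₗ[Dᵐᵒᵖ] V)
    {i : Fin 𝒱.length} {i' : Fin 𝒱'.length}
    (h1 : ∀ x, φ x ∈ 𝒱'.space i'.castSucc ↔ x ∈ 𝒱.space i.castSucc)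
    (h2 : ∀ x, φ x ∈ 𝒱'.space i'.succ ↔ x ∈ 𝒱.space i.succ) :
    ∃ ψ : 𝒱.Subquotient i ≃ₗ[Dᵐᵒᵖ] 𝒱'.Subquotient i',
      ∀ x ∈ 𝒱.space i.succ, ψ (𝒱.proj i x) = 𝒱'.proj i' (φ x) := by
  let f : 𝒱.Subquotient i →ₗ[Dᵐᵒᵖ] 𝒱'.Subquotient i' :=
    𝒱'.proj i' ∘ₗ φ.toLinearMap ∘ₗ 𝒱.incl i
  have hf : ∀ x ∈ 𝒱.space i.succ, f (𝒱.proj i x) = 𝒱'.proj i' (φ x) := by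
    intro x hx
    have hx' := 𝒱.incl_mem i (𝒱.proj i x)
    change 𝒱'.proj i' (φ (𝒱.incl i (𝒱.proj i x))) = _
    rw [← sub_eq_zero, ← map_sub, ← map_sub, 𝒱'.proj_eq_zero_iff ((h2 _).2 (sub_mem hx' hx)), h1,
      ← 𝒱.proj_eq_zero_iff (sub_mem hx' hx), map_sub, proj_incl_self, sub_self]
  refine ⟨LinearEquiv.ofBijective f ⟨?_, fun q' => ?_⟩, hf⟩
  · rw [injective_iff_map_eq_zero]
    intro q hq
    have h3 : 𝒱'.proj i' (φ (𝒱.incl i q)) = 0 := hq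
    rwa [𝒱'.proj_eq_zero_iff ((h2 _).2 (𝒱.incl_mem i q)), h1,
      ← 𝒱.proj_eq_zero_iff (𝒱.incl_mem i q), proj_incl_self] at h3
  · refine ⟨𝒱.proj i (φ.symm (𝒱'.incl i' q')), ?_⟩
    rw [hf _ ((h2 _).1 (by rw [φ.apply_symm_apply]; exact 𝒱'.incl_mem i' q')),
      φ.apply_symm_apply, proj_incl_self]

variable [Module F V] [IsScalarTower F Dᵐᵒᵖ V] {S : Submodule F (Module.End Dᵐᵒᵖ V)}
  {𝒱 : SubspaceFlag D V}

theorem isIrreducible_inducedSpace (h𝒱 : ∀ u ∈ S, 𝒱.IsStable u) {i : Fin 𝒱.length}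
    (h : ∀ W : Submodule Dᵐᵒᵖ V, (∀ u ∈ S, ∀ x ∈ W, u x ∈ W) → 𝒱.space i.castSucc ≤ W →
      W ≤ 𝒱.space i.succ → W = 𝒱.space i.castSucc ∨ W = 𝒱.space i.succ) :
    IsIrreducible (𝒱.inducedSpace S i) := by
  intro K hK
  have hincl : ∀ q ∈ K, 𝒱.incl i q ∈ 𝒱.space i.succ ⊓ K.comap (𝒱.proj i) := by
    intro q hq
    refine ⟨𝒱.incl_mem i q, ?_⟩
    change 𝒱.proj i (𝒱.incl i q) ∈ K
    rwa [proj_incl_self]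
  have hinv : ∀ u ∈ S, ∀ x ∈ 𝒱.space i.succ ⊓ K.comap (𝒱.proj i),
      u x ∈ 𝒱.space i.succ ⊓ K.comap (𝒱.proj i) := by
    intro u hu x hx
    refine ⟨h𝒱 u hu _ x hx.1, ?_⟩
    change 𝒱.proj i (u x) ∈ K
    rw [← induced_proj (h𝒱 u hu) hx.1]
    exact hK _ ⟨u, hu, h𝒱 u hu, rfl⟩ _ hx.2
  have hle : 𝒱.space i.castSucc ≤ 𝒱.space i.succ ⊓ K.comap (𝒱.proj i) := by
    intro x hx
    refine ⟨𝒱.castSucc_le_succ i hx, ?_⟩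
    change 𝒱.proj i x ∈ K
    rw [𝒱.proj_eq_zero le_rfl hx]
    exact zero_mem _
  rcases h _ hinv hle inf_le_left with hW | hW
  · refine Or.inl (le_bot_iff.1 fun q hq => ?_)
    have h1 := hincl q hq
    rw [hW, ← 𝒱.proj_eq_zero_iff (𝒱.incl_mem i q), proj_incl_self] at h1
    exact h1
  · refine Or.inr (top_le_iff.1 fun q _ => ?_)
    have h1 : 𝒱.proj i (𝒱.incl i q) ∈ K := (hW.ge (𝒱.incl_mem i q)).2
    rwa [proj_incl_self] at h1

end Induced

end SubspaceFlag

/-! ### Optimal spaces are the full ones; classification and uniqueness. -/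

section Optimal

variable {F D V : Type*} [Field F] [DivisionRing D] [Algebra F D]
  [AddCommGroup V] [Module Dᵐᵒᵖ V] [Module F V] [IsScalarTower F Dᵐᵒᵖ V]
  {σ : Dᵐᵒᵖ ≃ₐ[F] D} {e : D →ₗ[F] F} {S S' : Submodule F (Module.End Dᵐᵒᵖ V)}

/-- A space without proper nonzero subspaces carries a nonisotropic form. -/
theorem exists_isNonisotropic_of_isIrreducible_bot [Nontrivial V] (hp : IsQuadraticPair σ e)
    (h : IsIrreducible (⊥ : Submodule F (Module.End Dᵐᵒᵖ V))) :
    ∃ B : SesquilinearForm σ V, IsNonisotropic e B := by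
  obtain ⟨x, hx⟩ := exists_ne (0 : V)
  obtain ⟨β, hβ, -⟩ := exists_form_of_notMem (D := D) (G := ⊥) (x := x) (by simpa using hx)
  have hker : LinearMap.ker β = ⊥ := by
    rcases h (LinearMap.ker β) (fun u hu y hy => by
      rw [(Submodule.mem_bot F).1 hu]
      exact zero_mem _) with h0 | h0
    · exact h0
    · have h1 : β x = 0 := LinearMap.mem_ker.1 (by rw [h0]; trivial)
      exact absurd (hβ.symm.trans h1) one_ne_zero
  obtain ⟨c, hc⟩ := exists_apply_ne_zero hp.ne_zero
  -- For t ≠ 0, e(σ(t) c t) is a nonzero scalar times e(c), which was chosen nonzero.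
  let B : SesquilinearForm σ D := SesquilinearForm.ofFun (fun s t => σ (op s) * c * t)
    (fun s s' t => by rw [conj_add, add_mul, add_mul])
    (fun a s t => by rw [← op_unop a, op_smul_eq_mul, conj_mul, op_unop, mul_assoc, mul_assoc,
      mul_assoc])
    (fun s t t' => mul_add _ _ _)
    (fun a s t => by rw [← op_unop a, op_smul_eq_mul, op_unop, ← mul_assoc])
  have hB : IsNonisotropic e B := by
    intro t ht
    obtain ⟨q, hq, hqt⟩ := hp.exists_apply_conj_mul_mul ht
    change e (σ (op t) * c * t) ≠ 0
    rw [hqt]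
    exact mul_ne_zero hq hc
  exact ⟨SesquilinearForm.pullback B β, hB.pullback (LinearMap.ker_eq_bot.1 hker)⟩

variable [FiniteDimensional F D] [FiniteDimensional Dᵐᵒᵖ V]

/-- A maximal flag invariant under the zero space is a complete flag; its one-dimensional quotients
carry nonisotropic forms, and their joint attains the bound. -/
theorem exists_isFull (hp : IsQuadraticPair σ e) :
    ∃ S : Submodule F (Module.End Dᵐᵒᵖ V), IsFull S := by
  obtain ⟨𝒱, h𝒱, hmax⟩ :=
    SubspaceFlag.exists_maximal_invariant_flag (⊥ : Submodule F (Module.End Dᵐᵒᵖ V))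
  have hB : ∀ i, ∃ B : SesquilinearForm σ (𝒱.Subquotient i), IsNonisotropic e B := by
    intro i
    have := 𝒱.nontrivial_subquotient i
    apply exists_isNonisotropic_of_isIrreducible_bot hp
    have h := SubspaceFlag.isIrreducible_inducedSpace h𝒱 (hmax i)
    intro K hK
    refine h K ?_
    rintro _ ⟨u, hu, hs, rfl⟩ q hq
    rw [SubspaceFlag.induced_apply, (Submodule.mem_bot F).1 hu, LinearMap.zero_apply, map_zero]
    exact zero_mem _
  choose B hB using hB
  exact ⟨𝒱.altJoint e B, SubspaceFlag.isFull_joint fun i => isFull_altSpace hp (hB i)⟩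

theorem isOptimal_iff_isFull (hp : IsQuadraticPair σ e)
    (hF : (finrank F V : Cardinal) ≤ Cardinal.mk F) : IsOptimal S ↔ IsFull S := by
  constructor
  · rintro ⟨h1, h2⟩
    obtain ⟨T, hT⟩ := exists_isFull (F := F) (V := V) hp
    have h3 := h2 T hT.1
    have h4 := hT.2
    have h5 := h1.finrank_le hF
    exact ⟨h1, by omega⟩
  · rintro ⟨h1, h2⟩
    refine ⟨h1, fun T hT => ?_⟩
    have h3 := hT.finrank_le hF
    omega

theorem isOptimal_altJoint (hp : IsQuadraticPair σ e)
    (hF : (finrank F V : Cardinal) ≤ Cardinal.mk F) {𝒱 : SubspaceFlag D V}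
    {B : ∀ i, SesquilinearForm σ (𝒱.Subquotient i)} (hB : ∀ i, IsNonisotropic e (B i)) :
    IsOptimal (𝒱.altJoint e B) :=
  (isOptimal_iff_isFull hp hF).2
    (SubspaceFlag.isFull_joint fun i => isFull_altSpace hp (hB i))

theorem IsFull.exists_eq_altJoint (hS : IsFull S) (hp : IsQuadraticPair σ e)
    (hF : (finrank F V : Cardinal) ≤ Cardinal.mk F) :
    ∃ 𝒱 : SubspaceFlag D V, 𝒱.IsInvariantFlag S ∧
      ∃ B : ∀ i, SesquilinearForm σ (𝒱.Subquotient i),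
        (∀ i, IsNonisotropic e (B i)) ∧ S = 𝒱.altJoint e B := by
  obtain ⟨𝒱, h𝒱, hmax⟩ := SubspaceFlag.exists_maximal_invariant_flag S
  obtain ⟨hjoint, hfull⟩ := SubspaceFlag.eq_joint_inducedSpace hF hS h𝒱
  have hB : ∀ i, ∃ B : SesquilinearForm σ (𝒱.Subquotient i), IsNonisotropic e B ∧
      𝒱.inducedSpace S i = altSpace D (formComp e B) := fun i =>
    (SubspaceFlag.isIrreducible_inducedSpace h𝒱 (hmax i)).exists_sesquilinearForm
      ((Nat.cast_le.2 (SubspaceFlag.finrank_subquotient_le (F := F) i)).trans hF) (hfull i) hp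
  choose B hB hSB using hB
  refine ⟨𝒱, ?_, B, hB, ?_⟩
  · rw [hjoint]
    apply SubspaceFlag.isInvariantFlag_joint
    rw [← hjoint]
    exact hmax
  · rw [SubspaceFlag.altJoint, ← funext hSB]
    exact hjoint

omit [FiniteDimensional F D] [FiniteDimensional Dᵐᵒᵖ V] in
theorem exists_unit_smul_eq_of_altJoint_eq (hp : IsQuadraticPair σ e) {𝒱 : SubspaceFlag D V}
    {B B' : ∀ i, SesquilinearForm σ (𝒱.Subquotient i)} (hB : ∀ i, IsNonisotropic e (B i))
    (hB' : ∀ i, IsNonisotropic e (B' i)) (h : 𝒱.altJoint e B = 𝒱.altJoint e B')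
    (i : Fin 𝒱.length) : ∃ c : Fˣ, ∀ x y, B' i x y = c • B i x y :=
  have := 𝒱.nontrivial_subquotient i
  exists_unit_smul_eq_of_altSpace_le hp (hB i) (hB' i) (SubspaceFlag.le_of_joint_le h.le i)

omit [FiniteDimensional F D] [FiniteDimensional Dᵐᵒᵖ V] in
theorem exists_map_space_eq {φ : V ≃ₗ[Dᵐᵒᵖ] V} (hφ : ∀ u ∈ S,
      φ.toLinearMap ∘ₗ u ∘ₗ φ.symm.toLinearMap ∈ S')
    (hφ' : ∀ v ∈ S', φ.symm.toLinearMap ∘ₗ v ∘ₗ φ.toLinearMap ∈ S) {𝒱 𝒱' : SubspaceFlag D V}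
    (h𝒱 : 𝒱.IsInvariantFlag S) (h𝒱' : 𝒱'.IsInvariantFlag S') :
    ∃ h : 𝒱.length = 𝒱'.length, ∀ j,
      (𝒱.space j).map φ.toLinearMap = 𝒱'.space (Fin.cast (by rw [h]) j) := by
  have hmap : StrictMono fun j => (𝒱.space j).map φ.toLinearMap := fun i j h =>
    lt_of_le_of_ne (Submodule.map_mono (𝒱.strictMono h).le) fun heq =>
      (𝒱.strictMono h).ne (Submodule.map_injective_of_injective φ.injective heq)
  refine exists_eq_of_range_eq hmap 𝒱'.strictMono (Set.ext fun W => ⟨?_, ?_⟩)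
  · rintro ⟨j, rfl⟩
    refine (h𝒱' _).1 ?_
    rintro v hv _ ⟨x, hx, rfl⟩
    refine ⟨_, (h𝒱 _).2 ⟨j, rfl⟩ _ (hφ' v hv) x hx, ?_⟩
    simp
  · rintro ⟨j, rfl⟩
    obtain ⟨k, hk⟩ := (h𝒱 ((𝒱'.space j).comap φ.toLinearMap)).1 fun u hu x hx => by
      have := (h𝒱' _).2 ⟨j, rfl⟩ _ (hφ u hu) (φ x) hx
      simpa using this
    refine ⟨k, ?_⟩
    change (𝒱.space k).map φ.toLinearMap = 𝒱'.space j
    rw [hk, Submodule.map_comap_eq_of_surjective φ.surjective]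

-- Pull the second form back along the induced isomorphism ψ of quotients. Conjugation turns
-- operators alternating for the first form into operators alternating for the pullback, and
-- uniqueness up to a scalar applies.
omit [FiniteDimensional F D] [FiniteDimensional Dᵐᵒᵖ V] in
theorem exists_equiv_of_conj (hp : IsQuadraticPair σ e) {φ : V ≃ₗ[Dᵐᵒᵖ] V}
    {𝒱 𝒱' : SubspaceFlag D V} {B : ∀ i, SesquilinearForm σ (𝒱.Subquotient i)}
    {B' : ∀ i, SesquilinearForm σ (𝒱'.Subquotient i)} (hB : ∀ i, IsNonisotropic e (B i))
    (hB' : ∀ i, IsNonisotropic e (B' i)) (hφ : ∀ u ∈ 𝒱.altJoint e B,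
      φ.toLinearMap ∘ₗ u ∘ₗ φ.symm.toLinearMap ∈ 𝒱'.altJoint e B')
    {i : Fin 𝒱.length} {i' : Fin 𝒱'.length}
    (h1 : ∀ x, φ x ∈ 𝒱'.space i'.castSucc ↔ x ∈ 𝒱.space i.castSucc)
    (h2 : ∀ x, φ x ∈ 𝒱'.space i'.succ ↔ x ∈ 𝒱.space i.succ) :
    ∃ (c : Fˣ) (ψ : 𝒱.Subquotient i ≃ₗ[Dᵐᵒᵖ] 𝒱'.Subquotient i'),
      ∀ x y, B' i' (ψ x) (ψ y) = c • B i x y := by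
  have := 𝒱.nontrivial_subquotient i
  obtain ⟨ψ, hψ⟩ := SubspaceFlag.exists_subquotient_equiv φ h1 h2
  have hle : altSpace D (formComp e (B i)) ≤
      altSpace D (formComp e (SesquilinearForm.pullback (B' i') ψ.toLinearMap)) := by
    intro t ht
    obtain ⟨hs, hv⟩ := hφ _ (SubspaceFlag.incl_comp_proj_mem_joint ht)
    refine mem_altSpace.2 fun q => ?_
    rw [SesquilinearForm.pullback_apply]
    have h3 := mem_altSpace.1 (hv i') (ψ q)
    have hq := 𝒱.incl_mem i q
    have h4 : 𝒱'.induced _ hs i' (ψ q) = ψ (t q) := by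
      conv_lhs => rw [← 𝒱.proj_incl_self i q, hψ _ hq]
      rw [SubspaceFlag.induced_proj hs ((h2 _).2 hq)]
      simp only [LinearMap.comp_apply, LinearEquiv.coe_coe, LinearEquiv.symm_apply_apply,
        SubspaceFlag.proj_incl_self]
      rw [← hψ _ (𝒱.incl_mem i _), SubspaceFlag.proj_incl_self]
    rw [h4] at h3
    exact h3
  obtain ⟨c, hc⟩ := exists_unit_smul_eq_of_altSpace_le hp (hB i) ((hB' i').pullback ψ.injective) hle
  exact ⟨c, ψ, hc⟩

end Optimal

end TrivialSpectrum

/-! ### The main theorem. -/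

theorem mainTheorem6 {F D V : Type*} [Field F] [DivisionRing D] [Algebra F D]
    [FiniteDimensional F D] [AddCommGroup V] [Module Dᵐᵒᵖ V] [Module F V]
    [IsScalarTower F Dᵐᵒᵖ V] [FiniteDimensional Dᵐᵒᵖ V] [Nontrivial V]
    (σ : Dᵐᵒᵖ ≃ₐ[F] D) (e : D →ₗ[F] F) (hσe : TrivialSpectrum.IsAssociatedPair σ e)
    (hF : ((Module.finrank Dᵐᵒᵖ V * Module.finrank F D : ℕ) : Cardinal) ≤ Cardinal.mk F) :
    -- existence of the flag and of the forms, uniqueness of the forms up to `Fˣ`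
    (∀ S : Submodule F (Module.End Dᵐᵒᵖ V), TrivialSpectrum.IsOptimal S →
      ∃ 𝒱 : TrivialSpectrum.SubspaceFlag D V, 𝒱.IsInvariantFlag S ∧
        ∃ B : ∀ i : Fin 𝒱.length, TrivialSpectrum.SesquilinearForm σ (𝒱.Subquotient i),
          (∀ i, TrivialSpectrum.IsNonisotropic e (B i)) ∧ S = 𝒱.altJoint e B ∧
          ∀ B' : ∀ i : Fin 𝒱.length, TrivialSpectrum.SesquilinearForm σ (𝒱.Subquotient i),
            (∀ i, TrivialSpectrum.IsNonisotropic e (B' i)) → S = 𝒱.altJoint e B' →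
            ∀ i, ∃ c : Fˣ, ∀ x y, B' i x y = c • B i x y) ∧
    -- the forms attached to conjugate spaces are equivalent up to `Fˣ`
    (∀ S S' : Submodule F (Module.End Dᵐᵒᵖ V), TrivialSpectrum.IsOptimal S →
      TrivialSpectrum.IsOptimal S' → TrivialSpectrum.AreConjugate S S' →
      ∀ (𝒱 𝒱' : TrivialSpectrum.SubspaceFlag D V),
        𝒱.IsInvariantFlag S → 𝒱'.IsInvariantFlag S' →
        ∀ (B : ∀ i : Fin 𝒱.length, TrivialSpectrum.SesquilinearForm σ (𝒱.Subquotient i))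
          (B' : ∀ i : Fin 𝒱'.length, TrivialSpectrum.SesquilinearForm σ (𝒱'.Subquotient i)),
          (∀ i, TrivialSpectrum.IsNonisotropic e (B i)) →
          (∀ i, TrivialSpectrum.IsNonisotropic e (B' i)) →
          S = 𝒱.altJoint e B → S' = 𝒱'.altJoint e B' →
          ∃ h : 𝒱.length = 𝒱'.length, ∀ i : Fin 𝒱.length,
            ∃ (c : Fˣ) (ψ : 𝒱.Subquotient i ≃ₗ[Dᵐᵒᵖ] 𝒱'.Subquotient (Fin.cast h i)),
              ∀ x y, B' (Fin.cast h i) (ψ x) (ψ y) = c • B i x y) ∧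
    -- converse
    (∀ (𝒱 : TrivialSpectrum.SubspaceFlag D V)
      (B : ∀ i : Fin 𝒱.length, TrivialSpectrum.SesquilinearForm σ (𝒱.Subquotient i)),
      (∀ i, TrivialSpectrum.IsNonisotropic e (B i)) →
        TrivialSpectrum.IsOptimal (𝒱.altJoint e B)) := by
  have hp := hσe.isQuadraticPair
  -- The cardinality hypothesis becomes |F| ≥ dim V over F.
  rw [← TrivialSpectrum.finrank_of_tower F D V] at hF
  refine ⟨fun S hS => ?_, fun S S' hS hS' hSS' 𝒱 𝒱' h𝒱 h𝒱' B B' hB hB' hSB hSB' => ?_,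
    fun 𝒱 B hB => TrivialSpectrum.isOptimal_altJoint hp hF hB⟩
  · obtain ⟨𝒱, h𝒱, B, hB, hSB⟩ :=
      ((TrivialSpectrum.isOptimal_iff_isFull hp hF).1 hS).exists_eq_altJoint hp hF
    exact ⟨𝒱, h𝒱, B, hB, hSB, fun B' hB' hSB' =>
      TrivialSpectrum.exists_unit_smul_eq_of_altJoint_eq hp hB hB' (hSB.symm.trans hSB')⟩
  · obtain ⟨φ, hφ⟩ := hSS'
    have h1 : ∀ u ∈ S, φ.toLinearMap ∘ₗ u ∘ₗ φ.symm.toLinearMap ∈ S' :=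
      fun u hu => (hφ _).2 ⟨u, hu, rfl⟩
    have h2 : ∀ v ∈ S', φ.symm.toLinearMap ∘ₗ v ∘ₗ φ.toLinearMap ∈ S := by
      intro v hv
      obtain ⟨u, hu, rfl⟩ := (hφ v).1 hv
      convert hu using 1
      ext x
      simp
    obtain ⟨hlen, hspace⟩ := TrivialSpectrum.exists_map_space_eq h1 h2 h𝒱 h𝒱'
    have hmem : ∀ j x, φ x ∈ 𝒱'.space (Fin.cast (by rw [hlen]) j) ↔ x ∈ 𝒱.space j := by
      intro j x
      rw [← hspace]
      exact ⟨fun ⟨y, hy, hyx⟩ => φ.injective hyx ▸ hy, fun hx => ⟨x, hx, rfl⟩⟩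
    rw [hSB, hSB'] at h1
    exact ⟨hlen, fun i => TrivialSpectrum.exists_equiv_of_conj hp hB hB' h1
      (hmem i.castSucc) (hmem i.succ)⟩
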